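/- **Setting.** Let $d\ge 1$, $S\ge 1$, and fix a compactly supported orthonormal wavelet basis of $L^2([0,1]^d)$ of Cohen–Daubechies–Vial type and of regularity $S$, with continuous generators: scaling functions $\Phi_{l\boldsymbol m}$ and wavelets $\Psi^{\boldsymbol\iota}_{l\boldsymbol m}$, $l\ge J_0$, $\boldsymbol m\in\{0,\dots,2^l-1\}^d$, $\boldsymbol\iota\in\{0,1\}^d\setminus\{\boldsymbol 0\}$, are tensor products of boundary-adapted dilates and translates of univariate scaling functions and wavelets; $V_l=\mathrm{span}\{\Phi_{l\boldsymbol m}\}$ is a multiresolution analysis, and contains all polynomials of degree at most $S-1$. For $k=2^{jd}$ with $j\ge J_0$ let $K_{V_k}(\boldsymbol x,\boldsymbol y)=\sum_{\boldsymbol m}\Phi_{j\boldsymbol m}(\boldsymbol x)\Phi_{j\boldsymbol m}(\boldsymbol y)$. For $0<\alpha<S$ and $M>0$ let $H(\alpha,M)$ be the set of uniformly continuous $h$ on $[0,1]^d$ with $$2^{J_0(\alpha+d/2)}\max_{\boldsymbol m}|\langle h,\Phi_{J_0\boldsymbol m}\rangle|+\sup_{l\ge J_0,\boldsymbol m,\boldsymbol\iota}2^{l(\alpha+d/2)}|\langle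 h,\Psi^{\boldsymbol\iota}_{l\boldsymbol m}\rangle|\le M .$$ For $0<\alpha,\beta<S$, $M>0$ and $C_1,C_2\in\mathbb R$, let $\mathcal P_{(\alpha,\beta)}$ be the set of laws $\mathbb P$ of $(\boldsymbol X,A,Y)\in\mathbb R^d\times\mathbb R\times\mathbb R$ with $\boldsymbol X\sim\mathrm{Uniform}([0,1]^d)$, $A,Y\in[C_1,C_2]$ a.s., $p(\boldsymbol x)=\mathbb E_{\mathbb P}[A\mid\boldsymbol X=\boldsymbol x]\in H(\alpha,M)$ and $b(\boldsymbol x)=\mathbb E_{\mathbb P}[Y\mid\boldsymbol X=\boldsymbol x]\in H(\beta,M)$. Assume that this model is non-degenerate: each of $H(\alpha,M)$ and $H(\beta,M)$ contains a function with all its values in the open interval $(C_1,C_2)$ (this is automatic if $C_1\le 0\le C_2$ and $C_1<C_2$). Let $\psi(\mathbb P)=\mathbb E_{\mathbb P}[\mathrm{Cov}_{\mathbb P}(A,Y\mid\boldsymbol X)]$. Given i.i.d. observations from $\mathbb P$ in disjoint subsamples $\mathcal D_1,\mathcal D_2,\mathcal D_3$, each of size $n$, put $\hat p_{k}(\boldsymbol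 x)=\frac1n\sum_{i\in\mathcal D_1}A_iK_{V_k}(\boldsymbol X_i,\boldsymbol x)$, $\hat b_{k}(\boldsymbol x)=\frac1n\sum_{i\in\mathcal D_1}Y_iK_{V_k}(\boldsymbol X_i,\boldsymbol x)$ (single sample splitting: both are fitted on $\mathcal D_1$), and \begin{align*} \hat\psi^{\mathrm{INT}}_{k_1,k_2}&=\tfrac1n\sum_{i\in\mathcal D_2}A_iY_i-\int_{[0,1]^d}\hat p_{k_1}(\boldsymbol x)\hat b_{k_2}(\boldsymbol x)\,d\boldsymbol x,\\ \hat\psi^{\mathrm{MC}}_{k_1,k_2}&=\tfrac1n\sum_{i\in\mathcal D_2}A_iY_i-\tfrac1n\sum_{i\in\mathcal D_3}\hat p_{k_1}(\boldsymbol X_i)\hat b_{k_2}(\boldsymbol X_i),\\ \hat\psi^{\mathrm{IF}}_{k_1,k_2}&=\tfrac1n\sum_{i\in\mathcal D_2}(A_i-\hat p_{k_1}(\boldsymbol X_i))(Y_i-\hat b_{k_2}(\boldsymbol X_i)). \end{align*} **Theorem.** There are constants $0<c\le C<\infty$, depending only on $d,\alpha,\beta,M,C_1,C_2$ and the wavelet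 basis, such that for all $n\ge1$ and all $k_1=2^{j_1d}$, $k_2=2^{j_2d}$ with $j_1,j_2\ge J_0$, writing $k_{\min}=k_1\wedge k_2$, $k_{\max}=k_1\vee k_2$, all three estimators are square integrable under every $\mathbb P\in\mathcal P_{(\alpha,\beta)}$, and the following hold, where $a\lesssim b$ means $a\le Cb$ and $a\asymp b$ means $cb\le a\le Cb$. 1. $\displaystyle\sup_{\mathbb P\in\mathcal P_{(\alpha,\beta)}}\left|\mathbb E_{\mathbb P}(\hat\psi^{\mathrm{INT}}_{k_1,k_2}-\psi(\mathbb P))\right|\asymp k_{\min}^{-(\alpha+\beta)/d}\vee\frac{k_{\min}}n$ and $\displaystyle\sup_{\mathbb P\in\mathcal P_{(\alpha,\beta)}}\mathrm{Var}_{\mathbb P}(\hat\psi^{\mathrm{INT}}_{k_1,k_2})\lesssim\frac1n+\frac{k_{\min}^2}{n^2}$. 2. $\displaystyle\sup_{\mathbb P\in\mathcal P_{(\alpha,\beta)}}\left|\mathbb E_{\mathbb P}(\hat\psi^{\mathrm{MC}}_{k_1,k_2}-\psi(\mathbb P))\right|\asymp k_{\min}^{-(\alpha+\beta)/d}\vee\frac{k_{\min}}n$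 and $\displaystyle\sup_{\mathbb P\in\mathcal P_{(\alpha,\beta)}}\mathrm{Var}_{\mathbb P}(\hat\psi^{\mathrm{MC}}_{k_1,k_2})\lesssim\frac1n+\frac{k_{\min}^2}{n^2}+\frac{k_{\max}}{n^2}+\frac{k_{\min}k_{\max}}{n^3}+\frac{k_{\min}^2k_{\max}}{n^4}$. 3. $\displaystyle\sup_{\mathbb P\in\mathcal P_{(\alpha,\beta)}}\left|\mathbb E_{\mathbb P}(\hat\psi^{\mathrm{IF}}_{k_1,k_2}-\psi(\mathbb P))\right|\asymp k_{\max}^{-(\alpha+\beta)/d}\vee\frac{k_{\min}}n$ and $\displaystyle\sup_{\mathbb P\in\mathcal P_{(\alpha,\beta)}}\mathrm{Var}_{\mathbb P}(\hat\psi^{\mathrm{IF}}_{k_1,k_2})\lesssim\frac1n+\frac{k_{\min}^2}{n^2}+\frac{k_{\max}}{n^2}+\frac{k_{\min}k_{\max}}{n^3}+\frac{k_{\min}^2k_{\max}}{n^4}$. -/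

import Mathlib

open MeasureTheory ProbabilityTheory Set
open scoped ENNReal

noncomputable section

/-- The boundary-adapted dyadic family on `[0,1]` at level `l`, generated by an interior function
`f`, left edge functions `fL 0, …, fL (N-1)` and right edge functions `fR 0, …, fR (N-1)`.
Its members are indexed by `m = 0, …, 2 ^ l - 1`: for `m < N` the dilated left edge functions, for
`N ≤ m < 2 ^ l - N` the functions `2^{l/2} f(2^l x - m)`, and for `2 ^ l - N ≤ m < 2 ^ l` the
dilated right edge functions, reflected at `1`. -/
def boundaryFamily (N : ℕ) (f : ℝ → ℝ) (fL fR : ℕ → ℝ → ℝ) (l m : ℕ) (x : ℝ) : ℝ :=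
  Real.sqrt (2 ^ l) *
    (if m < N then fL m (2 ^ l * x)
     else if m + N < 2 ^ l then f (2 ^ l * x - m)
     else fR (2 ^ l - 1 - m) (2 ^ l * (1 - x)))

/-- A compactly supported orthonormal wavelet basis of `L²([0,1])` of Cohen–Daubechies–Vial type,
of regularity `S`: a multiresolution analysis of `L²([0,1])` starting at level `J₀` whose level `l`
scaling functions (and level `l` wavelets) are `2 ^ l - 2 N` dilated translates of one compactly
supported function inside `(0,1)`, and `N` dilated edge functions at each end point. The spaces
`V_l` contain the polynomials of degree at most `S - 1`. Of smoothness, only the continuity of the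
generators is asked for. -/
structure CDVBasis (S : ℕ) where
  /-- number of edge functions at each end point -/
  N : ℕ
  /-- coarsest level -/
  J₀ : ℕ
  /-- scaling function -/
  φ : ℝ → ℝ
  /-- wavelet function -/
  ψ : ℝ → ℝ
  /-- left and right edge scaling functions, on `[0,∞)`, with indices `k < N` -/
  φL : ℕ → ℝ → ℝ
  φR : ℕ → ℝ → ℝ
  /-- left and right edge wavelets, on `[0,∞)`, with indices `k < N` -/
  ψL : ℕ → ℝ → ℝ
  ψR : ℕ → ℝ → ℝ
  one_le_J₀ : 1 ≤ J₀
  S_le : S ≤ 2 ^ J₀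
  two_N_le : 2 * N ≤ 2 ^ J₀
  continuous_φ : Continuous φ
  continuous_ψ : Continuous ψ
  continuousOn_edge : ∀ k < N, ContinuousOn (φL k) (Ici 0) ∧ ContinuousOn (φR k) (Ici 0) ∧
    ContinuousOn (ψL k) (Ici 0) ∧ ContinuousOn (ψR k) (Ici 0)
  support_φ : Function.support φ ⊆ Icc (1 - (N : ℝ)) N
  support_ψ : Function.support ψ ⊆ Icc (1 - (N : ℝ)) N
  support_edge : ∃ R : ℝ, ∀ k < N, ∀ x > R, φL k x = 0 ∧ φR k x = 0 ∧ ψL k x = 0 ∧ ψR k x = 0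
  /-- at each level, the scaling functions and the wavelets together are orthonormal -/
  orthonormal_scal : ∀ l ≥ J₀, ∀ m < 2 ^ l, ∀ m' < 2 ^ l,
    ∫ x in Icc (0 : ℝ) 1, boundaryFamily N φ φL φR l m x * boundaryFamily N φ φL φR l m' x
      = if m = m' then 1 else 0
  orthonormal_wav : ∀ l ≥ J₀, ∀ m < 2 ^ l, ∀ m' < 2 ^ l,
    ∫ x in Icc (0 : ℝ) 1, boundaryFamily N ψ ψL ψR l m x * boundaryFamily N ψ ψL ψR l m' x
      = if m = m' then 1 else 0
  orthogonal_scal_wav : ∀ l ≥ J₀, ∀ m < 2 ^ l, ∀ m' < 2 ^ l,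
    ∫ x in Icc (0 : ℝ) 1, boundaryFamily N φ φL φR l m x * boundaryFamily N ψ ψL ψR l m' x = 0
  /-- `V_{l+1} = V_l + W_l`, as spaces of functions on `[0,1]` -/
  multiresolution : ∀ l ≥ J₀,
    Submodule.span ℝ (range fun m : Fin (2 ^ (l + 1)) =>
        (Icc (0 : ℝ) 1).domRestrict (boundaryFamily N φ φL φR (l + 1) m)) =
      Submodule.span ℝ (range fun m : Fin (2 ^ l) =>
        (Icc (0 : ℝ) 1).domRestrict (boundaryFamily N φ φL φR l m)) ⊔
      Submodule.span ℝ (range fun m : Fin (2 ^ l) =>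
        (Icc (0 : ℝ) 1).domRestrict (boundaryFamily N ψ ψL ψR l m))
  /-- the union of the `V_l` is dense in `L²([0,1])` -/
  complete : ∀ f : ℝ → ℝ, MemLp f 2 (volume.restrict (Icc (0 : ℝ) 1)) →
    (∀ l ≥ J₀, ∀ m < 2 ^ l, ∫ x in Icc (0 : ℝ) 1, f x * boundaryFamily N φ φL φR l m x = 0) →
    f =ᵐ[volume.restrict (Icc (0 : ℝ) 1)] 0
  /-- `V_l` contains the polynomials of degree at most `S - 1` -/
  polynomials : ∀ l ≥ J₀, ∀ r < S,
    (Icc (0 : ℝ) 1).domRestrict (fun x : ℝ => x ^ r) ∈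
      Submodule.span ℝ (range fun m : Fin (2 ^ l) =>
        (Icc (0 : ℝ) 1).domRestrict (boundaryFamily N φ φL φR l m))

namespace CDVBasis

variable {S : ℕ} (B : CDVBasis S) {d : ℕ}

/-- The univariate scaling functions at level `l`. -/
def scal (l m : ℕ) : ℝ → ℝ := boundaryFamily B.N B.φ B.φL B.φR l m

/-- The univariate wavelets at level `l`. -/
def wav (l m : ℕ) : ℝ → ℝ := boundaryFamily B.N B.ψ B.ψL B.ψR l m

/-- The tensor product scaling functions `Φ_{l m}` on `[0,1]^d`. -/
def Phi (l : ℕ) (m : Fin d → Fin (2 ^ l)) (x : Fin d → ℝ) : ℝ :=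
  ∏ i, B.scal l (m i) (x i)

/-- The tensor product wavelets `Ψ^ι_{l m}` on `[0,1]^d` (used for `ι ≠ 0`). -/
def Psi (l : ℕ) (ι : Fin d → Bool) (m : Fin d → Fin (2 ^ l)) (x : Fin d → ℝ) : ℝ :=
  ∏ i, if ι i then B.wav l (m i) (x i) else B.scal l (m i) (x i)

/-- The kernel of the orthogonal projection onto `V_k`, `k = 2 ^ (j d)`. -/
def kernel (j : ℕ) (x y : Fin d → ℝ) : ℝ :=
  ∑ m : Fin d → Fin (2 ^ j), B.Phi j m x * B.Phi j m y

/-- The Hölder–Zygmund ball `H(α, M)` on `[0,1]^d`, defined through wavelet coefficients. -/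
def holderBall (d : ℕ) (α M : ℝ) : Set ((Fin d → ℝ) → ℝ) :=
  {h | UniformContinuousOn h (Icc 0 1) ∧
    (⨆ m : Fin d → Fin (2 ^ B.J₀), ENNReal.ofReal ((2 : ℝ) ^ ((B.J₀ : ℝ) * (α + d / 2)) *
        |∫ x in Icc (0 : Fin d → ℝ) 1, h x * B.Phi B.J₀ m x|)) +
      (⨆ (l : ℕ) (_ : B.J₀ ≤ l) (m : Fin d → Fin (2 ^ l)) (ι : Fin d → Bool)
        (_ : ι ≠ fun _ => false), ENNReal.ofReal ((2 : ℝ) ^ ((l : ℝ) * (α + d / 2)) *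
          |∫ x in Icc (0 : Fin d → ℝ) 1, h x * B.Psi l ι m x|))
      ≤ ENNReal.ofReal M}

end CDVBasis

/-- An observation `O = (X, A, Y)`. -/
abbrev Obs (d : ℕ) : Type := (Fin d → ℝ) × ℝ × ℝ

namespace Obs

variable {d : ℕ}

/-- The covariates. -/
def X (o : Obs d) : Fin d → ℝ := o.1

/-- The first response (exposure). -/
def A (o : Obs d) : ℝ := o.2.1

/-- The second response (outcome). -/
def Y (o : Obs d) : ℝ := o.2.2

/-- The σ-algebra generated by the covariates. -/
abbrev sigmaX (d : ℕ) : MeasurableSpace (Obs d) := MeasurableSpace.comap X inferInstance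

end Obs

/-- The functional `ψ(P) = E_P[Cov_P(A, Y | X)]`. -/
def expCondCov {d : ℕ} (P : Measure (Obs d)) : ℝ :=
  ∫ o, (P[fun o' => (o'.A - (P[Obs.A | Obs.sigmaX d]) o') *
    (o'.Y - (P[Obs.Y | Obs.sigmaX d]) o') | Obs.sigmaX d]) o ∂P

/-- The model `𝒫_{(α,β)}`: laws of `(X, A, Y)` with `X` uniform on `[0,1]^d`, `A, Y ∈ [C₁, C₂]`
almost surely, and regression functions `p ∈ H(α, M)` of `A` and `b ∈ H(β, M)` of `Y` on `X`. -/
def model {S : ℕ} (B : CDVBasis S) (d : ℕ) (α β M C₁ C₂ : ℝ) : Set (Measure (Obs d)) :=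
  {P | IsProbabilityMeasure P ∧
    P.map Obs.X = volume.restrict (Icc (0 : Fin d → ℝ) 1) ∧
    (∀ᵐ o ∂P, o.A ∈ Icc C₁ C₂ ∧ o.Y ∈ Icc C₁ C₂) ∧
    (∃ p ∈ B.holderBall d α M, P[Obs.A | Obs.sigmaX d] =ᵐ[P] fun o => p o.X) ∧
    (∃ b ∈ B.holderBall d β M, P[Obs.Y | Obs.sigmaX d] =ᵐ[P] fun o => b o.X)}

/-- A sample that is split into three disjoint subsamples of size `n`. -/
abbrev Sample (d n : ℕ) : Type := Fin 3 × Fin n → Obs d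

/-- The law of a sample of i.i.d. observations from `P`. -/
def sampleLaw {d : ℕ} (n : ℕ) (P : Measure (Obs d)) : Measure (Sample d n) :=
  Measure.pi fun _ => P

namespace CDVBasis

variable {S : ℕ} (B : CDVBasis S) {d n : ℕ}

/-- The approximate wavelet projection estimator of `p` from subsample `s`, with `k = 2 ^ (j d)`. -/
def pHat (j : ℕ) (s : Fin 3) (ω : Sample d n) (x : Fin d → ℝ) : ℝ :=
  (1 / n : ℝ) * ∑ i : Fin n, (ω (s, i)).A * B.kernel j (ω (s, i)).X x

/-- The approximate wavelet projection estimator of `b` from subsample `s`, with `k = 2 ^ (j d)`. -/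
def bHat (j : ℕ) (s : Fin 3) (ω : Sample d n) (x : Fin d → ℝ) : ℝ :=
  (1 / n : ℝ) * ∑ i : Fin n, (ω (s, i)).Y * B.kernel j (ω (s, i)).X x

/-- The integral-based plug-in estimator with single sample splitting: both nuisance functions are
fitted on subsample `0`. -/
def psiINT (j₁ j₂ : ℕ) (ω : Sample d n) : ℝ :=
  (1 / n : ℝ) * ∑ i : Fin n, (ω (1, i)).A * (ω (1, i)).Y -
    ∫ x in Icc (0 : Fin d → ℝ) 1, B.pHat j₁ 0 ω x * B.bHat j₂ 0 ω x

/-- The Monte Carlo-based plug-in estimator with single sample splitting. -/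
def psiMC (j₁ j₂ : ℕ) (ω : Sample d n) : ℝ :=
  (1 / n : ℝ) * ∑ i : Fin n, (ω (1, i)).A * (ω (1, i)).Y -
    (1 / n : ℝ) * ∑ i : Fin n, B.pHat j₁ 0 ω (ω (2, i)).X * B.bHat j₂ 0 ω (ω (2, i)).X

/-- The first-order bias-corrected estimator with single sample splitting. -/
def psiIF (j₁ j₂ : ℕ) (ω : Sample d n) : ℝ :=
  (1 / n : ℝ) * ∑ i : Fin n,
    ((ω (1, i)).A - B.pHat j₁ 0 ω (ω (1, i)).X) * ((ω (1, i)).Y - B.bHat j₂ 0 ω (ω (1, i)).X)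

end CDVBasis

/-- The worst-case absolute bias `sup_P |E_P(T - ψ(P))|` of an estimator `T` over a set of laws. -/
def supBias {d n : ℕ} (Q : Set (Measure (Obs d))) (T : Sample d n → ℝ) : ℝ≥0∞ :=
  ⨆ P ∈ Q, ENNReal.ofReal |∫ ω, (T ω - expCondCov P) ∂(sampleLaw n P)|

/-- The worst-case variance `sup_P Var_P(T)` of an estimator `T` over a set of laws. -/
def supVar {d n : ℕ} (Q : Set (Measure (Obs d))) (T : Sample d n → ℝ) : ℝ≥0∞ :=
  ⨆ P ∈ Q, evariance T (sampleLaw n P)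

/-- The estimator `T` has a finite second moment under every law of the set, so that its
expectation and its variance are the genuine ones. -/
def SquareIntegrableOver {d n : ℕ} (Q : Set (Measure (Obs d))) (T : Sample d n → ℝ) : Prop :=
  ∀ P ∈ Q, MemLp T 2 (sampleLaw n P)

end

noncomputable section

/-! ### Boundary-adapted families on the unit interval -/

section Family

variable {N : ℕ} {f : ℝ → ℝ} {fL fR : ℕ → ℝ → ℝ}

/-! Everything rests on one algebraic fact: projections onto nested spaces compose to the coarser
one, so `∫ K_{j₁}(x,z) K_{j₂}(y,z) dz = K_{min j₁ j₂}(x,y)` (`integral_kernel_mul_kernel`). Hence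
the integral of the product of the two fitted functions is an inner product of two averages, of `A
e(X)` and of `Y e(X)`, where `e` collects the scaling functions of the coarser level
(`integral_fitted_mul_fitted`). Pairs of distinct observations contribute `⟨Π p, Π b⟩`, which is
`projForm`; the diagonal terms, present because both fits use the same subsample, contribute `E[A Y
K(X,X)] / n`, of order at most `k_min / n`.

This gives exact biases (`bias_psiINT`, `bias_psiMC`, `bias_psiIF`). For the plug-in estimators the
bias is the approximation error `∫ p b - ⟨Π p, Π b⟩` at the coarser level minus the diagonal noise.
For the bias-corrected estimator the two cross terms have means `projForm j₁` and `projForm j₂`;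
their sum is the value at the coarser level plus the value at the finer one, so the coarser value
cancels against the plug-in term and the approximation error moves to the finer level, while the
noise changes sign. `HasPlugInBias` records this common shape, and the two bias bounds are proved
once for it.

Upper bound on the bias (`exists_supBias_le`): passing from level `l` to `l + 1` changes `projForm`
by `2 ^ (l d)` products of wavelet coefficients, hence by `O(2 ^ (-l (α + β)))`. The kernels are an
approximate identity, so `projForm` converges to `∫ p b`, and the error is a geometric tail.

Lower bound on the bias (`exists_le_supBias`): take `A = p(X) + ε η`, `Y = b(X) + ε η` with an
independent random sign `ε`. Passing from `η = 0` to a fixed `η` shifts the bias by exactly `± η²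
k_min / n`, so one of the two laws has bias of that order. For the approximation term, `p` and `b`
are perturbed by signed multiples of a sum `u` of wavelets at the level `l` of the approximation
error; `u` is orthogonal to `V_l`, so no projection sees it, and the alternating sum of the bias
over the four sign choices isolates `∫ u² (1 + σ K(x,x) / n)`. This is at least half of `∫ u²`
unless `k_min / n` is bounded below, and then the noise alone dominates both rates.

Variances: the plug-in term splits into two linear averages, whose summands are bounded
independently of the level because the kernels are bounded in `L¹`, and a degenerate bilinear part,
controlled by a mixed fourth moment (`integral_norm_sum_sq_mul_le`). The other two estimators are
averages given the fitted functions; their additional error is `1 / n` times the mean square of a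
summand, estimated in `integral_fitted_sq_mul_le`. Throughout, covariates are clamped to the cube
and responses clipped to `[C₁, C₂]`; this changes nothing almost surely and makes all statistics
bounded and measurable. -/

theorem exists_bound_of_continuousOn_Ici {g : ℝ → ℝ} (hg : ContinuousOn g (Ici 0)) {R : ℝ}
    (hR : ∀ x > R, g x = 0) : ∃ D, ∀ x, 0 ≤ x → |g x| ≤ D := by
  obtain ⟨D, hD⟩ := (isCompact_Icc (a := (0 : ℝ)) (b := R)).exists_bound_of_continuousOn
    (hg.mono Icc_subset_Ici_self)
  refine ⟨max D 0, fun x hx => ?_⟩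
  rcases le_or_gt x R with h | h
  · exact (hD x ⟨hx, h⟩).trans (le_max_left _ _)
  · simp [hR x h]

theorem exists_uniform_bound {P : ℕ → ℝ → Prop} (hP : ∀ k, ∀ a b, a ≤ b → P k a → P k b)
    (N : ℕ) (h : ∀ k < N, ∃ D, P k D) : ∃ D, ∀ k < N, P k D := by
  induction N with
  | zero => exact ⟨0, by simp⟩
  | succ N ih =>
    obtain ⟨D, hD⟩ := ih fun k hk => h k (by omega)
    obtain ⟨D', hD'⟩ := h N (by omega)
    refine ⟨max D D', fun k hk => ?_⟩
    rcases Nat.lt_succ_iff_lt_or_eq.1 hk with hk | rfl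
    · exact hP _ _ _ (le_max_left _ _) (hD k hk)
    · exact hP _ _ _ (le_max_right _ _) hD'

theorem boundaryFamily_localized (hf : Continuous f)
    (hs : Function.support f ⊆ Icc (1 - (N : ℝ)) N)
    (he : ∀ k < N, ContinuousOn (fL k) (Ici 0) ∧ ContinuousOn (fR k) (Ici 0))
    {R : ℝ} (hR : ∀ k < N, ∀ x > R, fL k x = 0 ∧ fR k x = 0) :
    ∃ D : ℝ, 1 ≤ D ∧ ∀ l m : ℕ, ∀ x : ℝ, m < 2 ^ l → x ∈ Icc (0 : ℝ) 1 →
      |boundaryFamily N f fL fR l m x| ≤ D * Real.sqrt (2 ^ l) ∧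
      (D < |2 ^ l * x - m| → boundaryFamily N f fL fR l m x = 0) := by
  obtain ⟨D₁, h1⟩ := exists_uniform_bound
    (P := fun k D => ∀ x, 0 ≤ x → |fL k x| ≤ D ∧ |fR k x| ≤ D)
    (fun k a b hab h x hx => ⟨(h x hx).1.trans hab, (h x hx).2.trans hab⟩) N
    (fun k hk => by
      obtain ⟨a, ha⟩ := exists_bound_of_continuousOn_Ici (he k hk).1 (fun x hx => (hR k hk x hx).1)
      obtain ⟨b, hb⟩ := exists_bound_of_continuousOn_Ici (he k hk).2 (fun x hx => (hR k hk x hx).2)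
      exact ⟨max a b, fun x hx => ⟨(ha x hx).trans (le_max_left _ _),
        (hb x hx).trans (le_max_right _ _)⟩⟩)
  obtain ⟨D₂, h2⟩ := (isCompact_Icc (a := 1 - (N : ℝ)) (b := N)).exists_bound_of_continuousOn
    hf.continuousOn
  have h2' : ∀ x, |f x| ≤ max D₂ 0 := fun x => by
    by_cases hx : x ∈ Icc (1 - (N : ℝ)) N
    · exact (h2 x hx).trans (le_max_left _ _)
    · have : f x = 0 := by
        by_contra h
        exact hx (hs h)
      simp [this]
  -- One constant serves for size and for localization: `R` covers the supports of the edge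
  -- functions, and `N` covers both the interior support and the distance between an edge index and
  -- its end point.
  set D := 1 + |D₁| + |D₂| + |R| + N with hDdef
  have hN : (0 : ℝ) ≤ N := N.cast_nonneg
  have a1 := abs_nonneg D₁
  have a2 := abs_nonneg D₂
  have a3 := abs_nonneg R
  refine ⟨D, by linarith, fun l m x hm hx => ?_⟩
  have hp : (0 : ℝ) < 2 ^ l := by positivity
  have hm' : (m : ℝ) + 1 ≤ 2 ^ l := by exact_mod_cast hm
  have hm0 : (0 : ℝ) ≤ m := m.cast_nonneg
  have hx0 : 0 ≤ 2 ^ l * x := mul_nonneg hp.le hx.1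
  have hx1 : 0 ≤ 2 ^ l * (1 - x) := mul_nonneg hp.le (by linarith [hx.2])
  have key : ∀ v : ℝ, |v| ≤ D → |Real.sqrt (2 ^ l) * v| ≤ D * Real.sqrt (2 ^ l) := fun v hv => by
    rw [abs_mul, abs_of_nonneg (Real.sqrt_nonneg _), mul_comm]
    exact mul_le_mul_of_nonneg_right hv (Real.sqrt_nonneg _)
  unfold boundaryFamily
  split_ifs with c1 c2
  · refine ⟨key _ (((h1 m c1 _ hx0).1).trans (by linarith [le_abs_self D₁])), fun h => ?_⟩
    rw [(hR m c1 _ _).1, mul_zero]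
    have c1' : (m : ℝ) < N := by exact_mod_cast c1
    rcases lt_abs.1 h with h | h <;> linarith [le_abs_self R]
  · refine ⟨key _ ((h2' _).trans (max_le (by linarith [le_abs_self D₂]) (by linarith))),
      fun h => ?_⟩
    have : f (2 ^ l * x - m) = 0 := by
      by_contra h'
      have := hs h'
      rcases lt_abs.1 h with h | h <;> linarith [this.1, this.2]
    rw [this, mul_zero]
  · have hk : 2 ^ l - 1 - m < N := by omega
    refine ⟨key _ (((h1 _ hk _ hx1).2).trans (by linarith [le_abs_self D₁])), fun h => ?_⟩
    rw [(hR _ hk _ _).2, mul_zero]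
    have c2' : (2 : ℝ) ^ l ≤ m + N := by exact_mod_cast (not_lt.1 c2)
    rcases lt_abs.1 h with h | h <;> linarith [le_abs_self R]

theorem boundaryFamily_continuousOn (hf : Continuous f)
    (he : ∀ k < N, ContinuousOn (fL k) (Ici 0) ∧ ContinuousOn (fR k) (Ici 0))
    {l m : ℕ} (hm : m < 2 ^ l) :
    ContinuousOn (boundaryFamily N f fL fR l m) (Icc 0 1) := by
  have hp : (0 : ℝ) < 2 ^ l := by positivity
  unfold boundaryFamily
  split_ifs with c1 c2
  · refine continuousOn_const.mul ((he m c1).1.comp (by fun_prop) fun x hx => ?_)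
    exact mul_nonneg hp.le hx.1
  · exact (continuous_const.mul (hf.comp (by fun_prop))).continuousOn
  · refine continuousOn_const.mul ((he _ (by omega)).2.comp (by fun_prop) fun x hx => ?_)
    exact mul_nonneg hp.le (by linarith [hx.2])

end Family

/-- A family `e l m`, `m < 2 ^ l`, of functions on `[0,1]` of size `2 ^ (l / 2)` which live within
`2 ^ (-l)` of the points `m / 2 ^ l`, up to the constant `D`. -/
structure LocalizedFamily (e : ℕ → ℕ → ℝ → ℝ) (D : ℝ) : Prop where
  one_le : 1 ≤ D
  continuousOn : ∀ l m, m < 2 ^ l → ContinuousOn (e l m) (Icc 0 1)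
  bound : ∀ l m x, m < 2 ^ l → x ∈ Icc (0 : ℝ) 1 → |e l m x| ≤ D * Real.sqrt (2 ^ l)
  eq_zero : ∀ (l m : ℕ) (x : ℝ), m < 2 ^ l → x ∈ Icc (0 : ℝ) 1 → D < |2 ^ l * x - m| → e l m x = 0

namespace LocalizedFamily

variable {e : ℕ → ℕ → ℝ → ℝ} {D : ℝ}

theorem card_near_le (hD : 1 ≤ D) (l : ℕ) (y : ℝ) :
    ((Finset.univ.filter fun m : Fin (2 ^ l) => |y - m| ≤ D).card : ℝ) ≤ 3 * D := by
  -- `⌊·⌋₊` sends negative numbers to `0`, so the case in which no index is near has to be split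
  -- off.
  rcases lt_or_ge (y + D) 0 with hneg | hneg
  · have : (Finset.univ.filter fun m : Fin (2 ^ l) => |y - m| ≤ D) = ∅ := by
      ext m
      simp only [Finset.mem_filter, Finset.mem_univ, true_and, Finset.notMem_empty, iff_false,
        not_le]
      have : (0 : ℝ) ≤ (m : ℕ) := Nat.cast_nonneg _
      exact lt_abs.2 (Or.inr (by linarith))
    rw [this]
    simp
    linarith
  have h1 : (Finset.univ.filter fun m : Fin (2 ^ l) => |y - m| ≤ D).card ≤
      (Finset.Icc ⌈y - D⌉₊ ⌊y + D⌋₊).card := by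
    refine Finset.card_le_card_of_injOn (fun m => (m : ℕ)) (fun m hm => ?_)
      (fun a _ b _ h => Fin.ext h)
    simp only [Finset.coe_filter, Finset.mem_univ, true_and, mem_ofPred_eq] at hm
    have := abs_le.1 hm
    simp only [Finset.coe_Icc, mem_Icc]
    exact ⟨Nat.ceil_le.2 (by linarith [this.2]), Nat.le_floor (by linarith [this.1])⟩
  rw [Nat.card_Icc] at h1
  -- An interval of length `2 * D` contains at most `2 * D + 1` integers, which is at most `3 * D`
  -- as `1 ≤ D`.
  have h2 : ((⌊y + D⌋₊ + 1 - ⌈y - D⌉₊ : ℕ) : ℝ) ≤ 2 * D + 1 := by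
    rcases le_total ⌈y - D⌉₊ (⌊y + D⌋₊ + 1) with h | h
    · rw [Nat.cast_sub h]
      push_cast
      have := Nat.floor_le hneg
      have := Nat.le_ceil (y - D)
      linarith
    · rw [Nat.sub_eq_zero_of_le h]
      simp
      linarith
  calc _ ≤ ((⌊y + D⌋₊ + 1 - ⌈y - D⌉₊ : ℕ) : ℝ) := by exact_mod_cast h1
    _ ≤ _ := by linarith

variable (he : LocalizedFamily e D)
include he

/-- At most `3 * D` indices are active at a point. This growth in `l` is exactly compensated by the
decay in `integral_abs_le`. -/
theorem sum_abs_le (l : ℕ) {x : ℝ} (hx : x ∈ Icc (0 : ℝ) 1) :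
    ∑ m : Fin (2 ^ l), |e l m x| ≤ 3 * D ^ 2 * Real.sqrt (2 ^ l) := by
  have h0 : ∑ m : Fin (2 ^ l), |e l m x| =
      ∑ m ∈ Finset.univ.filter (fun m : Fin (2 ^ l) => |2 ^ l * x - m| ≤ D), |e l m x| := by
    refine (Finset.sum_subset (Finset.filter_subset _ _) fun m _ hm => ?_).symm
    simp only [Finset.mem_filter, Finset.mem_univ, true_and, not_le] at hm
    simp [he.eq_zero l m x m.2 hx hm]
  rw [h0]
  refine (Finset.sum_le_card_nsmul _ _ _ fun (m : Fin (2 ^ l)) _ =>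
    he.bound l m x m.2 hx).trans ?_
  rw [nsmul_eq_mul]
  have := card_near_le he.one_le l (2 ^ l * x)
  have hD := he.one_le
  calc _ ≤ 3 * D * (D * Real.sqrt (2 ^ l)) := by gcongr
    _ = _ := by ring

/-- The function has height `D * 2 ^ (l / 2)` and lives on an interval of length `2 * D / 2 ^ l`. -/
theorem integral_abs_le {l m : ℕ} (hm : m < 2 ^ l) :
    ∫ x in Icc (0 : ℝ) 1, |e l m x| ≤ 2 * D ^ 2 / Real.sqrt (2 ^ l) := by
  have hp : (0 : ℝ) < 2 ^ l := by positivity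
  have hD := he.one_le
  set J : Set ℝ := Icc ((m - D) / 2 ^ l) ((m + D) / 2 ^ l) with hJ
  have h1 : ∀ x ∈ Icc (0 : ℝ) 1,
      |e l m x| ≤ J.indicator (fun _ => D * Real.sqrt (2 ^ l)) x := fun x hx => by
    by_cases hxJ : x ∈ J
    · rw [indicator_of_mem hxJ]
      exact he.bound l m x hm hx
    · rw [indicator_of_notMem hxJ, he.eq_zero l m x hm hx, abs_zero]
      by_contra h
      have := abs_le.1 (not_lt.1 h)
      refine hxJ ⟨?_, ?_⟩
      · rw [div_le_iff₀ hp]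
        linarith [this.1]
      · rw [le_div_iff₀ hp]
        linarith [this.2]
  have hi : Integrable (J.indicator fun _ => D * Real.sqrt (2 ^ l)) :=
    (integrable_indicator_iff measurableSet_Icc).2 (integrableOn_const (by simp [Real.volume_Icc]))
  calc ∫ x in Icc (0 : ℝ) 1, |e l m x|
      ≤ ∫ x in Icc (0 : ℝ) 1, J.indicator (fun _ => D * Real.sqrt (2 ^ l)) x :=
        setIntegral_mono_on ((he.continuousOn l m hm).abs.integrableOn_Icc) hi.integrableOn
          measurableSet_Icc h1
    _ ≤ ∫ x, J.indicator (fun _ => D * Real.sqrt (2 ^ l)) x := by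
        refine setIntegral_le_integral hi (Filter.Eventually.of_forall fun x => ?_)
        exact indicator_nonneg (fun _ _ => by positivity) x
    _ = 2 * D / 2 ^ l * (D * Real.sqrt (2 ^ l)) := by
        rw [integral_indicator measurableSet_Icc, setIntegral_const, Real.volume_real_Icc_of_le]
        · rw [smul_eq_mul]
          ring
        · gcongr
          linarith
    _ = 2 * D ^ 2 / Real.sqrt (2 ^ l) := by
        have hs : Real.sqrt (2 ^ l) ≠ 0 := (Real.sqrt_pos.2 hp).ne'
        have := Real.mul_self_sqrt hp.le
        field_simp
        nlinarith

end LocalizedFamily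

/-! ### Finite orthonormal families on the unit interval -/

section Orthonormal

variable {ι κ : Type*} [Fintype ι] [Fintype κ] [DecidableEq ι] [DecidableEq κ]
  {e : ι → ℝ → ℝ} {g : κ → ℝ → ℝ}

theorem integrableOn_mul_of_continuousOn {f g : ℝ → ℝ} (hf : ContinuousOn f (Icc (0 : ℝ) 1))
    (hg : ContinuousOn g (Icc (0 : ℝ) 1)) :
    IntegrableOn (fun x => f x * g x) (Icc (0 : ℝ) 1) :=
  (hf.mul hg).integrableOn_Icc

/-- The span is one of functions on `[0,1]`, not of classes modulo null sets, so the orthonormal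
expansion is valid at every point. -/
theorem eq_sum_of_mem_span_of_orthonormal (hc : ∀ a, ContinuousOn (e a) (Icc (0 : ℝ) 1))
    (ho : ∀ a b, ∫ x in Icc (0 : ℝ) 1, e a x * e b x = if a = b then 1 else 0) {f : ℝ → ℝ}
    (hf : (Icc (0 : ℝ) 1).domRestrict f ∈
      Submodule.span ℝ (range fun a => (Icc (0 : ℝ) 1).domRestrict (e a)))
    {x : ℝ} (hx : x ∈ Icc (0 : ℝ) 1) :
    f x = ∑ a, (∫ z in Icc (0 : ℝ) 1, f z * e a z) * e a x := by
  obtain ⟨c, hc'⟩ := (Submodule.mem_span_range_iff_exists_fun ℝ).1 hf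
  have hfx : ∀ z ∈ Icc (0 : ℝ) 1, f z = ∑ a, c a * e a z := fun z hz => by
    have := congrFun hc' ⟨z, hz⟩
    simpa using this.symm
  have hco : ∀ b, ∫ z in Icc (0 : ℝ) 1, f z * e b z = c b := fun b => by
    calc ∫ z in Icc (0 : ℝ) 1, f z * e b z
        = ∫ z in Icc (0 : ℝ) 1, ∑ a, c a * (e a z * e b z) :=
          setIntegral_congr_fun measurableSet_Icc fun z hz => by
            simp only [hfx z hz, Finset.sum_mul, mul_assoc]
      _ = ∑ a, c a * ∫ z in Icc (0 : ℝ) 1, e a z * e b z := by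
          rw [integral_finsetSum _ fun a _ =>
            (integrableOn_mul_of_continuousOn (hc a) (hc b)).const_mul _]
          simp only [integral_const_mul]
      _ = c b := by simp [ho]
  simp only [hco]
  exact hfx x hx

/-- A reproducing kernel depends only on the space: expand each `e a` in the basis `g`, exchange the
sums, and recognize the expansion of `g b` in the basis `e`. -/
theorem kernel_eq_of_span_eq (hc : ∀ a, ContinuousOn (e a) (Icc (0 : ℝ) 1))
    (ho : ∀ a b, ∫ x in Icc (0 : ℝ) 1, e a x * e b x = if a = b then 1 else 0)
    (hc' : ∀ a, ContinuousOn (g a) (Icc (0 : ℝ) 1))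
    (ho' : ∀ a b, ∫ x in Icc (0 : ℝ) 1, g a x * g b x = if a = b then 1 else 0)
    (hs : Submodule.span ℝ (range fun a => (Icc (0 : ℝ) 1).domRestrict (e a)) =
      Submodule.span ℝ (range fun a => (Icc (0 : ℝ) 1).domRestrict (g a)))
    {x y : ℝ} (hx : x ∈ Icc (0 : ℝ) 1) (hy : y ∈ Icc (0 : ℝ) 1) :
    ∑ a, e a x * e a y = ∑ b, g b x * g b y := by
  have h1 : ∀ a, e a x = ∑ b, (∫ z in Icc (0 : ℝ) 1, e a z * g b z) * g b x := fun a =>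
    eq_sum_of_mem_span_of_orthonormal hc' ho' (hs ▸ Submodule.subset_span ⟨a, rfl⟩) hx
  have h2 : ∀ b, g b y = ∑ a, (∫ z in Icc (0 : ℝ) 1, g b z * e a z) * e a y := fun b =>
    eq_sum_of_mem_span_of_orthonormal hc ho (hs ▸ Submodule.subset_span ⟨b, rfl⟩) hy
  calc ∑ a, e a x * e a y
      = ∑ a, ∑ b, g b x * ((∫ z in Icc (0 : ℝ) 1, g b z * e a z) * e a y) := by
        refine Finset.sum_congr rfl fun a _ => ?_
        rw [h1 a, Finset.sum_mul]
        refine Finset.sum_congr rfl fun b _ => ?_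
        simp only [mul_comm (g b _) (e a _)]
        ring
    _ = ∑ b, g b x * g b y := by
        rw [Finset.sum_comm]
        refine Finset.sum_congr rfl fun b _ => ?_
        rw [← Finset.mul_sum, ← h2 b]

end Orthonormal

/-! ### Kernels of localized families. -/

theorem LocalizedFamily.mono {e : ℕ → ℕ → ℝ → ℝ} {D D' : ℝ} (he : LocalizedFamily e D)
    (h : D ≤ D') : LocalizedFamily e D' where
  one_le := he.one_le.trans h
  continuousOn := he.continuousOn
  bound l m x hm hx := (he.bound l m x hm hx).trans (by gcongr)
  eq_zero l m x hm hx hD := he.eq_zero l m x hm hx (h.trans_lt hD)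

/-- The kernel `∑ m, e l m x * e l m y` of a family of functions. -/
def familyKernel (e : ℕ → ℕ → ℝ → ℝ) (l : ℕ) (x y : ℝ) : ℝ :=
  ∑ m : Fin (2 ^ l), e l m x * e l m y

namespace LocalizedFamily

variable {e : ℕ → ℕ → ℝ → ℝ} {D : ℝ} (he : LocalizedFamily e D)
include he

theorem abs_kernel_le (l : ℕ) {x y : ℝ} (hx : x ∈ Icc (0 : ℝ) 1) (hy : y ∈ Icc (0 : ℝ) 1) :
    |familyKernel e l x y| ≤ 3 * D ^ 3 * 2 ^ l := by
  have hD := he.one_le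
  calc |familyKernel e l x y| ≤ ∑ m : Fin (2 ^ l), |e l m x| * (D * Real.sqrt (2 ^ l)) := by
        refine (Finset.abs_sum_le_sum_abs _ _).trans (Finset.sum_le_sum fun m _ => ?_)
        rw [abs_mul]
        exact mul_le_mul_of_nonneg_left (he.bound l m y m.2 hy) (abs_nonneg _)
    _ = (∑ m : Fin (2 ^ l), |e l m x|) * (D * Real.sqrt (2 ^ l)) := by rw [Finset.sum_mul]
    _ ≤ 3 * D ^ 2 * Real.sqrt (2 ^ l) * (D * Real.sqrt (2 ^ l)) := by
        gcongr
        exact he.sum_abs_le l hx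
    _ = 3 * D ^ 3 * (Real.sqrt (2 ^ l) * Real.sqrt (2 ^ l)) := by ring
    _ = _ := by rw [Real.mul_self_sqrt (by positivity)]

theorem kernel_continuousOn (l : ℕ) (x : ℝ) :
    ContinuousOn (familyKernel e l x) (Icc 0 1) :=
  continuousOn_finsetSum _ fun m _ => continuousOn_const.mul (he.continuousOn l m m.2)

/-- The factors `2 ^ (l / 2)` from `sum_abs_le` and `2 ^ (-l / 2)` from `integral_abs_le` cancel.
Uniformity in the level is what keeps the resolution out of the `1 / n` part of the variances. -/
theorem integral_abs_kernel_le (l : ℕ) {x : ℝ} (hx : x ∈ Icc (0 : ℝ) 1) :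
    ∫ z in Icc (0 : ℝ) 1, |familyKernel e l x z| ≤ 6 * D ^ 4 := by
  have hD := he.one_le
  have hi : ∀ m : Fin (2 ^ l), IntegrableOn (fun z => |e l m x| * |e l m z|) (Icc (0 : ℝ) 1) :=
    fun m => (he.continuousOn l m m.2).abs.integrableOn_Icc.const_mul _
  calc ∫ z in Icc (0 : ℝ) 1, |familyKernel e l x z|
      ≤ ∫ z in Icc (0 : ℝ) 1, ∑ m : Fin (2 ^ l), |e l m x| * |e l m z| := by
        refine setIntegral_mono_on (he.kernel_continuousOn l x).abs.integrableOn_Icc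
          (integrable_finsetSum _ fun m _ => hi m) measurableSet_Icc fun z _ => ?_
        refine (Finset.abs_sum_le_sum_abs _ _).trans (Finset.sum_le_sum fun m _ => ?_)
        rw [abs_mul]
    _ = ∑ m : Fin (2 ^ l), |e l m x| * ∫ z in Icc (0 : ℝ) 1, |e l m z| := by
        rw [integral_finsetSum _ fun m _ => hi m]
        simp only [integral_const_mul]
    _ ≤ ∑ m : Fin (2 ^ l), |e l m x| * (2 * D ^ 2 / Real.sqrt (2 ^ l)) :=
        Finset.sum_le_sum fun m _ =>
          mul_le_mul_of_nonneg_left (he.integral_abs_le m.2) (abs_nonneg _)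
    _ ≤ 3 * D ^ 2 * Real.sqrt (2 ^ l) * (2 * D ^ 2 / Real.sqrt (2 ^ l)) := by
        rw [← Finset.sum_mul]
        gcongr
        exact he.sum_abs_le l hx
    _ = _ := by
        have hs : Real.sqrt (2 ^ l) ≠ 0 := by positivity
        field_simp
        norm_num

/-- If `x` and `y` are far apart, no index lies within `D` of both `2 ^ l * x` and `2 ^ l * y`, so
every summand has a vanishing factor. -/
theorem kernel_eq_zero (l : ℕ) {x y : ℝ} (hx : x ∈ Icc (0 : ℝ) 1) (hy : y ∈ Icc (0 : ℝ) 1)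
    (h : 2 * D / 2 ^ l < |x - y|) : familyKernel e l x y = 0 := by
  refine Finset.sum_eq_zero fun m _ => ?_
  by_cases h1 : D < |2 ^ l * x - (m : ℕ)|
  · rw [he.eq_zero l m x m.2 hx h1, zero_mul]
  by_cases h2 : D < |2 ^ l * y - (m : ℕ)|
  · rw [he.eq_zero l m y m.2 hy h2, mul_zero]
  exfalso
  have hp : (0 : ℝ) < 2 ^ l := by positivity
  rw [div_lt_iff₀ hp] at h
  have h3 := abs_sub_abs_le_abs_sub (2 ^ l * x - (m : ℕ)) (2 ^ l * y - (m : ℕ))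
  have h4 : |x - y| * 2 ^ l = |(2 ^ l * x - (m : ℕ)) - (2 ^ l * y - (m : ℕ))| := by
    rw [← abs_of_pos hp, ← abs_mul, abs_of_pos hp]
    congr 1
    ring
  have h5 := abs_sub (2 ^ l * x - (m : ℕ)) (2 ^ l * y - (m : ℕ))
  rw [← h4] at h5
  linarith [not_lt.1 h1, not_lt.1 h2]

end LocalizedFamily

/-! ### The univariate multiresolution analysis. -/

namespace CDVBasis

variable {S : ℕ} (B : CDVBasis S)

theorem exists_localized :
    ∃ D : ℝ, LocalizedFamily B.scal D ∧ LocalizedFamily B.wav D := by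
  obtain ⟨R, hR⟩ := B.support_edge
  obtain ⟨D₁, h1, h1'⟩ := boundaryFamily_localized (fL := B.φL) (fR := B.φR) B.continuous_φ
    B.support_φ
    (fun k hk => ⟨(B.continuousOn_edge k hk).1, (B.continuousOn_edge k hk).2.1⟩)
    (R := R) (fun k hk x hx => ⟨(hR k hk x hx).1, (hR k hk x hx).2.1⟩)
  obtain ⟨D₂, h2, h2'⟩ := boundaryFamily_localized (fL := B.ψL) (fR := B.ψR) B.continuous_ψ
    B.support_ψ
    (fun k hk => ⟨(B.continuousOn_edge k hk).2.2.1, (B.continuousOn_edge k hk).2.2.2⟩)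
    (R := R) (fun k hk x hx => ⟨(hR k hk x hx).2.2.1, (hR k hk x hx).2.2.2⟩)
  have e1 : LocalizedFamily B.scal D₁ :=
    ⟨h1, fun l m hm => boundaryFamily_continuousOn B.continuous_φ
      (fun k hk => ⟨(B.continuousOn_edge k hk).1, (B.continuousOn_edge k hk).2.1⟩) hm,
      fun l m x hm hx => (h1' l m x hm hx).1, fun l m x hm hx => (h1' l m x hm hx).2⟩
  have e2 : LocalizedFamily B.wav D₂ :=
    ⟨h2, fun l m hm => boundaryFamily_continuousOn B.continuous_ψ
      (fun k hk => ⟨(B.continuousOn_edge k hk).2.2.1, (B.continuousOn_edge k hk).2.2.2⟩) hm,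
      fun l m x hm hx => (h2' l m x hm hx).1, fun l m x hm hx => (h2' l m x hm hx).2⟩
  exact ⟨max D₁ D₂, e1.mono (le_max_left _ _), e2.mono (le_max_right _ _)⟩

theorem scal_continuousOn {l m : ℕ} (hm : m < 2 ^ l) : ContinuousOn (B.scal l m) (Icc 0 1) :=
  boundaryFamily_continuousOn B.continuous_φ
    (fun k hk => ⟨(B.continuousOn_edge k hk).1, (B.continuousOn_edge k hk).2.1⟩) hm

theorem wav_continuousOn {l m : ℕ} (hm : m < 2 ^ l) : ContinuousOn (B.wav l m) (Icc 0 1) :=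
  boundaryFamily_continuousOn B.continuous_ψ
    (fun k hk => ⟨(B.continuousOn_edge k hk).2.2.1, (B.continuousOn_edge k hk).2.2.2⟩) hm

/-- The span of the univariate scaling functions of level `l`, as functions on `[0,1]`. -/
def scalSpan (l : ℕ) : Submodule ℝ (Icc (0 : ℝ) 1 → ℝ) :=
  Submodule.span ℝ (range fun m : Fin (2 ^ l) => (Icc (0 : ℝ) 1).domRestrict (B.scal l m))

theorem scal_orthonormal {l : ℕ} (hl : B.J₀ ≤ l) (a b : Fin (2 ^ l)) :
    ∫ x in Icc (0 : ℝ) 1, B.scal l a x * B.scal l b x = if a = b then 1 else 0 :=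
  (B.orthonormal_scal l hl a a.2 b b.2).trans (by simp only [Fin.ext_iff])

theorem wav_orthonormal {l : ℕ} (hl : B.J₀ ≤ l) (a b : Fin (2 ^ l)) :
    ∫ x in Icc (0 : ℝ) 1, B.wav l a x * B.wav l b x = if a = b then 1 else 0 :=
  (B.orthonormal_wav l hl a a.2 b b.2).trans (by simp only [Fin.ext_iff])

theorem scalSpan_succ {l : ℕ} (hl : B.J₀ ≤ l) : B.scalSpan (l + 1) = B.scalSpan l ⊔
    Submodule.span ℝ (range fun m : Fin (2 ^ l) => (Icc (0 : ℝ) 1).domRestrict (B.wav l m)) :=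
  B.multiresolution l hl

theorem scalSpan_mono {l l' : ℕ} (hl : B.J₀ ≤ l) (h : l ≤ l') : B.scalSpan l ≤ B.scalSpan l' := by
  induction l', h using Nat.le_induction with
  | base => exact le_rfl
  | succ l' h ih => exact ih.trans (by rw [B.scalSpan_succ (hl.trans h)]; exact le_sup_left)

theorem scal_mem_scalSpan {l l' : ℕ} (hl : B.J₀ ≤ l) (h : l ≤ l') (m : Fin (2 ^ l)) :
    (Icc (0 : ℝ) 1).domRestrict (B.scal l m) ∈ B.scalSpan l' :=
  B.scalSpan_mono hl h (Submodule.subset_span ⟨m, rfl⟩)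

theorem wav_mem_scalSpan {l l' : ℕ} (hl : B.J₀ ≤ l) (h : l < l') (m : Fin (2 ^ l)) :
    (Icc (0 : ℝ) 1).domRestrict (B.wav l m) ∈ B.scalSpan l' := by
  refine B.scalSpan_mono (hl.trans l.le_succ) h ?_
  rw [Nat.succ_eq_add_one, B.scalSpan_succ hl]
  exact Submodule.mem_sup_right (Submodule.subset_span ⟨m, rfl⟩)

theorem eq_sum_of_mem_scalSpan {l : ℕ} (hl : B.J₀ ≤ l) {f : ℝ → ℝ}
    (hf : (Icc (0 : ℝ) 1).domRestrict f ∈ B.scalSpan l) {x : ℝ} (hx : x ∈ Icc (0 : ℝ) 1) :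
    f x = ∑ m : Fin (2 ^ l), (∫ z in Icc (0 : ℝ) 1, f z * B.scal l m z) * B.scal l m x :=
  eq_sum_of_mem_span_of_orthonormal (e := fun m : Fin (2 ^ l) => B.scal l m)
    (fun m => B.scal_continuousOn m.2) (B.scal_orthonormal hl) hf hx

/-- Orthogonality of `W_l` to the basis of `V_l` extends to its span. Since the spaces `V_l` are
nested, all orthogonality relations between different levels follow. -/
theorem integral_mul_wav_eq_zero {l : ℕ} (hl : B.J₀ ≤ l) {f : ℝ → ℝ}
    (hf : (Icc (0 : ℝ) 1).domRestrict f ∈ B.scalSpan l) (m : Fin (2 ^ l)) :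
    ∫ x in Icc (0 : ℝ) 1, f x * B.wav l m x = 0 := by
  have h := fun x hx => B.eq_sum_of_mem_scalSpan hl hf (x := x) hx
  calc ∫ x in Icc (0 : ℝ) 1, f x * B.wav l m x
      = ∫ x in Icc (0 : ℝ) 1, ∑ a : Fin (2 ^ l),
          (∫ z in Icc (0 : ℝ) 1, f z * B.scal l a z) * (B.scal l a x * B.wav l m x) :=
        setIntegral_congr_fun measurableSet_Icc fun x hx => by
          simp only [← mul_assoc, ← Finset.sum_mul]
          rw [← h x hx]
    _ = 0 := by
        rw [integral_finsetSum _ fun a _ => (integrableOn_mul_of_continuousOn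
          (B.scal_continuousOn a.2) (B.wav_continuousOn m.2)).const_mul _]
        refine Finset.sum_eq_zero fun a _ => ?_
        rw [integral_const_mul]
        have : ∫ x in Icc (0 : ℝ) 1, B.scal l a x * B.wav l m x = 0 :=
          B.orthogonal_scal_wav l hl a a.2 m m.2
        rw [this, mul_zero]

theorem integral_scal_mul_wav {l l' : ℕ} (hl : B.J₀ ≤ l) (h : l ≤ l') (m : Fin (2 ^ l))
    (m' : Fin (2 ^ l')) : ∫ x in Icc (0 : ℝ) 1, B.scal l m x * B.wav l' m' x = 0 :=
  B.integral_mul_wav_eq_zero (hl.trans h) (B.scal_mem_scalSpan hl h m) m'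

theorem integral_wav_mul_wav_of_lt {l l' : ℕ} (hl : B.J₀ ≤ l) (h : l < l') (m : Fin (2 ^ l))
    (m' : Fin (2 ^ l')) : ∫ x in Icc (0 : ℝ) 1, B.wav l m x * B.wav l' m' x = 0 :=
  B.integral_mul_wav_eq_zero (hl.trans h.le) (B.wav_mem_scalSpan hl h m) m'

/-- Both sides are kernels of orthonormal bases of the same space `V_{l+1}`. -/
theorem familyKernel_scal_succ {l : ℕ} (hl : B.J₀ ≤ l) {x y : ℝ} (hx : x ∈ Icc (0 : ℝ) 1)
    (hy : y ∈ Icc (0 : ℝ) 1) : familyKernel B.scal (l + 1) x y =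
      familyKernel B.scal l x y + familyKernel B.wav l x y := by
  have h := kernel_eq_of_span_eq (e := fun m : Fin (2 ^ (l + 1)) => B.scal (l + 1) m)
    (g := Sum.elim (fun m : Fin (2 ^ l) => B.scal l m) (fun m : Fin (2 ^ l) => B.wav l m))
    (fun m => B.scal_continuousOn m.2) (B.scal_orthonormal (hl.trans l.le_succ))
    (by
      rintro (m | m)
      · exact B.scal_continuousOn m.2
      · exact B.wav_continuousOn m.2)
    (by
      rintro (a | a) (b | b)
      · simpa using B.scal_orthonormal hl a b
      · simpa using B.integral_scal_mul_wav hl le_rfl a b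
      · simpa [mul_comm] using B.integral_scal_mul_wav hl le_rfl b a
      · simpa using B.wav_orthonormal hl a b)
    (by
      refine (B.scalSpan_succ hl).trans ?_
      rw [scalSpan, ← Submodule.span_union]
      congr 1
      ext v
      simp)
    hx hy
  rw [Fintype.sum_sum_type] at h
  exact h

theorem integral_mul_familyKernel {l : ℕ} (hl : B.J₀ ≤ l) {f : ℝ → ℝ}
    (hc : ContinuousOn f (Icc 0 1))
    (hf : (Icc (0 : ℝ) 1).domRestrict f ∈ B.scalSpan l) {y : ℝ} (hy : y ∈ Icc (0 : ℝ) 1) :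
    ∫ z in Icc (0 : ℝ) 1, f z * familyKernel B.scal l y z = f y := by
  rw [B.eq_sum_of_mem_scalSpan hl hf hy]
  simp only [familyKernel, Finset.mul_sum]
  rw [integral_finsetSum]
  · refine Finset.sum_congr rfl fun m _ => ?_
    rw [← integral_mul_const]
    congr 1
    ext z
    ring
  · intro m _
    refine ((integrableOn_mul_of_continuousOn hc (B.scal_continuousOn m.2)).const_mul
      (B.scal l m y)).congr (Filter.Eventually.of_forall fun z => ?_)
    simp only
    ring

/-- As a function of `z`, the coarse kernel lies in `V_l ⊆ V_{l'}`, where the fine kernel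
reproduces. The point `x` only enters through the coefficients `scal l m x`, so it need not lie in
`[0,1]`. -/
theorem integral_familyKernel_mul_familyKernel {l l' : ℕ} (hl : B.J₀ ≤ l) (h : l ≤ l') (x : ℝ)
    {y : ℝ} (hy : y ∈ Icc (0 : ℝ) 1) :
    ∫ z in Icc (0 : ℝ) 1, familyKernel B.scal l x z * familyKernel B.scal l' y z =
      familyKernel B.scal l x y := by
  have hc : ContinuousOn (familyKernel B.scal l x) (Icc 0 1) :=
    continuousOn_finsetSum _ fun m _ => continuousOn_const.mul (B.scal_continuousOn m.2)
  refine B.integral_mul_familyKernel (hl.trans h) hc ?_ hy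
  have : (Icc (0 : ℝ) 1).domRestrict (familyKernel B.scal l x) =
      ∑ m : Fin (2 ^ l), B.scal l m x • (Icc (0 : ℝ) 1).domRestrict (B.scal l m) := by
    ext z
    simp [familyKernel]
  rw [this]
  exact Submodule.sum_mem _ fun m _ => Submodule.smul_mem _ _ (B.scal_mem_scalSpan hl h m)

/-- Constants are reproduced. Degree `0` is all the polynomial exactness that is needed, since the
rates come from the decay of wavelet coefficients. -/
theorem integral_familyKernel (hS : 1 ≤ S) {l : ℕ} (hl : B.J₀ ≤ l) {y : ℝ}
    (hy : y ∈ Icc (0 : ℝ) 1) : ∫ z in Icc (0 : ℝ) 1, familyKernel B.scal l y z = 1 := by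
  have h := B.integral_mul_familyKernel hl (f := fun x => x ^ 0) (by fun_prop)
    (B.polynomials l hl 0 hS) hy
  simpa using h

end CDVBasis

/-! ### Tensor products on the unit cube -/

section Cube

variable {d : ℕ}

theorem volume_restrict_cube : (volume.restrict (Icc (0 : Fin d → ℝ) 1)) =
    Measure.pi fun _ : Fin d => volume.restrict (Icc (0 : ℝ) 1) := by
  rw [← Measure.restrict_pi_pi, volume_pi]
  congr 1
  ext x
  simp [Pi.le_def]

instance isProbabilityMeasure_restrict_cube :
    IsProbabilityMeasure (volume.restrict (Icc (0 : Fin d → ℝ) 1)) := by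
  have : IsProbabilityMeasure (volume.restrict (Icc (0 : ℝ) 1)) := ⟨by simp⟩
  rw [volume_restrict_cube]
  infer_instance

theorem integral_cube_prod (f : Fin d → ℝ → ℝ) :
    ∫ x in Icc (0 : Fin d → ℝ) 1, ∏ i, f i (x i) = ∏ i, ∫ t in Icc (0 : ℝ) 1, f i t := by
  rw [volume_restrict_cube, integral_fintype_prod_eq_prod]

theorem mem_cube_apply {x : Fin d → ℝ} (hx : x ∈ Icc (0 : Fin d → ℝ) 1) (i : Fin d) :
    x i ∈ Icc (0 : ℝ) 1 := ⟨hx.1 i, hx.2 i⟩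

theorem ContinuousOn.integrableOn_cube {f : (Fin d → ℝ) → ℝ}
    (hf : ContinuousOn f (Icc 0 1)) : IntegrableOn f (Icc 0 1) :=
  hf.integrableOn_compact isCompact_Icc

theorem continuousOn_prod_apply {f : Fin d → ℝ → ℝ} (hf : ∀ i, ContinuousOn (f i) (Icc 0 1)) :
    ContinuousOn (fun x : Fin d → ℝ => ∏ i, f i (x i)) (Icc 0 1) :=
  continuousOn_finsetProd _ fun i _ => (hf i).comp (by fun_prop) fun _ hx => mem_cube_apply hx i

theorem prod_sum_apply {κ : Type*} [Fintype κ] (f : Fin d → κ → ℝ) :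
    ∏ i, ∑ a, f i a = ∑ m : Fin d → κ, ∏ i, f i (m i) := by
  rw [Finset.prod_univ_sum, Fintype.piFinset_univ]

theorem integrableOn_cube_mul {f g : (Fin d → ℝ) → ℝ} (hf : ContinuousOn f (Icc 0 1))
    (hg : ContinuousOn g (Icc 0 1)) : IntegrableOn (fun x => f x * g x) (Icc 0 1) :=
  (hf.mul hg).integrableOn_cube

theorem sum_coef_mul_coef {ι : Type*} [Fintype ι] {e : ι → (Fin d → ℝ) → ℝ}
    {p b : (Fin d → ℝ) → ℝ} (he : ∀ a, ContinuousOn (e a) (Icc 0 1))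
    (hp : ContinuousOn p (Icc 0 1)) (hb : ContinuousOn b (Icc 0 1)) :
    ∑ a, (∫ x in Icc (0 : Fin d → ℝ) 1, p x * e a x) *
        (∫ x in Icc (0 : Fin d → ℝ) 1, b x * e a x) =
      ∫ x in Icc (0 : Fin d → ℝ) 1, p x * ∫ y in Icc (0 : Fin d → ℝ) 1,
        b y * ∑ a, e a x * e a y := by
  have h1 : ∀ x, ∫ y in Icc (0 : Fin d → ℝ) 1, b y * ∑ a, e a x * e a y =
      ∑ a, e a x * ∫ y in Icc (0 : Fin d → ℝ) 1, b y * e a y := fun x => by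
    simp only [Finset.mul_sum, mul_left_comm (b _)]
    rw [integral_finsetSum _ fun a _ => (integrableOn_cube_mul hb (he a)).const_mul _]
    simp only [integral_const_mul]
  simp only [h1]
  simp only [Finset.mul_sum, ← mul_assoc]
  rw [integral_finsetSum _ fun a _ => (integrableOn_cube_mul hp (he a)).mul_const _]
  simp only [integral_mul_const]

/-- Two finite families of functions with the same kernel define the same bilinear form. -/
theorem sum_coef_eq_of_kernel_eq {ι κ : Type*} [Fintype ι] [Fintype κ]
    {e : ι → (Fin d → ℝ) → ℝ} {g : κ → (Fin d → ℝ) → ℝ} {p b : (Fin d → ℝ) → ℝ}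
    (he : ∀ a, ContinuousOn (e a) (Icc 0 1)) (hg : ∀ a, ContinuousOn (g a) (Icc 0 1))
    (hp : ContinuousOn p (Icc 0 1)) (hb : ContinuousOn b (Icc 0 1))
    (h : ∀ x ∈ Icc (0 : Fin d → ℝ) 1, ∀ y ∈ Icc (0 : Fin d → ℝ) 1,
      ∑ a, e a x * e a y = ∑ a, g a x * g a y) :
    ∑ a, (∫ x in Icc (0 : Fin d → ℝ) 1, p x * e a x) *
        (∫ x in Icc (0 : Fin d → ℝ) 1, b x * e a x) =
      ∑ a, (∫ x in Icc (0 : Fin d → ℝ) 1, p x * g a x) *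
        (∫ x in Icc (0 : Fin d → ℝ) 1, b x * g a x) := by
  rw [sum_coef_mul_coef he hp hb, sum_coef_mul_coef hg hp hb]
  refine setIntegral_congr_fun measurableSet_Icc fun x hx => congrArg (p x * ·) ?_
  exact setIntegral_congr_fun measurableSet_Icc fun y hy => congrArg (b y * ·) (h x hx y hy)

end Cube

/-! ### Tensor product wavelets and the projection kernel on the cube. -/

namespace CDVBasis

variable {S : ℕ} (B : CDVBasis S) {d : ℕ}

/-- The univariate factor of a tensor product wavelet. -/
def factor (l : ℕ) (b : Bool) (m : ℕ) : ℝ → ℝ := if b then B.wav l m else B.scal l m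

theorem factor_continuousOn {l m : ℕ} (b : Bool) (hm : m < 2 ^ l) :
    ContinuousOn (B.factor l b m) (Icc 0 1) := by
  cases b
  · exact B.scal_continuousOn hm
  · exact B.wav_continuousOn hm

theorem Psi_eq_prod (l : ℕ) (ι : Fin d → Bool) (m : Fin d → Fin (2 ^ l)) (x : Fin d → ℝ) :
    B.Psi l ι m x = ∏ i, B.factor l (ι i) (m i) (x i) := by
  refine Finset.prod_congr rfl fun i _ => ?_
  cases h : ι i <;> simp [factor]

theorem Psi_false (l : ℕ) (m : Fin d → Fin (2 ^ l)) : B.Psi l (fun _ => false) m = B.Phi l m := by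
  ext x
  simp [Psi, Phi]

theorem Psi_continuousOn (l : ℕ) (ι : Fin d → Bool) (m : Fin d → Fin (2 ^ l)) :
    ContinuousOn (B.Psi l ι m) (Icc 0 1) := by
  have : B.Psi l ι m = fun x => ∏ i, B.factor l (ι i) (m i) (x i) :=
    funext (B.Psi_eq_prod l ι m)
  rw [this]
  exact continuousOn_prod_apply fun i => B.factor_continuousOn (ι i) (m i).2

theorem Phi_continuousOn (l : ℕ) (m : Fin d → Fin (2 ^ l)) :
    ContinuousOn (B.Phi l m) (Icc 0 1) := by
  rw [← Psi_false]
  exact B.Psi_continuousOn l _ m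

theorem integral_Psi_mul_Psi (l l' : ℕ) (ι ι' : Fin d → Bool) (m : Fin d → Fin (2 ^ l))
    (m' : Fin d → Fin (2 ^ l')) :
    ∫ x in Icc (0 : Fin d → ℝ) 1, B.Psi l ι m x * B.Psi l' ι' m' x =
      ∏ i, ∫ t in Icc (0 : ℝ) 1, B.factor l (ι i) (m i) t * B.factor l' (ι' i) (m' i) t := by
  rw [← integral_cube_prod]
  simp only [Psi_eq_prod, Finset.prod_mul_distrib]

theorem integral_factor_mul_factor {l : ℕ} (hl : B.J₀ ≤ l) (b b' : Bool) (m m' : Fin (2 ^ l)) :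
    ∫ t in Icc (0 : ℝ) 1, B.factor l b m t * B.factor l b' m' t =
      if b = b' ∧ m = m' then 1 else 0 := by
  cases b <;> cases b'
  · simpa [factor] using B.scal_orthonormal hl m m'
  · simpa [factor] using B.integral_scal_mul_wav hl le_rfl m m'
  · simpa [factor, mul_comm] using B.integral_scal_mul_wav hl le_rfl m' m
  · simpa [factor] using B.wav_orthonormal hl m m'

theorem integral_Psi_mul_Psi_same {l : ℕ} (hl : B.J₀ ≤ l) (ι ι' : Fin d → Bool)
    (m m' : Fin d → Fin (2 ^ l)) :
    ∫ x in Icc (0 : Fin d → ℝ) 1, B.Psi l ι m x * B.Psi l ι' m' x =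
      if ι = ι' ∧ m = m' then 1 else 0 := by
  rw [integral_Psi_mul_Psi]
  simp only [B.integral_factor_mul_factor hl]
  rw [Finset.prod_ite_zero]
  simp [funext_iff, forall_and]

theorem Phi_orthonormal {l : ℕ} (hl : B.J₀ ≤ l) (m m' : Fin d → Fin (2 ^ l)) :
    ∫ x in Icc (0 : Fin d → ℝ) 1, B.Phi l m x * B.Phi l m' x = if m = m' then 1 else 0 := by
  simpa [Psi_false] using B.integral_Psi_mul_Psi_same hl (fun _ => false) (fun _ => false) m m'

theorem kernel_eq_prod (j : ℕ) (x y : Fin d → ℝ) :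
    B.kernel j x y = ∏ i, familyKernel B.scal j (x i) (y i) := by
  simp only [familyKernel]
  rw [prod_sum_apply]
  simp only [kernel, Phi, Finset.prod_mul_distrib]

theorem kernel_continuousOn (j : ℕ) (x : Fin d → ℝ) : ContinuousOn (B.kernel j x) (Icc 0 1) :=
  continuousOn_finsetSum _ fun m _ => continuousOn_const.mul (B.Phi_continuousOn j m)

/-- In each coordinate the kernel of level `l + 1` is a scaling part plus a wavelet part;
multiplying out over the coordinates gives one block for each type in `{0,1}^d`. -/
theorem kernel_succ {l : ℕ} (hl : B.J₀ ≤ l) {x y : Fin d → ℝ}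
    (hx : x ∈ Icc (0 : Fin d → ℝ) 1) (hy : y ∈ Icc (0 : Fin d → ℝ) 1) :
    B.kernel (l + 1) x y = ∑ a : (Fin d → Bool) × (Fin d → Fin (2 ^ l)),
      B.Psi l a.1 a.2 x * B.Psi l a.1 a.2 y := by
  rw [kernel_eq_prod]
  calc ∏ i, familyKernel B.scal (l + 1) (x i) (y i)
      = ∏ i, ∑ b : Bool, ∑ m : Fin (2 ^ l), B.factor l b m (x i) * B.factor l b m (y i) := by
        refine Finset.prod_congr rfl fun i _ => ?_
        rw [B.familyKernel_scal_succ hl (mem_cube_apply hx i) (mem_cube_apply hy i),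
          Fintype.sum_bool, add_comm]
        rfl
    _ = _ := by
        rw [prod_sum_apply, Fintype.sum_prod_type]
        refine Finset.sum_congr rfl fun ι _ => ?_
        rw [prod_sum_apply]
        simp only [Psi_eq_prod, Finset.prod_mul_distrib]

/-- The constants in the localization estimates for the kernels `K_j` on `[0,1]^d`. -/
structure KernelBound (d : ℕ) (D : ℝ) : Prop where
  one_le : 1 ≤ D
  abs_le : ∀ j, ∀ x ∈ Icc (0 : Fin d → ℝ) 1, ∀ y ∈ Icc (0 : Fin d → ℝ) 1,
    |B.kernel j x y| ≤ D * 2 ^ (j * d)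
  integral_abs_le : ∀ j, ∀ x ∈ Icc (0 : Fin d → ℝ) 1,
    ∫ z in Icc (0 : Fin d → ℝ) 1, |B.kernel j x z| ≤ D
  eq_zero : ∀ j, ∀ x ∈ Icc (0 : Fin d → ℝ) 1, ∀ y ∈ Icc (0 : Fin d → ℝ) 1,
    D / 2 ^ j < dist x y → B.kernel j x y = 0

theorem exists_kernelBound (d : ℕ) : ∃ D, B.KernelBound d D := by
  obtain ⟨D, hD, -⟩ := B.exists_localized
  have h1 := hD.one_le
  have p3 : D ≤ D ^ 3 := le_self_pow₀ h1 (by norm_num)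
  have p4 : D ≤ D ^ 4 := le_self_pow₀ h1 (by norm_num)
  have e0 : (1 : ℝ) ≤ (6 * D ^ 4) ^ d := one_le_pow₀ (by linarith)
  have e1 : (1 : ℝ) ≤ (3 * D ^ 3) ^ d := one_le_pow₀ (by linarith)
  -- The three summands serve the sup bound, the `L¹` bound and the localization, in this order.
  refine ⟨(3 * D ^ 3) ^ d + (6 * D ^ 4) ^ d + 2 * D, by linarith, ?_, ?_, ?_⟩
  · intro j x hx y hy
    rw [kernel_eq_prod, Finset.abs_prod]
    calc ∏ i, |familyKernel B.scal j (x i) (y i)| ≤ ∏ _i : Fin d, (3 * D ^ 3 * 2 ^ j) :=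
          Finset.prod_le_prod (fun _ _ => abs_nonneg _) fun i _ =>
            hD.abs_kernel_le j (mem_cube_apply hx i) (mem_cube_apply hy i)
      _ = (3 * D ^ 3) ^ d * 2 ^ (j * d) := by
          rw [Finset.prod_const, Finset.card_univ, Fintype.card_fin, mul_pow, ← pow_mul]
      _ ≤ _ := by
          gcongr
          linarith
  · intro j x hx
    simp only [kernel_eq_prod, Finset.abs_prod]
    rw [integral_cube_prod (fun i t => |familyKernel B.scal j (x i) t|)]
    calc ∏ i, ∫ t in Icc (0 : ℝ) 1, |familyKernel B.scal j (x i) t| ≤ ∏ _i : Fin d, (6 * D ^ 4) :=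
          Finset.prod_le_prod (fun _ _ => integral_nonneg fun _ => abs_nonneg _) fun i _ =>
            hD.integral_abs_kernel_le j (mem_cube_apply hx i)
      _ = (6 * D ^ 4) ^ d := by simp
      _ ≤ _ := by linarith
  · intro j x hx y hy h
    rw [kernel_eq_prod]
    have h2 : 2 * D / 2 ^ j < dist x y := lt_of_le_of_lt (by gcongr; linarith) h
    -- The distance on `Fin d → ℝ` is the maximum over coordinates, so some univariate factor
    -- vanishes.
    have : ∃ i, 2 * D / 2 ^ j < |x i - y i| := by
      by_contra hcon
      push Not at hcon
      exact absurd h2 (not_lt.2 ((dist_pi_le_iff (by positivity)).2 fun i => by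
        rw [Real.dist_eq]
        exact hcon i))
    obtain ⟨i, hi⟩ := this
    exact Finset.prod_eq_zero (Finset.mem_univ i)
      (hD.kernel_eq_zero j (mem_cube_apply hx i) (mem_cube_apply hy i) hi)

theorem integral_kernel (hS : 1 ≤ S) {j : ℕ} (hj : B.J₀ ≤ j) {x : Fin d → ℝ}
    (hx : x ∈ Icc (0 : Fin d → ℝ) 1) : ∫ z in Icc (0 : Fin d → ℝ) 1, B.kernel j x z = 1 := by
  simp only [kernel_eq_prod]
  rw [integral_cube_prod (fun i t => familyKernel B.scal j (x i) t)]
  exact Finset.prod_eq_one fun i _ => B.integral_familyKernel hS hj (mem_cube_apply hx i)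

theorem kernel_comm (j : ℕ) (x y : Fin d → ℝ) : B.kernel j x y = B.kernel j y x := by
  simp only [kernel, mul_comm]

theorem integral_kernel_mul_kernel_of_le {j j' : ℕ} (hj : B.J₀ ≤ j) (h : j ≤ j')
    (x : Fin d → ℝ) {y : Fin d → ℝ} (hy : y ∈ Icc (0 : Fin d → ℝ) 1) :
    ∫ z in Icc (0 : Fin d → ℝ) 1, B.kernel j x z * B.kernel j' y z = B.kernel j x y := by
  simp only [kernel_eq_prod, ← Finset.prod_mul_distrib]
  rw [integral_cube_prod
    (fun i t => familyKernel B.scal j (x i) t * familyKernel B.scal j' (y i) t)]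
  exact Finset.prod_congr rfl fun i _ =>
    B.integral_familyKernel_mul_familyKernel hj h (x i) (mem_cube_apply hy i)

/-- This identity is the source of `k_min`: integrating out the evaluation point of two fits at
different levels leaves the kernel of the coarser one. -/
theorem integral_kernel_mul_kernel {j j' : ℕ} (hj : B.J₀ ≤ j) (hj' : B.J₀ ≤ j')
    {x y : Fin d → ℝ} (hx : x ∈ Icc (0 : Fin d → ℝ) 1) (hy : y ∈ Icc (0 : Fin d → ℝ) 1) :
    ∫ z in Icc (0 : Fin d → ℝ) 1, B.kernel j x z * B.kernel j' y z = B.kernel (min j j') x y := by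
  rcases le_total j j' with h | h
  · rw [min_eq_left h, B.integral_kernel_mul_kernel_of_le hj h x hy]
  · rw [min_eq_right h, kernel_comm, ← B.integral_kernel_mul_kernel_of_le hj' h y hx]
    simp only [mul_comm]

/-- The trace of a projection is the dimension of its range. The exact value is what makes the noise
lower bound of order `k / n`. -/
theorem integral_kernel_diag {j : ℕ} (hj : B.J₀ ≤ j) :
    ∫ x in Icc (0 : Fin d → ℝ) 1, B.kernel j x x = 2 ^ (j * d) := by
  simp only [kernel]
  rw [integral_finsetSum _ fun m _ =>
    integrableOn_cube_mul (B.Phi_continuousOn j m) (B.Phi_continuousOn j m)]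
  simp [B.Phi_orthonormal hj, pow_mul]

end CDVBasis

/-! ### The projection form and its approximation error. -/

namespace CDVBasis

variable {S : ℕ} (B : CDVBasis S) {d : ℕ}

/-- The bilinear form `⟨Π_j p, Π_j b⟩` of the orthogonal projection onto `V_j`. -/
def projForm (j : ℕ) (p b : (Fin d → ℝ) → ℝ) : ℝ :=
  ∑ m : Fin d → Fin (2 ^ j), (∫ x in Icc (0 : Fin d → ℝ) 1, p x * B.Phi j m x) *
    ∫ x in Icc (0 : Fin d → ℝ) 1, b x * B.Phi j m x

-- The hypothesis on `g` is multiplied by the kernel, so that `g` has to be small only where the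
-- kernel does not vanish.
variable {B} in
theorem KernelBound.abs_integral_le {D : ℝ} (hK : B.KernelBound d D) (j : ℕ) {x : Fin d → ℝ}
    (hx : x ∈ Icc (0 : Fin d → ℝ) 1) {g : (Fin d → ℝ) → ℝ} (hg : ContinuousOn g (Icc 0 1))
    {ε : ℝ} (h : ∀ z ∈ Icc (0 : Fin d → ℝ) 1, |g z * B.kernel j x z| ≤ ε * |B.kernel j x z|)
    (hε : 0 ≤ ε) :
    |∫ z in Icc (0 : Fin d → ℝ) 1, g z * B.kernel j x z| ≤ ε * D := by
  have hk := B.kernel_continuousOn j x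
  calc |∫ z in Icc (0 : Fin d → ℝ) 1, g z * B.kernel j x z|
      ≤ ∫ z in Icc (0 : Fin d → ℝ) 1, |g z * B.kernel j x z| := abs_integral_le_integral_abs
    _ ≤ ∫ z in Icc (0 : Fin d → ℝ) 1, ε * |B.kernel j x z| :=
        setIntegral_mono_on (hg.mul hk).abs.integrableOn_cube
          (hk.abs.integrableOn_cube.const_mul _) measurableSet_Icc h
    _ ≤ ε * D := by
        rw [integral_const_mul]
        exact mul_le_mul_of_nonneg_left (hK.integral_abs_le j x hx) hε

theorem projForm_eq_integral (j : ℕ) {p b : (Fin d → ℝ) → ℝ} (hp : ContinuousOn p (Icc 0 1))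
    (hb : ContinuousOn b (Icc 0 1)) : B.projForm j p b =
      ∫ x in Icc (0 : Fin d → ℝ) 1, p x * ∫ y in Icc (0 : Fin d → ℝ) 1, b y * B.kernel j x y :=
  sum_coef_mul_coef (e := fun m : Fin d → Fin (2 ^ j) => B.Phi j m)
    (fun m => B.Phi_continuousOn j m) hp hb

theorem proj_continuousOn (j : ℕ) {b : (Fin d → ℝ) → ℝ} (hb : ContinuousOn b (Icc 0 1)) :
    ContinuousOn (fun x => ∫ y in Icc (0 : Fin d → ℝ) 1, b y * B.kernel j x y) (Icc 0 1) := by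
  have h1 : ∀ x, ∫ y in Icc (0 : Fin d → ℝ) 1, b y * B.kernel j x y =
      ∑ m, B.Phi j m x * ∫ y in Icc (0 : Fin d → ℝ) 1, b y * B.Phi j m y := fun x => by
    simp only [kernel, Finset.mul_sum, mul_left_comm (b _)]
    rw [integral_finsetSum _ fun a _ =>
      (integrableOn_cube_mul hb (B.Phi_continuousOn j a)).const_mul _]
    simp only [integral_const_mul]
  simp only [h1]
  exact continuousOn_finsetSum _ fun m _ => (B.Phi_continuousOn j m).mul continuousOn_const

/-- The kernels are an approximate identity: they have mass one, uniformly bounded `L¹` norm, and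
support within `D / 2 ^ j` of the diagonal. Uniform continuity of `b` then gives uniform convergence
of its projections. -/
theorem tendsto_projForm (hS : 1 ≤ S) {p b : (Fin d → ℝ) → ℝ} (hp : ContinuousOn p (Icc 0 1))
    (hb : UniformContinuousOn b (Icc 0 1)) :
    Filter.Tendsto (fun j => B.projForm j p b) Filter.atTop
      (nhds (∫ x in Icc (0 : Fin d → ℝ) 1, p x * b x)) := by
  obtain ⟨D, hK⟩ := B.exists_kernelBound d
  have hD0 : 0 < D := zero_lt_one.trans_le hK.one_le
  obtain ⟨C, hC⟩ := (isCompact_Icc (a := (0 : Fin d → ℝ)) (b := 1)).exists_bound_of_continuousOn hp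
  have hbc := hb.continuousOn
  have hC' : ∀ x ∈ Icc (0 : Fin d → ℝ) 1, |p x| ≤ |C| + 1 := fun x hx =>
    (hC x hx).trans (by linarith [le_abs_self C])
  rw [Metric.tendsto_atTop]
  intro ε hε
  -- The final bound is `(|C| + 1) * (ε' * D) = ε / 2`.
  set ε' := ε / (2 * (D * (|C| + 1))) with hε'
  have hε'0 : 0 < ε' := by positivity
  obtain ⟨δ, hδ, hbδ⟩ := Metric.uniformContinuousOn_iff.1 hb ε' hε'0
  obtain ⟨J, hJ⟩ := exists_nat_gt (D / δ)
  refine ⟨max J B.J₀, fun j hj => ?_⟩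
  have hjJ : D / 2 ^ j < δ := by
    rw [div_lt_iff₀ (by positivity), mul_comm, ← div_lt_iff₀ hδ]
    refine hJ.trans_le ?_
    have h1 : J ≤ j := (le_max_left _ _).trans hj
    exact_mod_cast h1.trans Nat.lt_two_pow_self.le
  have hj0 : B.J₀ ≤ j := (le_max_right _ _).trans hj
  have key : ∀ x ∈ Icc (0 : Fin d → ℝ) 1,
      |(∫ y in Icc (0 : Fin d → ℝ) 1, b y * B.kernel j x y) - b x| ≤ ε' * D := fun x hx => by
    have e : (∫ y in Icc (0 : Fin d → ℝ) 1, b y * B.kernel j x y) - b x =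
        ∫ y in Icc (0 : Fin d → ℝ) 1, (b y - b x) * B.kernel j x y := by
      simp only [sub_mul]
      rw [integral_sub (integrableOn_cube_mul hbc (B.kernel_continuousOn j x))
        ((B.kernel_continuousOn j x).integrableOn_cube.const_mul _), integral_const_mul,
        B.integral_kernel hS hj0 hx, mul_one]
    rw [e]
    refine hK.abs_integral_le j hx (hbc.sub continuousOn_const) (fun z hz => ?_) hε'0.le
    rw [abs_mul]
    rcases lt_or_ge (dist x z) δ with h | h
    · refine mul_le_mul_of_nonneg_right ?_ (abs_nonneg _)
      have := (hbδ x hx z hz h).le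
      rwa [dist_comm, Real.dist_eq] at this
    · rw [hK.eq_zero j x hx z hz (hjJ.trans_le h)]
      simp
  rw [Real.dist_eq, B.projForm_eq_integral j hp hbc, ← integral_sub
    (integrableOn_cube_mul hp (B.proj_continuousOn j hbc)) (integrableOn_cube_mul hp hbc)]
  have hle : |∫ x in Icc (0 : Fin d → ℝ) 1,
      (p x * (∫ y in Icc (0 : Fin d → ℝ) 1, b y * B.kernel j x y) - p x * b x)| ≤
      (|C| + 1) * (ε' * D) := by
    have := norm_setIntegral_le_of_norm_le_const (μ := volume) (s := Icc (0 : Fin d → ℝ) 1)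
      (C := (|C| + 1) * (ε' * D))
      (f := fun x => p x * (∫ y in Icc (0 : Fin d → ℝ) 1, b y * B.kernel j x y) - p x * b x)
      isCompact_Icc.measure_lt_top (fun x hx => by
        rw [← mul_sub, norm_mul]
        exact mul_le_mul (hC' x hx) (key x hx) (abs_nonneg _) (by positivity))
    have hv : volume.real (Icc (0 : Fin d → ℝ) 1) = 1 := by
      have := probReal_univ (μ := volume.restrict (Icc (0 : Fin d → ℝ) 1))
      rwa [measureReal_restrict_apply_univ] at this
    rwa [hv, mul_one] at this
  refine hle.trans_lt ?_
  rw [hε']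
  field_simp
  linarith

/-- The form depends on the basis only through its kernel, so `kernel_succ` applies; the type that
is constantly `false` gives back level `l`. -/
theorem projForm_succ {l : ℕ} (hl : B.J₀ ≤ l) {p b : (Fin d → ℝ) → ℝ}
    (hp : ContinuousOn p (Icc 0 1)) (hb : ContinuousOn b (Icc 0 1)) :
    B.projForm (l + 1) p b = B.projForm l p b +
      ∑ ι ∈ Finset.univ.erase (fun _ : Fin d => false), ∑ m : Fin d → Fin (2 ^ l),
        (∫ x in Icc (0 : Fin d → ℝ) 1, p x * B.Psi l ι m x) *
          ∫ x in Icc (0 : Fin d → ℝ) 1, b x * B.Psi l ι m x := by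
  have h := sum_coef_eq_of_kernel_eq (e := fun m : Fin d → Fin (2 ^ (l + 1)) => B.Phi (l + 1) m)
    (g := fun a : (Fin d → Bool) × (Fin d → Fin (2 ^ l)) => B.Psi l a.1 a.2)
    (fun m => B.Phi_continuousOn _ m) (fun a => B.Psi_continuousOn l a.1 a.2) hp hb
    (fun x hx y hy => B.kernel_succ hl hx hy)
  rw [projForm, h, Fintype.sum_prod_type, ← Finset.add_sum_erase _ _ (Finset.mem_univ fun _ => false)]
  simp only [Psi_false]
  rfl

theorem abs_integral_mul_Psi_le {α M : ℝ} (hM : 0 ≤ M) {h : (Fin d → ℝ) → ℝ}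
    (hh : h ∈ B.holderBall d α M) {l : ℕ} (hl : B.J₀ ≤ l) {ι : Fin d → Bool}
    (hι : ι ≠ fun _ => false) (m : Fin d → Fin (2 ^ l)) :
    |∫ x in Icc (0 : Fin d → ℝ) 1, h x * B.Psi l ι m x| ≤
      M * (2 : ℝ) ^ (-((l : ℝ) * (α + d / 2))) := by
  have h1 := le_trans (le_add_of_nonneg_left zero_le) hh.2
  simp only [iSup_le_iff] at h1
  have h2 := (ENNReal.ofReal_le_ofReal_iff hM).1 (h1 l hl m ι hι)
  rw [Real.rpow_neg (by norm_num), ← div_eq_mul_inv, le_div_iff₀ (by positivity), mul_comm]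
  exact h2

/-- For each of fewer than `2 ^ d` types there are `2 ^ (l d)` products of coefficients of size at
most `M² 2 ^ (-l (α + β + d))`; the dimension cancels. -/
theorem abs_projForm_succ_sub_le {α β M : ℝ} (hM : 0 ≤ M) {p b : (Fin d → ℝ) → ℝ}
    (hp : p ∈ B.holderBall d α M) (hb : b ∈ B.holderBall d β M) {l : ℕ} (hl : B.J₀ ≤ l) :
    |B.projForm (l + 1) p b - B.projForm l p b| ≤
      2 ^ d * M ^ 2 * ((2 : ℝ) ^ (-(α + β))) ^ l := by
  rw [B.projForm_succ hl hp.1.continuousOn hb.1.continuousOn, add_sub_cancel_left]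
  have hterm : ∀ ι ∈ Finset.univ.erase (fun _ : Fin d => false),
      |∑ m : Fin d → Fin (2 ^ l), (∫ x in Icc (0 : Fin d → ℝ) 1, p x * B.Psi l ι m x) *
          ∫ x in Icc (0 : Fin d → ℝ) 1, b x * B.Psi l ι m x| ≤
        M ^ 2 * ((2 : ℝ) ^ (-(α + β))) ^ l := fun ι hι => by
    have hι' := (Finset.mem_erase.1 hι).1
    calc _ ≤ ∑ _m : Fin d → Fin (2 ^ l), (M * (2 : ℝ) ^ (-((l : ℝ) * (α + d / 2)))) *
          (M * (2 : ℝ) ^ (-((l : ℝ) * (β + d / 2)))) := by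
          refine (Finset.abs_sum_le_sum_abs _ _).trans (Finset.sum_le_sum fun m _ => ?_)
          rw [abs_mul]
          exact mul_le_mul (B.abs_integral_mul_Psi_le hM hp hl hι' m)
            (B.abs_integral_mul_Psi_le hM hb hl hι' m) (abs_nonneg _) (by positivity)
      _ = M ^ 2 * ((2 : ℝ) ^ ((l * d : ℕ) : ℝ) * ((2 : ℝ) ^ (-((l : ℝ) * (α + d / 2))) *
          (2 : ℝ) ^ (-((l : ℝ) * (β + d / 2))))) := by
          rw [Finset.sum_const, Finset.card_univ, Fintype.card_fun, Fintype.card_fin,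
            Fintype.card_fin, nsmul_eq_mul, Real.rpow_natCast, pow_mul]
          push_cast
          ring
      _ = M ^ 2 * ((2 : ℝ) ^ (-(α + β))) ^ l := by
          rw [← Real.rpow_add (by norm_num), ← Real.rpow_add (by norm_num),
            ← Real.rpow_natCast ((2 : ℝ) ^ _), ← Real.rpow_mul (by norm_num)]
          congr 2
          push_cast
          ring
  calc _ ≤ ∑ _ι ∈ Finset.univ.erase (fun _ : Fin d => false),
        M ^ 2 * ((2 : ℝ) ^ (-(α + β))) ^ l :=
        (Finset.abs_sum_le_sum_abs _ _).trans (Finset.sum_le_sum hterm)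
    _ ≤ ∑ _ι : Fin d → Bool, M ^ 2 * ((2 : ℝ) ^ (-(α + β))) ^ l :=
        Finset.sum_le_sum_of_subset_of_nonneg (Finset.erase_subset _ _)
          fun _ _ _ => by positivity
    _ = _ := by
        rw [Finset.sum_const, Finset.card_univ, Fintype.card_fun, Fintype.card_bool,
          Fintype.card_fin, nsmul_eq_mul]
        push_cast
        ring

/-- The product of the approximation errors of `p` and `b` by their projections onto `V_j`. -/
theorem exists_approximation_bound (hS : 1 ≤ S) {α β M : ℝ} (hα : 0 < α) (hβ : 0 < β)
    (hM : 0 ≤ M) : ∃ C : ℝ, 0 < C ∧ ∀ p ∈ B.holderBall d α M, ∀ b ∈ B.holderBall d β M,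
      ∀ j, B.J₀ ≤ j → |(∫ x in Icc (0 : Fin d → ℝ) 1, p x * b x) - B.projForm j p b| ≤
        C * ((2 : ℝ) ^ (-(α + β))) ^ j := by
  set q := (2 : ℝ) ^ (-(α + β)) with hq
  have hq0 : 0 < q := by positivity
  have hq1 : q < 1 := Real.rpow_lt_one_of_one_lt_of_neg (by norm_num) (by linarith)
  have h1q : 0 < 1 - q := by linarith
  set A := (2 : ℝ) ^ d * M ^ 2 with hA
  have hA0 : 0 ≤ A := by positivity
  -- The summand `1` keeps the constant positive when `M = 0`.
  refine ⟨A / (1 - q) + 1, by positivity, fun p hp b hb j hj => ?_⟩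
  -- The partial geometric sum is kept in closed form so that the induction closes; the subtracted
  -- power is dropped only after the passage to the limit.
  have step : ∀ i, |B.projForm (j + i) p b - B.projForm j p b| ≤
      A / (1 - q) * (q ^ j - q ^ (j + i)) := fun i => by
    induction i with
    | zero => simp
    | succ i ih =>
      have h1 := B.abs_projForm_succ_sub_le hM hp hb (l := j + i) (by omega)
      rw [← hq, ← hA] at h1
      have h2 : A * q ^ (j + i) = A / (1 - q) * (q ^ (j + i) - q ^ (j + (i + 1))) := by
        rw [← add_assoc, pow_succ q (j + i)]
        field_simp
      calc _ = |(B.projForm (j + i + 1) p b - B.projForm (j + i) p b) +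
            (B.projForm (j + i) p b - B.projForm j p b)| := by
            rw [← add_assoc]
            congr 1
            ring
        _ ≤ _ := (abs_add_le _ _).trans (add_le_add h1 ih)
        _ = _ := by
          rw [h2]
          ring
  have hlim := B.tendsto_projForm hS hp.1.continuousOn hb.1
  have hlim2 : Filter.Tendsto (fun i => |B.projForm (j + i) p b - B.projForm j p b|) Filter.atTop
      (nhds |(∫ x in Icc (0 : Fin d → ℝ) 1, p x * b x) - B.projForm j p b|) :=
    ((hlim.comp (Filter.tendsto_add_atTop_nat j |>.congr fun n => add_comm n j)).sub_const _).abs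
  refine le_of_tendsto hlim2 (Filter.Eventually.of_forall fun i => (step i).trans ?_)
  have hqj : 0 < q ^ j := by positivity
  have hqi : 0 < q ^ (j + i) := by positivity
  have hAq : 0 ≤ A / (1 - q) := by positivity
  nlinarith [mul_nonneg hAq hqi.le]

/-! ### Perturbations at one resolution level -/

/-- The sum of the wavelets of level `j` which are wavelets in all coordinates. -/
def bump (d j : ℕ) (x : Fin d → ℝ) : ℝ := ∑ m : Fin d → Fin (2 ^ j), B.Psi j (fun _ => true) m x

theorem bump_continuousOn (d j : ℕ) : ContinuousOn (B.bump d j) (Icc 0 1) :=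
  continuousOn_finsetSum _ fun m _ => B.Psi_continuousOn j _ m

/-- The sum over multi-indices factors into univariate sums, in each of which boundedly many
wavelets overlap at a point. -/
theorem exists_abs_bump_le (d : ℕ) : ∃ C : ℝ, 1 ≤ C ∧ ∀ j, ∀ x ∈ Icc (0 : Fin d → ℝ) 1,
    |B.bump d j x| ≤ C * (2 : ℝ) ^ ((j : ℝ) * (d / 2)) := by
  obtain ⟨D, -, hD⟩ := B.exists_localized
  have h1 := hD.one_le
  refine ⟨(3 * D ^ 2) ^ d, one_le_pow₀ (by nlinarith), fun j x hx => ?_⟩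
  have e : B.bump d j x = ∏ i, ∑ m : Fin (2 ^ j), B.wav j m (x i) := by
    rw [prod_sum_apply]
    simp [bump, Psi]
  rw [e, Finset.abs_prod]
  calc ∏ i, |∑ m : Fin (2 ^ j), B.wav j m (x i)| ≤ ∏ _i : Fin d, 3 * D ^ 2 * Real.sqrt (2 ^ j) :=
        Finset.prod_le_prod (fun _ _ => abs_nonneg _) fun i _ =>
          (Finset.abs_sum_le_sum_abs _ _).trans (hD.sum_abs_le j (mem_cube_apply hx i))
    _ = (3 * D ^ 2) ^ d * Real.sqrt (2 ^ j) ^ d := by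
        rw [Finset.prod_const, Finset.card_univ, Fintype.card_fin, mul_pow]
    _ = _ := by
        rw [Real.sqrt_eq_rpow, ← Real.rpow_natCast 2 j, ← Real.rpow_mul (by norm_num),
          ← Real.rpow_natCast ((2 : ℝ) ^ _), ← Real.rpow_mul (by norm_num)]
        congr 2
        ring

theorem integral_bump_mul_Psi (j l : ℕ) (ι : Fin d → Bool) (m : Fin d → Fin (2 ^ l)) :
    ∫ x in Icc (0 : Fin d → ℝ) 1, B.bump d j x * B.Psi l ι m x =
      ∑ m' : Fin d → Fin (2 ^ j), ∏ i, ∫ t in Icc (0 : ℝ) 1,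
        B.wav j (m' i) t * B.factor l (ι i) (m i) t := by
  simp only [bump, Finset.sum_mul]
  rw [integral_finsetSum _ fun a _ =>
    integrableOn_cube_mul (B.Psi_continuousOn j _ a) (B.Psi_continuousOn l ι m)]
  refine Finset.sum_congr rfl fun m' _ => ?_
  rw [integral_Psi_mul_Psi]
  rfl

theorem integral_wav_mul_factor_of_lt {j l : ℕ} (hl : B.J₀ ≤ l) (h : l < j) (b : Bool)
    (m' : Fin (2 ^ j)) (m : Fin (2 ^ l)) :
    ∫ t in Icc (0 : ℝ) 1, B.wav j m' t * B.factor l b m t = 0 := by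
  cases b
  · simpa [factor, mul_comm] using B.integral_scal_mul_wav hl h.le m m'
  · simpa [factor, mul_comm] using B.integral_wav_mul_wav_of_lt hl h m m'

/-- One coordinate suffices: a wavelet of level `j` is orthogonal to the scaling functions of all
coarser or equal levels. This is where `1 ≤ d` enters. -/
theorem integral_bump_mul_Phi (hd : 1 ≤ d) {j l : ℕ} (hl : B.J₀ ≤ l) (h : l ≤ j)
    (m : Fin d → Fin (2 ^ l)) :
    ∫ x in Icc (0 : Fin d → ℝ) 1, B.bump d j x * B.Phi l m x = 0 := by
  rw [← Psi_false, integral_bump_mul_Psi]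
  refine Finset.sum_eq_zero fun m' _ => Finset.prod_eq_zero (Finset.mem_univ ⟨0, hd⟩) ?_
  simpa [factor, mul_comm] using B.integral_scal_mul_wav hl h (m ⟨0, hd⟩) (m' ⟨0, hd⟩)

/-- If `l < j`, any coordinate gives a vanishing factor, as the bump is a wavelet in all of them. If
`j < l`, a coordinate in which `ι` selects a wavelet does. -/
theorem integral_bump_mul_Psi_of_ne (hd : 1 ≤ d) {j l : ℕ} (hj : B.J₀ ≤ j) (hl : B.J₀ ≤ l)
    (h : l ≠ j) {ι : Fin d → Bool} (hι : ι ≠ fun _ => false) (m : Fin d → Fin (2 ^ l)) :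
    ∫ x in Icc (0 : Fin d → ℝ) 1, B.bump d j x * B.Psi l ι m x = 0 := by
  rw [integral_bump_mul_Psi]
  refine Finset.sum_eq_zero fun m' _ => ?_
  rcases lt_or_gt_of_ne h with h | h
  · exact Finset.prod_eq_zero (Finset.mem_univ ⟨0, hd⟩)
      (B.integral_wav_mul_factor_of_lt hl h _ _ _)
  · obtain ⟨i, hi⟩ := Function.ne_iff.1 hι
    refine Finset.prod_eq_zero (Finset.mem_univ i) ?_
    rw [Bool.eq_true_of_not_eq_false hi]
    exact B.integral_wav_mul_wav_of_lt hj h _ _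

theorem integral_bump_mul_Psi_same {j : ℕ} (hj : B.J₀ ≤ j) (ι : Fin d → Bool)
    (m : Fin d → Fin (2 ^ j)) :
    ∫ x in Icc (0 : Fin d → ℝ) 1, B.bump d j x * B.Psi j ι m x =
      if (fun _ => true) = ι then 1 else 0 := by
  simp only [bump, Finset.sum_mul]
  rw [integral_finsetSum _ fun a _ =>
    integrableOn_cube_mul (B.Psi_continuousOn j _ a) (B.Psi_continuousOn j ι m)]
  simp only [B.integral_Psi_mul_Psi_same hj]
  split_ifs with h <;> simp [h]

theorem abs_integral_bump_mul_Psi_le (hd : 1 ≤ d) {j l : ℕ} (hj : B.J₀ ≤ j) (hl : B.J₀ ≤ l)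
    {ι : Fin d → Bool} (hι : ι ≠ fun _ => false) (m : Fin d → Fin (2 ^ l)) :
    |∫ x in Icc (0 : Fin d → ℝ) 1, B.bump d j x * B.Psi l ι m x| ≤ if l = j then 1 else 0 := by
  split_ifs with h
  · subst h
    rw [B.integral_bump_mul_Psi_same hj]
    split_ifs <;> simp
  · rw [B.integral_bump_mul_Psi_of_ne hd hj hl h hι, abs_zero]

/-- The bump is a sum of `2 ^ (j d)` orthonormal functions. -/
theorem integral_bump_sq {j : ℕ} (hj : B.J₀ ≤ j) :
    ∫ x in Icc (0 : Fin d → ℝ) 1, B.bump d j x * B.bump d j x = 2 ^ (j * d) := by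
  have : ∀ x, B.bump d j x * B.bump d j x =
      ∑ m, B.bump d j x * B.Psi j (fun _ => true) m x := fun x => by
    rw [← Finset.mul_sum]
    rfl
  simp only [this]
  rw [integral_finsetSum _ fun a _ =>
    integrableOn_cube_mul (B.bump_continuousOn d j) (B.Psi_continuousOn j _ a)]
  simp [B.integral_bump_mul_Psi_same hj, pow_mul]

/-- Shrinking `h` by `1 - δ` frees `δ * M` in the ball. The bump has no coarse scaling coefficients,
and its wavelet coefficients are at most one and live at the single level `j`, so it fits into the
freed room. -/
theorem add_bump_mem_holderBall (hd : 1 ≤ d) {α M δ ε : ℝ} (hM : 0 ≤ M) (hδ0 : 0 ≤ δ)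
    (hδ : δ ≤ 1) {h : (Fin d → ℝ) → ℝ} (hh : h ∈ B.holderBall d α M) {j : ℕ} (hj : B.J₀ ≤ j)
    (hε : (2 : ℝ) ^ ((j : ℝ) * (α + d / 2)) * |ε| ≤ δ * M) :
    (fun x => (1 - δ) * h x + ε * B.bump d j x) ∈ B.holderBall d α M := by
  have hc := hh.1.continuousOn
  have hu := B.bump_continuousOn d j
  have hcoef : ∀ g : (Fin d → ℝ) → ℝ, ContinuousOn g (Icc 0 1) →
      ∫ x in Icc (0 : Fin d → ℝ) 1, ((1 - δ) * h x + ε * B.bump d j x) * g x =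
        (1 - δ) * (∫ x in Icc (0 : Fin d → ℝ) 1, h x * g x) +
          ε * ∫ x in Icc (0 : Fin d → ℝ) 1, B.bump d j x * g x := fun g hg => by
    simp only [add_mul, mul_assoc]
    rw [integral_add ((integrableOn_cube_mul hc hg).const_mul _)
      ((integrableOn_cube_mul hu hg).const_mul _), integral_const_mul, integral_const_mul]
  refine ⟨isCompact_Icc.uniformContinuousOn_of_continuous
    ((continuousOn_const.mul hc).add (continuousOn_const.mul hu)), ?_⟩
  have hMe : ENNReal.ofReal M = ENNReal.ofReal (1 - δ) * ENNReal.ofReal M +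
      ENNReal.ofReal (δ * M) := by
    rw [← ENNReal.ofReal_mul (by linarith), ← ENNReal.ofReal_add
      (mul_nonneg (by linarith) hM) (by positivity)]
    congr 1
    ring
  rw [hMe]
  refine le_trans ?_ (add_le_add_left (mul_le_mul_right hh.2 (ENNReal.ofReal (1 - δ))) _)
  rw [mul_add (ENNReal.ofReal (1 - δ)), add_assoc]
  refine add_le_add ?_ ?_
  · refine iSup_le fun m => ?_
    rw [hcoef _ (B.Phi_continuousOn _ m), B.integral_bump_mul_Phi hd le_rfl hj, mul_zero,
      add_zero, abs_mul, abs_of_nonneg (by linarith : 0 ≤ 1 - δ), mul_left_comm,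
      ENNReal.ofReal_mul (by linarith)]
    exact mul_le_mul_right (le_iSup (fun m : Fin d → Fin (2 ^ B.J₀) =>
      ENNReal.ofReal ((2 : ℝ) ^ ((B.J₀ : ℝ) * (α + d / 2)) *
        |∫ x in Icc (0 : Fin d → ℝ) 1, h x * B.Phi B.J₀ m x|)) m) _
  · refine iSup_le fun l => iSup_le fun hl => iSup_le fun m => iSup_le fun ι => iSup_le fun hι => ?_
    rw [hcoef _ (B.Psi_continuousOn _ _ m)]
    set a := ∫ x in Icc (0 : Fin d → ℝ) 1, h x * B.Psi l ι m x with ha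
    set w := (2 : ℝ) ^ ((l : ℝ) * (α + d / 2)) with hw
    have hw0 : 0 < w := by positivity
    have hb := B.abs_integral_bump_mul_Psi_le hd hj hl hι m
    set c := ∫ x in Icc (0 : Fin d → ℝ) 1, B.bump d j x * B.Psi l ι m x with hc'
    have h2 : w * |ε * c| ≤ δ * M := by
      rw [abs_mul]
      split_ifs at hb with hlj
      · subst hlj
        calc w * (|ε| * |c|) ≤ w * (|ε| * 1) := by gcongr
          _ ≤ _ := by rwa [mul_one]
      · have : |c| = 0 := le_antisymm hb (abs_nonneg _)
        rw [this]
        simp only [mul_zero]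
        positivity
    have h1 : w * |(1 - δ) * a + ε * c| ≤ (1 - δ) * (w * |a|) + δ * M := by
      calc w * |(1 - δ) * a + ε * c| ≤ w * (|(1 - δ) * a| + |ε * c|) := by
            gcongr
            exact abs_add_le _ _
        _ = (1 - δ) * (w * |a|) + w * |ε * c| := by
            rw [abs_mul (1 - δ), abs_of_nonneg (by linarith : 0 ≤ 1 - δ)]
            ring
        _ ≤ _ := by linarith
    refine (ENNReal.ofReal_le_ofReal h1).trans ?_
    rw [ENNReal.ofReal_add (mul_nonneg (by linarith) (by positivity)) (by positivity),
      ENNReal.ofReal_mul (by linarith)]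
    refine add_le_add_left (mul_le_mul_right ?_ _) _
    exact le_iSup_of_le l (le_iSup_of_le hl (le_iSup_of_le m (le_iSup_of_le ι
      (le_iSup_of_le hι le_rfl))))

end CDVBasis

/-! ### Bounded measurable functions -/

/-- Strongly measurable and bounded functions. -/
structure BddMeasurable {Ω H : Type*} [MeasurableSpace Ω] [NormedAddCommGroup H] (f : Ω → H) :
    Prop where
  stronglyMeasurable : StronglyMeasurable f
  bound : ∃ C, ∀ x, ‖f x‖ ≤ C

namespace BddMeasurable

variable {Ω Ω' H : Type*} [MeasurableSpace Ω] [MeasurableSpace Ω'] [NormedAddCommGroup H]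
  {f g : Ω → H}

theorem const (c : H) : BddMeasurable fun _ : Ω => c :=
  ⟨stronglyMeasurable_const, ‖c‖, fun _ => le_rfl⟩

theorem add (hf : BddMeasurable f) (hg : BddMeasurable g) : BddMeasurable fun x => f x + g x := by
  obtain ⟨C, hC⟩ := hf.bound
  obtain ⟨C', hC'⟩ := hg.bound
  exact ⟨hf.1.add hg.1, C + C', fun x => (norm_add_le _ _).trans (add_le_add (hC x) (hC' x))⟩

theorem neg (hf : BddMeasurable f) : BddMeasurable fun x => -f x :=
  ⟨hf.1.neg, by simpa using hf.2⟩

theorem sub (hf : BddMeasurable f) (hg : BddMeasurable g) : BddMeasurable fun x => f x - g x := by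
  simpa only [sub_eq_add_neg] using hf.add hg.neg

theorem sum {ι : Type*} (s : Finset ι) {f : ι → Ω → H} (hf : ∀ i, BddMeasurable (f i)) :
    BddMeasurable fun x => ∑ i ∈ s, f i x := by
  classical
  induction s using Finset.induction_on with
  | empty => simpa using const (Ω := Ω) (0 : H)
  | insert a s ha ih =>
    simp only [Finset.sum_insert ha]
    exact (hf a).add ih

theorem comp (hf : BddMeasurable f) {φ : Ω' → Ω} (hφ : Measurable φ) :
    BddMeasurable fun x => f (φ x) :=
  ⟨hf.1.comp_measurable hφ, hf.2.imp fun _ h _ => h _⟩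

theorem norm (hf : BddMeasurable f) : BddMeasurable fun x => ‖f x‖ :=
  ⟨hf.1.norm, by simpa using hf.2⟩

theorem smul [NormedSpace ℝ H] {a : Ω → ℝ} (ha : BddMeasurable a) (hf : BddMeasurable f) :
    BddMeasurable fun x => a x • f x := by
  obtain ⟨C, hC⟩ := ha.bound
  obtain ⟨C', hC'⟩ := hf.bound
  refine ⟨ha.1.smul hf.1, C * C', fun x => ?_⟩
  rw [norm_smul]
  exact mul_le_mul (hC x) (hC' x) (norm_nonneg _) ((norm_nonneg _).trans (hC x))

theorem mul {a b : Ω → ℝ} (ha : BddMeasurable a) (hb : BddMeasurable b) :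
    BddMeasurable fun x => a x * b x := ha.smul hb

theorem pow {a : Ω → ℝ} (ha : BddMeasurable a) (k : ℕ) : BddMeasurable fun x => a x ^ k := by
  induction k with
  | zero => simpa using const (Ω := Ω) (1 : ℝ)
  | succ k ih => simpa only [pow_succ] using ih.mul ha

theorem inner [InnerProductSpace ℝ H] (hf : BddMeasurable f) (hg : BddMeasurable g) :
    BddMeasurable fun x => inner ℝ (f x) (g x) := by
  obtain ⟨C, hC⟩ := hf.bound
  obtain ⟨C', hC'⟩ := hg.bound
  exact ⟨hf.1.inner hg.1, C * C', fun x => (norm_inner_le_norm _ _).trans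
    (mul_le_mul (hC x) (hC' x) (norm_nonneg _) ((norm_nonneg _).trans (hC x)))⟩

theorem integrable (hf : BddMeasurable f) (μ : Measure Ω) [IsFiniteMeasure μ] : Integrable f μ := by
  obtain ⟨C, hC⟩ := hf.bound
  exact Integrable.of_bound hf.1.aestronglyMeasurable C (Filter.Eventually.of_forall hC)

theorem memLp (hf : BddMeasurable f) (μ : Measure Ω) [IsFiniteMeasure μ] (p : ℝ≥0∞) :
    MemLp f p μ := by
  obtain ⟨C, hC⟩ := hf.bound
  exact MemLp.of_bound hf.1.aestronglyMeasurable C (Filter.Eventually.of_forall hC)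

theorem integral_right [NormedSpace ℝ H] {f : Ω' × Ω → H} (hf : BddMeasurable f) (μ : Measure Ω)
    [IsProbabilityMeasure μ] : BddMeasurable fun x => ∫ y, f (x, y) ∂μ := by
  obtain ⟨C, hC⟩ := hf.bound
  refine ⟨hf.1.integral_prod_right', C, fun x => ?_⟩
  have := norm_integral_le_of_norm_le_const (μ := μ)
    (Filter.Eventually.of_forall fun y => hC (x, y))
  simpa using this

theorem right {f : Ω' × Ω → H} (hf : BddMeasurable f) (x : Ω') : BddMeasurable fun y => f (x, y) :=
  hf.comp measurable_prodMk_left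

end BddMeasurable

/-! ### Moments of sums of independent copies -/

section Moments

variable {Ω : Type*} [MeasurableSpace Ω] {P : Measure Ω} [IsProbabilityMeasure P]

theorem integral_pi_succ (n : ℕ) (F : Ω × (Fin n → Ω) → ℝ) :
    ∫ ω, F (ω 0, fun i => ω i.succ) ∂(Measure.pi fun _ : Fin (n + 1) => P) =
      ∫ z, F z ∂(P.prod (Measure.pi fun _ : Fin n => P)) := by
  rw [← (measurePreserving_piFinSuccAbove (fun _ : Fin (n + 1) => P) 0).integral_comp']
  simp [MeasurableEquiv.piFinSuccAbove, Fin.insertNthEquiv]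
  rfl

theorem integral_pi_eval {ι H : Type*} [Fintype ι] [NormedAddCommGroup H] [NormedSpace ℝ H]
    (i : ι) (f : Ω → H) (hf : BddMeasurable f) :
    ∫ ω, f (ω i) ∂(Measure.pi fun _ : ι => P) = ∫ o, f o ∂P := by
  have h := measurePreserving_eval (fun _ : ι => P) i
  conv_rhs => rw [← h.map_eq]
  rw [integral_map h.measurable.aemeasurable (by rw [h.map_eq]; exact hf.1.aestronglyMeasurable)]

theorem integral_pi_sum (n : ℕ) (f : Ω → ℝ) (hf : BddMeasurable f) :
    ∫ ω, ∑ i, f (ω i) ∂(Measure.pi fun _ : Fin n => P) = n * ∫ o, f o ∂P := by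
  rw [integral_finsetSum _ fun i _ => (hf.comp (measurable_pi_apply i)).integrable _]
  simp [integral_pi_eval _ f hf]

theorem BddMeasurable.pi_sum {H : Type*} [NormedAddCommGroup H] {n : ℕ} {U : Ω → H} (hU : BddMeasurable U) :
    BddMeasurable fun ω : Fin n → Ω => ∑ i, U (ω i) :=
  BddMeasurable.sum _ fun i => hU.comp (measurable_pi_apply i)

theorem integral_prod_fst {Ω' : Type*} [MeasurableSpace Ω'] {ν : Measure Ω'}
    [IsProbabilityMeasure ν] (f : Ω → ℝ) : ∫ z, f z.1 ∂(P.prod ν) = ∫ x, f x ∂P := by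
  rw [integral_fun_fst]
  simp

theorem integral_prod_snd {Ω' : Type*} [MeasurableSpace Ω'] {ν : Measure Ω'}
    [IsProbabilityMeasure ν] (f : Ω' → ℝ) : ∫ z, f z.2 ∂(P.prod ν) = ∫ x, f x ∂ν := by
  rw [integral_fun_snd]
  simp

variable {H K : Type*} [NormedAddCommGroup H] [InnerProductSpace ℝ H]
  [NormedAddCommGroup K] [InnerProductSpace ℝ K]

theorem integral_pi_sum_eq_zero {n : ℕ} {U : Ω → H} (hU : BddMeasurable U)
    (hU0 : ∫ o, U o ∂P = 0) : ∫ ω, ∑ i, U (ω i) ∂(Measure.pi fun _ : Fin n => P) = 0 := by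
  rw [integral_finsetSum _ fun i _ => (hU.comp (measurable_pi_apply i)).integrable _]
  simp [integral_pi_eval _ U hU, hU0]

/-- In the expansion, the only cross term which is not linear in a centered independent factor is `4
⟨s,u⟩ ⟨t,v⟩`. Cauchy–Schwarz and the inequality of means bound it by `2 (‖s‖² ‖v‖² + ‖u‖² ‖t‖²)`,
which turns coefficients `1` into `3`. -/
theorem norm_add_sq_mul_norm_add_sq_le (s u : H) (t v : K) :
    ‖u + s‖ ^ 2 * ‖v + t‖ ^ 2 ≤ (‖s‖ ^ 2 * ‖t‖ ^ 2 + ‖u‖ ^ 2 * ‖v‖ ^ 2 +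
      3 * (‖s‖ ^ 2 * ‖v‖ ^ 2) + 3 * (‖u‖ ^ 2 * ‖t‖ ^ 2)) +
      (2 * (‖s‖ ^ 2 * inner ℝ t v) + 2 * (‖t‖ ^ 2 * inner ℝ s u) +
      2 * (‖v‖ ^ 2 * inner ℝ u s) + 2 * (‖u‖ ^ 2 * inner ℝ v t)) := by
  rw [norm_add_sq_real, norm_add_sq_real, real_inner_comm s u, real_inner_comm t v]
  have h1 : inner ℝ s u * inner ℝ t v ≤ (‖s‖ * ‖u‖) * (‖t‖ * ‖v‖) := by
    refine (le_abs_self _).trans ?_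
    rw [abs_mul]
    exact mul_le_mul (abs_real_inner_le_norm _ _) (abs_real_inner_le_norm _ _) (abs_nonneg _)
      (by positivity)
  nlinarith [sq_nonneg (‖s‖ * ‖v‖ - ‖u‖ * ‖t‖)]

variable [CompleteSpace H] [CompleteSpace K]

/-- An inner product with an independent centered factor has mean zero. -/
theorem integral_prod_mul_inner_eq_zero {Ω' : Type*} [MeasurableSpace Ω'] {ν : Measure Ω'}
    [IsProbabilityMeasure ν] {f : Ω' → ℝ} {T : Ω' → H} {V : Ω → H} (hf : BddMeasurable f)
    (hT : BddMeasurable T) (hV : BddMeasurable V) (hV0 : ∫ o, V o ∂P = 0) :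
    ∫ z, f z.2 * inner ℝ (T z.2) (V z.1) ∂(P.prod ν) = 0 := by
  have hi : BddMeasurable fun z : Ω × Ω' => f z.2 * inner ℝ (T z.2) (V z.1) :=
    (hf.comp measurable_snd).mul ((hT.comp measurable_snd).inner (hV.comp measurable_fst))
  rw [integral_prod_symm _ (hi.integrable _)]
  simp only [integral_const_mul]
  have : ∀ y, ∫ x, inner ℝ (T y) (V x) ∂P = 0 := fun y => by
    rw [integral_inner (hV.integrable P), hV0, inner_zero_right]
  simp [this]

theorem integral_prod_mul_inner_eq_zero' {Ω' : Type*} [MeasurableSpace Ω'] {ν : Measure Ω'}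
    [IsProbabilityMeasure ν] {f : Ω → ℝ} {T : Ω → H} {V : Ω' → H} (hf : BddMeasurable f)
    (hT : BddMeasurable T) (hV : BddMeasurable V) (hV0 : ∫ o, V o ∂ν = 0) :
    ∫ z, f z.1 * inner ℝ (T z.1) (V z.2) ∂(P.prod ν) = 0 := by
  have hi : BddMeasurable fun z : Ω × Ω' => f z.1 * inner ℝ (T z.1) (V z.2) :=
    (hf.comp measurable_fst).mul ((hT.comp measurable_fst).inner (hV.comp measurable_snd))
  rw [integral_prod _ (hi.integrable _)]
  simp only [integral_const_mul]
  have : ∀ y, ∫ x, inner ℝ (T y) (V x) ∂ν = 0 := fun y => by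
    rw [integral_inner (hV.integrable ν), hV0, inner_zero_right]
  simp [this]

/-- For distinct indices independence gives `⟨E U, E V⟩ = 0`, so only the diagonal survives;
centering of one factor is enough. -/
theorem integral_inner_sum_sum (n : ℕ) {U V : Ω → H} (hU : BddMeasurable U)
    (hV : BddMeasurable V) (hV0 : ∫ o, V o ∂P = 0) :
    ∫ ω, inner ℝ (∑ i, U (ω i)) (∑ i, V (ω i)) ∂(Measure.pi fun _ : Fin n => P) =
      n * ∫ o, inner ℝ (U o) (V o) ∂P := by
  induction n with
  | zero => simp
  | succ n ih =>
    have hS := hU.pi_sum (n := n)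
    have hT := hV.pi_sum (n := n)
    have h1 := hU.comp (measurable_fst (α := Ω) (β := Fin n → Ω))
    have h2 := hV.comp (measurable_fst (α := Ω) (β := Fin n → Ω))
    have h3 := hS.comp (measurable_snd (α := Ω) (β := Fin n → Ω))
    have h4 := hT.comp (measurable_snd (α := Ω) (β := Fin n → Ω))
    have e := integral_pi_succ (P := P) n fun z =>
      inner ℝ (U z.1 + ∑ i, U (z.2 i)) (V z.1 + ∑ i, V (z.2 i))
    simp only [Fin.sum_univ_succ]
    rw [e]
    simp only [inner_add_left, inner_add_right]
    rw [integral_add, integral_add, integral_add, integral_prod_fst (fun o => inner ℝ (U o) (V o)),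
      integral_prod_snd (fun ω : Fin n → Ω => inner ℝ (∑ i, U (ω i)) (∑ i, V (ω i))), ih]
    · have z1 := integral_prod_mul_inner_eq_zero (ν := Measure.pi fun _ : Fin n => P)
        (BddMeasurable.const 1) hS hV hV0
      have z2 := integral_prod_mul_inner_eq_zero' (P := P) (BddMeasurable.const 1) hU hT
        (integral_pi_sum_eq_zero hV hV0)
      simp only [one_mul] at z1 z2
      rw [z1, z2]
      push_cast
      ring
    all_goals first
      | exact (h1.inner h2).integrable _
      | exact (h3.inner h2).integrable _
      | exact (h1.inner h4).integrable _
      | exact (h3.inner h4).integrable _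
      | exact ((h1.inner h2).add (h3.inner h2)).integrable _
      | exact ((h1.inner h4).add (h3.inner h4)).integrable _

theorem integral_norm_sum_sq (n : ℕ) {U : Ω → H} (hU : BddMeasurable U)
    (hU0 : ∫ o, U o ∂P = 0) :
    ∫ ω, ‖∑ i, U (ω i)‖ ^ 2 ∂(Measure.pi fun _ : Fin n => P) = n * ∫ o, ‖U o‖ ^ 2 ∂P := by
  have := integral_inner_sum_sum (P := P) n hU hU hU0
  simpa only [real_inner_self_eq_norm_sq] using this

/-- A bound for the mixed fourth moment of sums of independent copies of centered vectors. -/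
theorem integral_norm_sum_sq_mul_le (n : ℕ) {U : Ω → H} {V : Ω → K} (hU : BddMeasurable U)
    (hV : BddMeasurable V) (hU0 : ∫ o, U o ∂P = 0) (hV0 : ∫ o, V o ∂P = 0) :
    ∫ ω, ‖∑ i, U (ω i)‖ ^ 2 * ‖∑ i, V (ω i)‖ ^ 2 ∂(Measure.pi fun _ : Fin n => P) ≤
      n * (∫ o, ‖U o‖ ^ 2 * ‖V o‖ ^ 2 ∂P) +
        3 * n ^ 2 * ((∫ o, ‖U o‖ ^ 2 ∂P) * ∫ o, ‖V o‖ ^ 2 ∂P) := by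
  induction n with
  | zero => simp
  | succ n ih =>
    set ν := Measure.pi fun _ : Fin n => P with hν
    have hS := hU.pi_sum (n := n)
    have hT := hV.pi_sum (n := n)
    have h1 := hU.comp (measurable_fst (α := Ω) (β := Fin n → Ω))
    have h2 := hV.comp (measurable_fst (α := Ω) (β := Fin n → Ω))
    have h3 := hS.comp (measurable_snd (α := Ω) (β := Fin n → Ω))
    have h4 := hT.comp (measurable_snd (α := Ω) (β := Fin n → Ω))
    have e := integral_pi_succ (P := P) n fun z =>
      ‖U z.1 + ∑ i, U (z.2 i)‖ ^ 2 * ‖V z.1 + ∑ i, V (z.2 i)‖ ^ 2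
    simp only [Fin.sum_univ_succ]
    rw [e]
    have m1 : BddMeasurable fun z : Ω × (Fin n → Ω) =>
      ‖∑ i, U (z.2 i)‖ ^ 2 * ‖∑ i, V (z.2 i)‖ ^ 2 := (h3.norm.pow 2).mul (h4.norm.pow 2)
    have m2 : BddMeasurable fun z : Ω × (Fin n → Ω) => ‖U z.1‖ ^ 2 * ‖V z.1‖ ^ 2 :=
      (h1.norm.pow 2).mul (h2.norm.pow 2)
    have m3 : BddMeasurable fun z : Ω × (Fin n → Ω) =>
      3 * (‖∑ i, U (z.2 i)‖ ^ 2 * ‖V z.1‖ ^ 2) :=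
      (BddMeasurable.const 3).mul ((h3.norm.pow 2).mul (h2.norm.pow 2))
    have m4 : BddMeasurable fun z : Ω × (Fin n → Ω) =>
      3 * (‖U z.1‖ ^ 2 * ‖∑ i, V (z.2 i)‖ ^ 2) :=
      (BddMeasurable.const 3).mul ((h1.norm.pow 2).mul (h4.norm.pow 2))
    have m5 : BddMeasurable fun z : Ω × (Fin n → Ω) =>
      2 * (‖∑ i, U (z.2 i)‖ ^ 2 * inner ℝ (∑ i, V (z.2 i)) (V z.1)) :=
      (BddMeasurable.const 2).mul ((h3.norm.pow 2).mul (h4.inner h2))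
    have m6 : BddMeasurable fun z : Ω × (Fin n → Ω) =>
      2 * (‖∑ i, V (z.2 i)‖ ^ 2 * inner ℝ (∑ i, U (z.2 i)) (U z.1)) :=
      (BddMeasurable.const 2).mul ((h4.norm.pow 2).mul (h3.inner h1))
    have m7 : BddMeasurable fun z : Ω × (Fin n → Ω) =>
      2 * (‖V z.1‖ ^ 2 * inner ℝ (U z.1) (∑ i, U (z.2 i))) :=
      (BddMeasurable.const 2).mul ((h2.norm.pow 2).mul (h1.inner h3))
    have m8 : BddMeasurable fun z : Ω × (Fin n → Ω) =>
      2 * (‖U z.1‖ ^ 2 * inner ℝ (V z.1) (∑ i, V (z.2 i))) :=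
      (BddMeasurable.const 2).mul ((h1.norm.pow 2).mul (h2.inner h4))
    have m0 : BddMeasurable fun z : Ω × (Fin n → Ω) =>
      ‖U z.1 + ∑ i, U (z.2 i)‖ ^ 2 * ‖V z.1 + ∑ i, V (z.2 i)‖ ^ 2 :=
      ((h1.add h3).norm.pow 2).mul ((h2.add h4).norm.pow 2)
    have hmono := integral_mono (μ := P.prod ν) (m0.integrable _)
      ((((m1.add m2).add m3).add m4).add (((m5.add m6).add m7).add m8) |>.integrable _)
      fun z => norm_add_sq_mul_norm_add_sq_le (∑ i, U (z.2 i)) (U z.1) (∑ i, V (z.2 i)) (V z.1)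
    refine hmono.trans ?_
    rw [integral_add ((((m1.add m2).add m3).add m4).integrable _)
      ((((m5.add m6).add m7).add m8).integrable _),
      integral_add (((m1.add m2).add m3).integrable _) (m4.integrable _),
      integral_add ((m1.add m2).integrable _) (m3.integrable _),
      integral_add (m1.integrable _) (m2.integrable _),
      integral_add (((m5.add m6).add m7).integrable _) (m8.integrable _),
      integral_add ((m5.add m6).integrable _) (m7.integrable _),
      integral_add (m5.integrable _) (m6.integrable _)]
    simp only [integral_const_mul]
    rw [integral_prod_mul_inner_eq_zero (hS.norm.pow 2) hT hV hV0,
      integral_prod_mul_inner_eq_zero (hT.norm.pow 2) hS hU hU0,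
      integral_prod_mul_inner_eq_zero' (hV.norm.pow 2) hU hS (integral_pi_sum_eq_zero hU hU0),
      integral_prod_mul_inner_eq_zero' (hU.norm.pow 2) hV hT (integral_pi_sum_eq_zero hV hV0),
      integral_prod_fst (fun o => ‖U o‖ ^ 2 * ‖V o‖ ^ 2),
      integral_prod_snd (fun ω : Fin n → Ω => ‖∑ i, U (ω i)‖ ^ 2 * ‖∑ i, V (ω i)‖ ^ 2),
      integral_prod_mul (fun o => ‖U o‖ ^ 2) (fun ω : Fin n → Ω => ‖∑ i, V (ω i)‖ ^ 2)]
    have e3 : ∫ z : Ω × (Fin n → Ω), ‖∑ i, U (z.2 i)‖ ^ 2 * ‖V z.1‖ ^ 2 ∂(P.prod ν) =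
        (∫ o, ‖V o‖ ^ 2 ∂P) * ∫ ω, ‖∑ i, U (ω i)‖ ^ 2 ∂ν := by
      rw [← integral_prod_mul (fun o => ‖V o‖ ^ 2) (fun ω : Fin n → Ω => ‖∑ i, U (ω i)‖ ^ 2)]
      simp only [mul_comm]
    -- The two mixed terms add `3 n + 3 n` times the product of second moments, and `6 n ≤ 3 ((n +
    -- 1)² - n²)`.
    rw [e3, integral_norm_sum_sq n hU hU0, integral_norm_sum_sq n hV hV0]
    have hn : (0 : ℝ) ≤ n := n.cast_nonneg
    have ha : 0 ≤ ∫ o, ‖U o‖ ^ 2 ∂P := integral_nonneg fun _ => by positivity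
    have hb : 0 ≤ ∫ o, ‖V o‖ ^ 2 ∂P := integral_nonneg fun _ => by positivity
    have hab := mul_nonneg ha hb
    push_cast
    nlinarith

/-- The mean square error of an average of `n` independent copies of `F (w, ·)`. -/
theorem integral_average_sub_sq_le {W : Type*} [MeasurableSpace W] {μ : Measure W}
    [IsProbabilityMeasure μ] {n : ℕ} (hn : 1 ≤ n) {F : W × Ω → ℝ} (hF : BddMeasurable F) (c : ℝ) :
    ∫ z, ((1 / n : ℝ) * ∑ i, F (z.1, z.2 i) - c) ^ 2
        ∂(μ.prod (Measure.pi fun _ : Fin n => P)) ≤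
      2 / n * (∫ w, ∫ o, F (w, o) ^ 2 ∂P ∂μ) + 2 * ∫ w, ((∫ o, F (w, o) ∂P) - c) ^ 2 ∂μ := by
  have hn0 : (0 : ℝ) < n := by exact_mod_cast hn
  have hm : BddMeasurable fun z : W × (Fin n → Ω) =>
      ((1 / n : ℝ) * ∑ i, F (z.1, z.2 i) - c) ^ 2 :=
    (((BddMeasurable.const _).mul (BddMeasurable.sum _ fun i => hF.comp (by fun_prop))).sub
      (BddMeasurable.const c)).pow 2
  have hq := ((hF.pow 2).integral_right P)
  have hr := (((hF.integral_right P).sub (BddMeasurable.const c)).pow 2)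
  rw [integral_prod _ (hm.integrable _), ← integral_const_mul, ← integral_const_mul,
    ← integral_add (((BddMeasurable.const _).mul hq).integrable _)
      (((BddMeasurable.const _).mul hr).integrable _)]
  refine integral_mono ((hm.integral_right _).integrable _)
    ((((BddMeasurable.const _).mul hq).add ((BddMeasurable.const _).mul hr)).integrable _)
    fun w => ?_
  have hFw := hF.right w
  set m := ∫ o, F (w, o) ∂P with hmdef
  have hU : BddMeasurable fun o => F (w, o) - m := hFw.sub (BddMeasurable.const m)
  have hU0 : ∫ o, (F (w, o) - m) ∂P = 0 := by
    rw [integral_sub (hFw.integrable _) (integrable_const _)]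
    simp [hmdef]
  have hvar := integral_norm_sum_sq (P := P) n hU hU0
  have hU2 : ∫ o, ‖F (w, o) - m‖ ^ 2 ∂P ≤ ∫ o, F (w, o) ^ 2 ∂P := by
    have e : ∀ o, ‖F (w, o) - m‖ ^ 2 = F (w, o) ^ 2 - 2 * m * F (w, o) + m ^ 2 := fun o => by
      rw [Real.norm_eq_abs, sq_abs]
      ring
    simp only [e]
    rw [integral_add (((hFw.pow 2).sub ((BddMeasurable.const (2 * m)).mul hFw)).integrable _)
      (integrable_const _), integral_sub ((hFw.pow 2).integrable _)
      (((BddMeasurable.const (2 * m)).mul hFw).integrable _), integral_const_mul, ← hmdef]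
    simp
    nlinarith [sq_nonneg m]
  -- Split around the conditional mean `m` given `w`: the sampling error is `1 / n` times a
  -- conditional variance, the other part is the error of `m` itself.
  have hpt : ∀ ω : Fin n → Ω, ((1 / n : ℝ) * ∑ i, F (w, ω i) - c) ^ 2 ≤
      2 / (n : ℝ) ^ 2 * ‖∑ i, (F (w, ω i) - m)‖ ^ 2 + 2 * (m - c) ^ 2 := fun ω => by
    rw [Real.norm_eq_abs, sq_abs, Finset.sum_sub_distrib]
    simp only [Finset.sum_const, Finset.card_univ, Fintype.card_fin, nsmul_eq_mul]
    set s := ∑ i, F (w, ω i)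
    have e : (1 / n : ℝ) * s - c = (1 / n : ℝ) * (s - n * m) + (m - c) := by
      field_simp
      ring
    have e2 : 2 / (n : ℝ) ^ 2 * (s - n * m) ^ 2 = 2 * ((1 / n : ℝ) * (s - n * m)) ^ 2 := by
      field_simp
    rw [e, e2]
    nlinarith [sq_nonneg ((1 / n : ℝ) * (s - n * m) - (m - c))]
  have hb2 : BddMeasurable fun ω : Fin n → Ω =>
      2 / (n : ℝ) ^ 2 * ‖∑ i, (F (w, ω i) - m)‖ ^ 2 :=
    (BddMeasurable.const _).mul (hU.pi_sum.norm.pow 2)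
  calc _ ≤ ∫ ω, (2 / (n : ℝ) ^ 2 * ‖∑ i, (F (w, ω i) - m)‖ ^ 2 + 2 * (m - c) ^ 2)
        ∂(Measure.pi fun _ : Fin n => P) :=
        integral_mono ((hm.right w).integrable _)
          ((hb2.add (BddMeasurable.const _)).integrable _) hpt
    _ = 2 / n * (∫ o, ‖F (w, o) - m‖ ^ 2 ∂P) + 2 * (m - c) ^ 2 := by
        rw [integral_add (hb2.integrable _) (integrable_const _), integral_const_mul, hvar]
        simp
        field_simp
    _ ≤ _ := by gcongr

end Moments

/-! ### Averages of independent copies -/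

section Averages

variable {Ω : Type*} [MeasurableSpace Ω] {P : Measure Ω} [IsProbabilityMeasure P]

theorem BddMeasurable.integral_sub_integral_sq_le {u : Ω → ℝ} (hu : BddMeasurable u) :
    ∫ o, (u o - ∫ o', u o' ∂P) ^ 2 ∂P ≤ ∫ o, u o ^ 2 ∂P := by
  set m := ∫ o, u o ∂P with hm
  have e : ∀ o, (u o - m) ^ 2 = u o ^ 2 - 2 * m * u o + m ^ 2 := fun o => by ring
  simp only [e]
  rw [integral_add (((hu.pow 2).sub ((BddMeasurable.const (2 * m)).mul hu)).integrable _)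
    (integrable_const _), integral_sub ((hu.pow 2).integrable _)
    (((BddMeasurable.const (2 * m)).mul hu).integrable _), integral_const_mul, ← hm]
  simp
  nlinarith [sq_nonneg m]

theorem BddMeasurable.integral_sub_integral {H : Type*} [NormedAddCommGroup H] [NormedSpace ℝ H]
    [CompleteSpace H] {u : Ω → H} (hu : BddMeasurable u) :
    ∫ o, (u o - ∫ o', u o' ∂P) ∂P = 0 := by
  rw [integral_sub (hu.integrable _) (integrable_const _)]
  simp

theorem average_eq {α : Type*} {n : ℕ} (hn : 1 ≤ n) {H : Type*} [NormedAddCommGroup H] [NormedSpace ℝ H]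
    (u : α → H) (m : H) (ω : Fin n → α) :
    (1 / n : ℝ) • ∑ i, u (ω i) = m + (1 / n : ℝ) • ∑ i, (u (ω i) - m) := by
  have hn0 : (n : ℝ) ≠ 0 := by positivity
  rw [Finset.sum_sub_distrib, smul_sub]
  simp only [Finset.sum_const, Finset.card_univ, Fintype.card_fin]
  rw [← Nat.cast_smul_eq_nsmul ℝ, smul_smul, one_div_mul_cancel hn0, one_smul]
  abel

theorem BddMeasurable.average {n : ℕ} {u : Ω → ℝ} (hu : BddMeasurable u) :
    BddMeasurable fun ω : Fin n → Ω => (1 / n : ℝ) * ∑ i, u (ω i) :=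
  (BddMeasurable.const _).mul hu.pi_sum

theorem integral_average {n : ℕ} (hn : 1 ≤ n) {u : Ω → ℝ} (hu : BddMeasurable u) :
    ∫ ω, (1 / n : ℝ) * ∑ i, u (ω i) ∂(Measure.pi fun _ : Fin n => P) = ∫ o, u o ∂P := by
  rw [integral_const_mul, integral_pi_sum n u hu]
  field_simp

theorem integral_average_sub_mean_sq_le {n : ℕ} (hn : 1 ≤ n) {u : Ω → ℝ} (hu : BddMeasurable u) :
    ∫ ω, ((1 / n : ℝ) * ∑ i, u (ω i) - ∫ o, u o ∂P) ^ 2 ∂(Measure.pi fun _ : Fin n => P) ≤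
      (∫ o, u o ^ 2 ∂P) / n := by
  have hn0 : (0 : ℝ) < n := by exact_mod_cast hn
  set m := ∫ o, u o ∂P with hm
  have e : ∀ ω : Fin n → Ω, ((1 / n : ℝ) * ∑ i, u (ω i) - m) ^ 2 =
      (1 / n : ℝ) ^ 2 * ‖∑ i, (u (ω i) - m)‖ ^ 2 := fun ω => by
    have := average_eq hn u m ω
    simp only [smul_eq_mul] at this
    rw [this, Real.norm_eq_abs, sq_abs]
    ring
  simp only [e]
  rw [integral_const_mul, integral_norm_sum_sq n (hu.sub (BddMeasurable.const m))
    hu.integral_sub_integral]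
  simp only [Real.norm_eq_abs, sq_abs]
  have := hu.integral_sub_integral_sq_le (P := P)
  rw [← hm] at this
  calc _ = (∫ o, (u o - m) ^ 2 ∂P) / n := by field_simp
    _ ≤ _ := by gcongr

theorem integral_average_sq_le {n : ℕ} (hn : 1 ≤ n) {u : Ω → ℝ} (hu : BddMeasurable u) {t A : ℝ}
    (ht : |∫ o, u o ∂P| ≤ t) (hA : ∫ o, u o ^ 2 ∂P ≤ A) :
    ∫ ω, ((1 / n : ℝ) * ∑ i, u (ω i)) ^ 2 ∂(Measure.pi fun _ : Fin n => P) ≤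
      2 * t ^ 2 + 2 * (A / n) := by
  have hn0 : (0 : ℝ) < n := by exact_mod_cast hn
  set m := ∫ o, u o ∂P with hm
  have hmt : m ^ 2 ≤ t ^ 2 := sq_le_sq' (by linarith [(abs_le.1 ht).1]) (abs_le.1 ht).2
  have hb := (hu.average (n := n)).sub (BddMeasurable.const m)
  calc _ ≤ ∫ ω, (2 * m ^ 2 + 2 * ((1 / n : ℝ) * ∑ i, u (ω i) - m) ^ 2)
        ∂(Measure.pi fun _ : Fin n => P) := by
        refine integral_mono ((hu.average.pow 2).integrable _)
          (((BddMeasurable.const _).add ((BddMeasurable.const 2).mul (hb.pow 2))).integrable _)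
          fun ω => ?_
        simp only
        nlinarith [sq_nonneg ((1 / n : ℝ) * ∑ i, u (ω i) - 2 * m)]
    _ = 2 * m ^ 2 + 2 * ∫ ω, ((1 / n : ℝ) * ∑ i, u (ω i) - m) ^ 2
        ∂(Measure.pi fun _ : Fin n => P) := by
        rw [integral_add (integrable_const _)
          (((BddMeasurable.const 2).mul (hb.pow 2)).integrable _)]
        simp only [integral_const, probReal_univ, one_smul, integral_const_mul]
    _ ≤ _ := by
        have h1 := integral_average_sub_mean_sq_le (P := P) hn hu
        have h2 : (∫ o, u o ^ 2 ∂P) / n ≤ A / n := by gcongr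
        rw [← hm] at h1
        linarith

/-- A bound for the mixed fourth moment of two averages of independent copies. -/
theorem integral_average_sq_mul_le {n : ℕ} (hn : 1 ≤ n) {u v : Ω → ℝ} (hu : BddMeasurable u)
    (hv : BddMeasurable v) {t A₁ A₂ A₁₂ : ℝ} (ht : |∫ o, u o ∂P| ≤ t) (ht' : |∫ o, v o ∂P| ≤ t)
    (h1 : ∫ o, u o ^ 2 ∂P ≤ A₁) (h2 : ∫ o, v o ^ 2 ∂P ≤ A₂)
    (h12 : ∫ o, u o ^ 2 * v o ^ 2 ∂P ≤ A₁₂) :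
    ∫ ω, ((1 / n : ℝ) * ∑ i, u (ω i)) ^ 2 * ((1 / n : ℝ) * ∑ i, v (ω i)) ^ 2
        ∂(Measure.pi fun _ : Fin n => P) ≤
      4 * (t ^ 4 + t ^ 2 * (A₁ / n) + t ^ 2 * (A₂ / n) +
        (4 * (A₁₂ + t ^ 2 * A₁ + t ^ 2 * A₂ + t ^ 4) / n ^ 3 + 3 * (A₁ * A₂) / n ^ 2)) := by
  have hn0 : (0 : ℝ) < n := by exact_mod_cast hn
  set m := ∫ o, u o ∂P with hm
  set m' := ∫ o, v o ∂P with hm'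
  have hmt : m ^ 2 ≤ t ^ 2 := sq_le_sq' (by linarith [(abs_le.1 ht).1]) (abs_le.1 ht).2
  have hmt' : m' ^ 2 ≤ t ^ 2 := sq_le_sq' (by linarith [(abs_le.1 ht').1]) (abs_le.1 ht').2
  set a : (Fin n → Ω) → ℝ := fun ω => (1 / n : ℝ) * ∑ i, u (ω i) - m with ha
  set b : (Fin n → Ω) → ℝ := fun ω => (1 / n : ℝ) * ∑ i, v (ω i) - m' with hb
  have hba : BddMeasurable a := hu.average.sub (BddMeasurable.const m)
  have hbb : BddMeasurable b := hv.average.sub (BddMeasurable.const m')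
  have hU := hu.sub (BddMeasurable.const m)
  have hV := hv.sub (BddMeasurable.const m')
  have ea : ∀ ω, a ω = (1 / n : ℝ) * ∑ i, (u (ω i) - m) := fun ω => by
    have := average_eq hn u m ω
    simp only [smul_eq_mul] at this
    rw [ha]
    simp only
    rw [this]
    ring
  have eb : ∀ ω, b ω = (1 / n : ℝ) * ∑ i, (v (ω i) - m') := fun ω => by
    have := average_eq hn v m' ω
    simp only [smul_eq_mul] at this
    rw [hb]
    simp only
    rw [this]
    ring
  have A1nn : 0 ≤ ∫ o, u o ^ 2 ∂P := integral_nonneg fun _ => by positivity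
  have A2nn : 0 ≤ ∫ o, v o ^ 2 ∂P := integral_nonneg fun _ => by positivity
  have ia := integral_average_sub_mean_sq_le (P := P) hn hu
  have ib := integral_average_sub_mean_sq_le (P := P) hn hv
  have ia' : ∫ ω, a ω ^ 2 ∂(Measure.pi fun _ : Fin n => P) ≤ A₁ / n :=
    ia.trans (by gcongr)
  have ib' : ∫ ω, b ω ^ 2 ∂(Measure.pi fun _ : Fin n => P) ≤ A₂ / n :=
    ib.trans (by gcongr)
  have iU : ∫ o, ‖u o - m‖ ^ 2 ∂P ≤ A₁ := by
    simp only [Real.norm_eq_abs, sq_abs]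
    exact hu.integral_sub_integral_sq_le.trans h1
  have iV : ∫ o, ‖v o - m'‖ ^ 2 ∂P ≤ A₂ := by
    simp only [Real.norm_eq_abs, sq_abs]
    exact hv.integral_sub_integral_sq_le.trans h2
  -- Each centered square is at most `2 (u² + t²)`, which is where the factor `4` comes from.
  have iUV : ∫ o, ‖u o - m‖ ^ 2 * ‖v o - m'‖ ^ 2 ∂P ≤
      4 * (A₁₂ + t ^ 2 * A₁ + t ^ 2 * A₂ + t ^ 4) := by
    simp only [Real.norm_eq_abs, sq_abs]
    have c1 : BddMeasurable fun o => u o ^ 2 * v o ^ 2 := (hu.pow 2).mul (hv.pow 2)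
    have c2 : BddMeasurable fun o => t ^ 2 * u o ^ 2 := (BddMeasurable.const _).mul (hu.pow 2)
    have c3 : BddMeasurable fun o => t ^ 2 * v o ^ 2 := (BddMeasurable.const _).mul (hv.pow 2)
    calc ∫ o, (u o - m) ^ 2 * (v o - m') ^ 2 ∂P
        ≤ ∫ o, 4 * (u o ^ 2 * v o ^ 2 + t ^ 2 * u o ^ 2 + t ^ 2 * v o ^ 2 + t ^ 4) ∂P := by
          refine integral_mono (((hU.pow 2).mul (hV.pow 2)).integrable _)
            (((BddMeasurable.const 4).mul
              (((c1.add c2).add c3).add (BddMeasurable.const (t ^ 4)))).integrable _) fun o => ?_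
          have g1 : (u o - m) ^ 2 ≤ 2 * (u o ^ 2 + t ^ 2) := by nlinarith [sq_nonneg (u o + m)]
          have g2 : (v o - m') ^ 2 ≤ 2 * (v o ^ 2 + t ^ 2) := by nlinarith [sq_nonneg (v o + m')]
          calc _ ≤ 2 * (u o ^ 2 + t ^ 2) * (2 * (v o ^ 2 + t ^ 2)) :=
                mul_le_mul g1 g2 (sq_nonneg _) (by positivity)
            _ = _ := by ring
      _ = 4 * ((∫ o, u o ^ 2 * v o ^ 2 ∂P) + t ^ 2 * (∫ o, u o ^ 2 ∂P) +
          t ^ 2 * (∫ o, v o ^ 2 ∂P) + t ^ 4) := by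
          rw [integral_const_mul, integral_add (((c1.add c2).add c3).integrable _)
            (integrable_const _), integral_add ((c1.add c2).integrable _) (c3.integrable _),
            integral_add (c1.integrable _) (c2.integrable _), integral_const_mul,
            integral_const_mul]
          simp
      _ ≤ _ := by gcongr
  -- After division by `n ^ 4`, the single-index part is of order `n ^ (-3)` and the part from pairs
  -- of order `n ^ (-2)`.
  have iab : ∫ ω, a ω ^ 2 * b ω ^ 2 ∂(Measure.pi fun _ : Fin n => P) ≤
      4 * (A₁₂ + t ^ 2 * A₁ + t ^ 2 * A₂ + t ^ 4) / n ^ 3 + 3 * (A₁ * A₂) / n ^ 2 := by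
    have h := integral_norm_sum_sq_mul_le (P := P) n hU hV hu.integral_sub_integral
      hv.integral_sub_integral
    have e : ∀ ω : Fin n → Ω, a ω ^ 2 * b ω ^ 2 = (1 / n : ℝ) ^ 4 *
        (‖∑ i, (u (ω i) - m)‖ ^ 2 * ‖∑ i, (v (ω i) - m')‖ ^ 2) := fun ω => by
      rw [ea, eb, Real.norm_eq_abs, Real.norm_eq_abs, sq_abs, sq_abs]
      ring
    simp only [e]
    rw [integral_const_mul]
    have nnU : 0 ≤ ∫ o, ‖u o - m‖ ^ 2 ∂P := integral_nonneg fun _ => by positivity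
    have nnV : 0 ≤ ∫ o, ‖v o - m'‖ ^ 2 ∂P := integral_nonneg fun _ => by positivity
    calc _ ≤ (1 / n : ℝ) ^ 4 * (n * (4 * (A₁₂ + t ^ 2 * A₁ + t ^ 2 * A₂ + t ^ 4)) +
          3 * n ^ 2 * (A₁ * A₂)) := by
          refine mul_le_mul_of_nonneg_left (h.trans ?_) (by positivity)
          gcongr
          exact nnU.trans iU
      _ = _ := by field_simp
  have k1 : BddMeasurable fun ω => t ^ 2 * a ω ^ 2 := (BddMeasurable.const _).mul (hba.pow 2)
  have k2 : BddMeasurable fun ω => t ^ 2 * b ω ^ 2 := (BddMeasurable.const _).mul (hbb.pow 2)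
  have k3 : BddMeasurable fun ω => a ω ^ 2 * b ω ^ 2 := (hba.pow 2).mul (hbb.pow 2)
  calc _ ≤ ∫ ω, 4 * (t ^ 4 + t ^ 2 * a ω ^ 2 + t ^ 2 * b ω ^ 2 + a ω ^ 2 * b ω ^ 2)
        ∂(Measure.pi fun _ : Fin n => P) := by
        refine integral_mono (((hu.average.pow 2).mul (hv.average.pow 2)).integrable _)
          (((BddMeasurable.const 4).mul
            ((((BddMeasurable.const (t ^ 4)).add k1).add k2).add k3)).integrable _) fun ω => ?_
        have g1 : ((1 / n : ℝ) * ∑ i, u (ω i)) ^ 2 ≤ 2 * (t ^ 2 + a ω ^ 2) := by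
          have : (1 / n : ℝ) * ∑ i, u (ω i) = a ω + m := by simp [ha]
          rw [this]
          nlinarith [sq_nonneg (a ω - m)]
        have g2 : ((1 / n : ℝ) * ∑ i, v (ω i)) ^ 2 ≤ 2 * (t ^ 2 + b ω ^ 2) := by
          have : (1 / n : ℝ) * ∑ i, v (ω i) = b ω + m' := by simp [hb]
          rw [this]
          nlinarith [sq_nonneg (b ω - m')]
        calc _ ≤ 2 * (t ^ 2 + a ω ^ 2) * (2 * (t ^ 2 + b ω ^ 2)) :=
              mul_le_mul g1 g2 (sq_nonneg _) (by positivity)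
          _ = _ := by ring
    _ = 4 * (t ^ 4 + t ^ 2 * (∫ ω, a ω ^ 2 ∂(Measure.pi fun _ : Fin n => P)) +
          t ^ 2 * (∫ ω, b ω ^ 2 ∂(Measure.pi fun _ : Fin n => P)) +
          ∫ ω, a ω ^ 2 * b ω ^ 2 ∂(Measure.pi fun _ : Fin n => P)) := by
        rw [integral_const_mul, integral_add ((((BddMeasurable.const (t ^ 4)).add k1).add
          k2).integrable _) (k3.integrable _), integral_add
          (((BddMeasurable.const (t ^ 4)).add k1).integrable _) (k2.integrable _),
          integral_add (integrable_const _) (k1.integrable _), integral_const_mul,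
          integral_const_mul]
        simp
    _ ≤ _ := by gcongr

end Averages

/-! ### Products of two fitted regression functions -/

section Fitted

variable {Ω H : Type*} [MeasurableSpace Ω] [NormedAddCommGroup H] [InnerProductSpace ℝ H]

/-- The kernel regression estimator with responses `a` and kernel `K`. -/
def fitted {n : ℕ} (a : Ω → ℝ) (K : Ω → Ω → ℝ) (ω : Fin n → Ω) (o : Ω) : ℝ :=
  (1 / n : ℝ) * ∑ i, a (ω i) * K (ω i) o

/-- The inner product of two averages of weighted feature vectors. -/
def plugIn {α : Type*} {n : ℕ} (a y : α → ℝ) (e : α → H) (ω : Fin n → α) : ℝ :=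
  inner ℝ ((1 / n : ℝ) • ∑ i, a (ω i) • e (ω i)) ((1 / n : ℝ) • ∑ i, y (ω i) • e (ω i))

/-- Expansion of a bilinear statistic around an arbitrary centre `(u, v)`. When `u` and `v` are the
means, the last term is the degenerate part, while the others are averages of scalar summands up to
a constant. -/
theorem plugIn_eq {α : Type*} {n : ℕ} (hn : 1 ≤ n) (a y : α → ℝ) (e : α → H) (u v : H)
    (ω : Fin n → α) :
    plugIn a y e ω = (1 / n : ℝ) * ∑ i, y (ω i) * inner ℝ u (e (ω i)) +
      (1 / n : ℝ) * ∑ i, a (ω i) * inner ℝ v (e (ω i)) - inner ℝ u v +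
      (1 / n : ℝ) ^ 2 *
        inner ℝ (∑ i, (a (ω i) • e (ω i) - u)) (∑ i, (y (ω i) • e (ω i) - v)) := by
  have h1 := average_eq hn (fun o => a o • e o) u ω
  have h2 := average_eq hn (fun o => y o • e o) v ω
  have e1 : (1 / n : ℝ) * ∑ i, y (ω i) * inner ℝ u (e (ω i)) =
      inner ℝ u (v + (1 / n : ℝ) • ∑ i, (y (ω i) • e (ω i) - v)) := by
    rw [← h2, real_inner_smul_right, inner_sum]
    simp only [real_inner_smul_right]
  have e2 : (1 / n : ℝ) * ∑ i, a (ω i) * inner ℝ v (e (ω i)) =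
      inner ℝ v (u + (1 / n : ℝ) • ∑ i, (a (ω i) • e (ω i) - u)) := by
    rw [← h1, real_inner_smul_right, inner_sum]
    simp only [real_inner_smul_right]
  rw [e1, e2, plugIn, h1, h2]
  simp only [inner_add_left, inner_add_right, real_inner_smul_left, real_inner_smul_right,
    real_inner_comm u v]
  rw [real_inner_comm (∑ i, (a (ω i) • e (ω i) - u)) v]
  ring

/-- Two responses bounded by `C`, and two localized kernels at resolutions `k₁` and `k₂`, whose
composition is the kernel of the feature map `e`, at resolution `min k₁ k₂`. -/
structure KernelPair (P : Measure Ω) (a y : Ω → ℝ) (K₁ K₂ : Ω → Ω → ℝ) (e : Ω → H)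
    (C D k₁ k₂ : ℝ) : Prop where
  one_le_C : 1 ≤ C
  one_le_D : 1 ≤ D
  one_le_k₁ : 1 ≤ k₁
  one_le_k₂ : 1 ≤ k₂
  meas_a : BddMeasurable a
  meas_y : BddMeasurable y
  meas_K₁ : BddMeasurable fun z : Ω × Ω => K₁ z.1 z.2
  meas_K₂ : BddMeasurable fun z : Ω × Ω => K₂ z.1 z.2
  meas_e : BddMeasurable e
  abs_a : ∀ o, |a o| ≤ C
  abs_y : ∀ o, |y o| ≤ C
  symm_K₁ : ∀ o o', K₁ o o' = K₁ o' o
  symm_K₂ : ∀ o o', K₂ o o' = K₂ o' o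
  abs_K₁ : ∀ o o', |K₁ o o'| ≤ D * k₁
  abs_K₂ : ∀ o o', |K₂ o o'| ≤ D * k₂
  norm_e : ∀ o, ‖e o‖ ^ 2 ≤ D * min k₁ k₂
  integral_abs_K₁ : ∀ o, ∫ o', |K₁ o o'| ∂P ≤ D
  integral_abs_K₂ : ∀ o, ∫ o', |K₂ o o'| ∂P ≤ D
  integral_abs_e : ∀ o, ∫ o', |inner ℝ (e o) (e o')| ∂P ≤ D
  integral_sq_K₁ : ∀ o, ∫ o', K₁ o o' ^ 2 ∂P ≤ D * k₁
  integral_sq_K₂ : ∀ o, ∫ o', K₂ o o' ^ 2 ∂P ≤ D * k₂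
  integral_mul : ∀ o o', ∫ z, K₁ o z * K₂ o' z ∂P = inner ℝ (e o) (e o')

theorem abs_integral_mul_le {P : Measure Ω} [IsProbabilityMeasure P] {g k : Ω → ℝ} {C D : ℝ}
    (hC : 0 ≤ C) (hg : ∀ o, |g o| ≤ C) (hgm : BddMeasurable g) (hk : BddMeasurable k)
    (hD : ∫ o, |k o| ∂P ≤ D) : |∫ o, g o * k o ∂P| ≤ C * D := by
  calc |∫ o, g o * k o ∂P| ≤ ∫ o, |g o * k o| ∂P := abs_integral_le_integral_abs
    _ ≤ ∫ o, C * |k o| ∂P := by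
        refine integral_mono ((hgm.mul hk).norm.integrable P)
          ((hk.norm.integrable P).const_mul C) fun o => ?_
        simp only [abs_mul]
        exact mul_le_mul_of_nonneg_right (hg o) (abs_nonneg _)
    _ ≤ C * D := by
        rw [integral_const_mul]
        exact mul_le_mul_of_nonneg_left hD hC

theorem integral_weighted_sq_le {P : Measure Ω} [IsProbabilityMeasure P] {g k : Ω → ℝ} {C A : ℝ}
    (hg : ∀ o, |g o| ≤ C) (hgm : BddMeasurable g) (hk : BddMeasurable k)
    (hA : ∫ o, k o ^ 2 ∂P ≤ A) : ∫ o, (g o * k o) ^ 2 ∂P ≤ C ^ 2 * A := by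
  calc ∫ o, (g o * k o) ^ 2 ∂P ≤ ∫ o, C ^ 2 * k o ^ 2 ∂P := by
        refine integral_mono (((hgm.mul hk).pow 2).integrable _)
          (((BddMeasurable.const _).mul (hk.pow 2)).integrable _) fun o => ?_
        simp only [mul_pow]
        exact mul_le_mul_of_nonneg_right (sq_le_sq' (by linarith [(abs_le.1 (hg o)).1])
          (abs_le.1 (hg o)).2) (sq_nonneg _)
    _ ≤ _ := by
        rw [integral_const_mul]
        exact mul_le_mul_of_nonneg_left hA (sq_nonneg _)

theorem BddMeasurable.fitted {n : ℕ} {a : Ω → ℝ} {K : Ω → Ω → ℝ} (ha : BddMeasurable a)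
    (hK : BddMeasurable fun z : Ω × Ω => K z.1 z.2) :
    BddMeasurable fun z : (Fin n → Ω) × Ω => fitted a K z.1 z.2 :=
  (BddMeasurable.const _).mul (BddMeasurable.sum _ fun i =>
    (ha.comp (by fun_prop)).mul
      (hK.comp (φ := fun z : (Fin n → Ω) × Ω => (z.1 i, z.2)) (by fun_prop)))

namespace KernelPair

variable {P : Measure Ω} {a y : Ω → ℝ} {K₁ K₂ : Ω → Ω → ℝ} {e : Ω → H}
  {C D k₁ k₂ : ℝ} (h : KernelPair P a y K₁ K₂ e C D k₁ k₂) {n : ℕ}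

include h

/-- The hypotheses are symmetric in the two fits, so each one-sided estimate is proved once and used
twice. -/
theorem swap : KernelPair P y a K₂ K₁ e C D k₂ k₁ :=
  ⟨h.one_le_C, h.one_le_D, h.one_le_k₂, h.one_le_k₁, h.meas_y, h.meas_a, h.meas_K₂, h.meas_K₁,
    h.meas_e, h.abs_y, h.abs_a, h.symm_K₂, h.symm_K₁, h.abs_K₂, h.abs_K₁,
    by simpa only [min_comm] using h.norm_e, h.integral_abs_K₂, h.integral_abs_K₁,
    h.integral_abs_e, h.integral_sq_K₂, h.integral_sq_K₁, fun o o' => by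
      rw [real_inner_comm, ← h.integral_mul o' o]
      simp only [mul_comm]⟩

theorem measurable_plugIn : BddMeasurable fun ω : Fin n → Ω => plugIn a y e ω :=
  ((BddMeasurable.const (1 / n : ℝ)).smul (h.meas_a.smul h.meas_e).pi_sum).inner
    ((BddMeasurable.const (1 / n : ℝ)).smul (h.meas_y.smul h.meas_e).pi_sum)

variable [IsProbabilityMeasure P]

/-- The product is a double sum over observations, and the composition property of the kernels turns
each summand into an inner product of features. -/
theorem integral_fitted_mul_fitted (ω : Fin n → Ω) :
    ∫ o, fitted a K₁ ω o * fitted y K₂ ω o ∂P = plugIn a y e ω := by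
  have e1 : ∀ o, fitted a K₁ ω o * fitted y K₂ ω o = (1 / n : ℝ) * (1 / n : ℝ) *
      ∑ i, ∑ j, a (ω i) * y (ω j) * (K₁ (ω i) o * K₂ (ω j) o) := fun o => by
    simp only [fitted]
    rw [mul_mul_mul_comm, Finset.sum_mul_sum]
    refine congrArg _ (Finset.sum_congr rfl fun i _ => Finset.sum_congr rfl fun j _ => ?_)
    ring
  have hi : ∀ i j, BddMeasurable fun o => a (ω i) * y (ω j) * (K₁ (ω i) o * K₂ (ω j) o) :=
    fun i j => (BddMeasurable.const _).mul ((h.meas_K₁.right (ω i)).mul (h.meas_K₂.right (ω j)))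
  have e2 : ∀ i, ∫ o, ∑ j, a (ω i) * y (ω j) * (K₁ (ω i) o * K₂ (ω j) o) ∂P =
      ∑ j, a (ω i) * y (ω j) * inner ℝ (e (ω i)) (e (ω j)) := fun i => by
    rw [integral_finsetSum _ fun j _ => (hi i j).integrable _]
    simp only [integral_const_mul, h.integral_mul]
  simp only [e1]
  rw [integral_const_mul, integral_finsetSum _ fun i _ =>
    (BddMeasurable.sum _ fun j => hi i j).integrable _, Finset.sum_congr rfl fun i _ => e2 i]
  simp only [plugIn, real_inner_smul_left, real_inner_smul_right, sum_inner, inner_sum,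
    Finset.mul_sum]
  rw [Finset.sum_comm]
  refine Finset.sum_congr rfl fun i _ => Finset.sum_congr rfl fun j _ => ?_
  ring

variable [CompleteSpace H]

/-- The quantity is a projected response evaluated at `o`, so the `L¹` bound on the kernel applies.
Unlike `‖e o‖`, it does not grow with the resolution, hence the linear terms have variance of order
`1 / n`. -/
theorem abs_inner_mean_le (o : Ω) : |inner ℝ (∫ o', a o' • e o' ∂P) (e o)| ≤ C * D := by
  rw [real_inner_comm, ← integral_inner ((h.meas_a.smul h.meas_e).integrable _)]
  simp only [real_inner_smul_right]
  exact abs_integral_mul_le (by linarith [h.one_le_C]) h.abs_a h.meas_a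
    ((BddMeasurable.const (e o)).inner h.meas_e) (h.integral_abs_e o)

theorem integral_mul_inner_mean : ∫ o, y o * inner ℝ (∫ o', a o' • e o' ∂P) (e o) ∂P =
    inner ℝ (∫ o', a o' • e o' ∂P) (∫ o', y o' • e o' ∂P) := by
  rw [← integral_inner ((h.meas_y.smul h.meas_e).integrable _)]
  simp only [real_inner_smul_right]

/-- Of the `n²` pairs of observations, the `n` diagonal ones have mean `E[a y ‖e‖²]` instead of the
product of means; this is the bias of fitting both functions on one sample. -/
theorem integral_plugIn (hn : 1 ≤ n) :
    ∫ ω, plugIn a y e ω ∂(Measure.pi fun _ : Fin n => P) =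
      inner ℝ (∫ o, a o • e o ∂P) (∫ o, y o • e o ∂P) + (1 / n : ℝ) *
        ((∫ o, a o * y o * ‖e o‖ ^ 2 ∂P) -
          inner ℝ (∫ o, a o • e o ∂P) (∫ o, y o • e o ∂P)) := by
  have hn0 : (n : ℝ) ≠ 0 := by positivity
  set u := ∫ o, a o • e o ∂P with hu
  set v := ∫ o, y o • e o ∂P with hv
  have hae := h.meas_a.smul h.meas_e
  have hye := h.meas_y.smul h.meas_e
  have hU := hae.sub (BddMeasurable.const u)
  have hV := hye.sub (BddMeasurable.const v)
  have g1 : BddMeasurable fun o => y o * inner ℝ u (e o) :=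
    h.meas_y.mul ((BddMeasurable.const u).inner h.meas_e)
  have g2 : BddMeasurable fun o => a o * inner ℝ v (e o) :=
    h.meas_a.mul ((BddMeasurable.const v).inner h.meas_e)
  have g3 : BddMeasurable fun ω : Fin n → Ω => (1 / n : ℝ) ^ 2 *
        inner ℝ (∑ i, (a (ω i) • e (ω i) - u)) (∑ i, (y (ω i) • e (ω i) - v)) :=
    (BddMeasurable.const _).mul (hU.pi_sum.inner hV.pi_sum)
  simp only [plugIn_eq hn a y e u v]
  rw [integral_add (((g1.average.add g2.average).sub (BddMeasurable.const _)).integrable _)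
    (g3.integrable _), integral_sub ((g1.average.add g2.average).integrable _)
    (integrable_const _), integral_add (g1.average.integrable _) (g2.average.integrable _),
    integral_average hn g1, integral_average hn g2, integral_const_mul,
    integral_inner_sum_sum n hU hV hye.integral_sub_integral, h.integral_mul_inner_mean,
    h.swap.integral_mul_inner_mean]
  have e1 : ∫ o, inner ℝ (a o • e o - u) (y o • e o - v) ∂P =
      (∫ o, a o * y o * ‖e o‖ ^ 2 ∂P) - inner ℝ u v := by
    have e2 : ∀ o, inner ℝ (a o • e o - u) (y o • e o - v) =
        a o * y o * ‖e o‖ ^ 2 - inner ℝ v (a o • e o) - inner ℝ u (y o • e o - v) := fun o => by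
      simp only [inner_sub_left, inner_sub_right, real_inner_smul_left, real_inner_smul_right,
        real_inner_self_eq_norm_sq, real_inner_comm v]
      ring
    simp only [e2]
    have m1 : BddMeasurable fun o => a o * y o * ‖e o‖ ^ 2 :=
      (h.meas_a.mul h.meas_y).mul (h.meas_e.norm.pow 2)
    have m2 : BddMeasurable fun o => inner ℝ v (a o • e o) := (BddMeasurable.const v).inner hae
    have m3 : BddMeasurable fun o => inner ℝ u (y o • e o - v) := (BddMeasurable.const u).inner hV
    rw [integral_sub ((m1.sub m2).integrable _) (m3.integrable _),
      integral_sub (m1.integrable _) (m2.integrable _), integral_inner (hae.integrable _),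
      integral_inner (hV.integrable _), hye.integral_sub_integral, inner_zero_right, ← hu,
      real_inner_comm]
    ring
  rw [e1]
  simp only [integral_const, probReal_univ, one_smul]
  rw [← hu, ← hv, real_inner_comm u v]
  field_simp
  ring

/-- By `plugIn_eq` at the means, the error is two linear averages, contributing `1 / n`, and the
degenerate part, whose second moment is at most a mixed fourth moment of order `k² / n²`. -/
theorem integral_plugIn_sub_sq_le (hn : 1 ≤ n) :
    ∫ ω, (plugIn a y e ω - inner ℝ (∫ o, a o • e o ∂P) (∫ o, y o • e o ∂P)) ^ 2
        ∂(Measure.pi fun _ : Fin n => P) ≤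
      192 * (C ^ 4 * D ^ 4) * (1 / n + min k₁ k₂ ^ 2 / n ^ 2) := by
  have hn1 : (1 : ℝ) ≤ n := by exact_mod_cast hn
  have hn0 : (0 : ℝ) < n := by linarith
  have hC := h.one_le_C
  have hD := h.one_le_D
  set k := min k₁ k₂ with hk
  have hk1 : 1 ≤ k := le_min h.one_le_k₁ h.one_le_k₂
  set u := ∫ o, a o • e o ∂P with hu
  set v := ∫ o, y o • e o ∂P with hv
  have hae := h.meas_a.smul h.meas_e
  have hye := h.meas_y.smul h.meas_e
  have hU := hae.sub (BddMeasurable.const u)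
  have hV := hye.sub (BddMeasurable.const v)
  have g1 : BddMeasurable fun o => y o * inner ℝ u (e o) :=
    h.meas_y.mul ((BddMeasurable.const u).inner h.meas_e)
  have g2 : BddMeasurable fun o => a o * inner ℝ v (e o) :=
    h.meas_a.mul ((BddMeasurable.const v).inner h.meas_e)
  have g3 : BddMeasurable fun ω : Fin n → Ω => (1 / n : ℝ) ^ 2 *
        inner ℝ (∑ i, (a (ω i) • e (ω i) - u)) (∑ i, (y (ω i) • e (ω i) - v)) :=
    (BddMeasurable.const _).mul (hU.pi_sum.inner hV.pi_sum)
  -- This bounds the squared norm of a weighted feature vector; centering costs a factor `4`.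
  set r := C ^ 2 * (D * k) with hr
  have hr0 : 0 ≤ r := by positivity
  have cent : ∀ (w : Ω → ℝ) (_ : BddMeasurable w) (_ : ∀ o, |w o| ≤ C), ∀ o,
      ‖w o • e o - ∫ o', w o' • e o' ∂P‖ ^ 2 ≤ 4 * r := fun w hw hwC o => by
    have b1 : ∀ o, ‖w o • e o‖ ≤ Real.sqrt r := fun o => by
      refine Real.le_sqrt_of_sq_le ?_
      rw [norm_smul, mul_pow, Real.norm_eq_abs]
      exact mul_le_mul (pow_le_pow_left₀ (abs_nonneg _) (hwC o) 2) (h.norm_e o) (by positivity)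
        (by positivity)
    have b2 : ‖∫ o', w o' • e o' ∂P‖ ≤ Real.sqrt r := by
      have := norm_integral_le_of_norm_le_const (μ := P) (Filter.Eventually.of_forall b1)
      simpa using this
    have b3 := (norm_sub_le (w o • e o) (∫ o', w o' • e o' ∂P)).trans (add_le_add (b1 o) b2)
    calc _ ≤ (Real.sqrt r + Real.sqrt r) ^ 2 := pow_le_pow_left₀ (norm_nonneg _) b3 2
      _ = 4 * (Real.sqrt r * Real.sqrt r) := by ring
      _ = _ := by rw [Real.mul_self_sqrt hr0]
  have cU := cent a h.meas_a h.abs_a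
  have cV := cent y h.meas_y h.abs_y
  rw [← hu] at cU
  rw [← hv] at cV
  have iconst : ∀ (f : Ω → ℝ) (_ : BddMeasurable f) (c : ℝ) (_ : ∀ o, f o ≤ c),
      ∫ o, f o ∂P ≤ c := fun f hf c hc => by
    have := integral_mono (hf.integrable P) (integrable_const c) hc
    simpa using this
  have i1 := iconst _ (hU.norm.pow 2) _ cU
  have i2 := iconst _ (hV.norm.pow 2) _ cV
  have i12 := iconst _ ((hU.norm.pow 2).mul (hV.norm.pow 2)) (4 * r * (4 * r)) fun o =>
    mul_le_mul (cU o) (cV o) (by positivity) (by positivity)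
  have hST : ∫ ω, ((1 / n : ℝ) ^ 2 * inner ℝ (∑ i, (a (ω i) • e (ω i) - u))
      (∑ i, (y (ω i) • e (ω i) - v))) ^ 2 ∂(Measure.pi fun _ : Fin n => P) ≤
      64 * r ^ 2 / n ^ 2 := by
    calc _ ≤ ∫ ω, (1 / n : ℝ) ^ 4 * (‖∑ i, (a (ω i) • e (ω i) - u)‖ ^ 2 *
          ‖∑ i, (y (ω i) • e (ω i) - v)‖ ^ 2) ∂(Measure.pi fun _ : Fin n => P) := by
          refine integral_mono ((g3.pow 2).integrable _) (((BddMeasurable.const _).mul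
            ((hU.pi_sum.norm.pow 2).mul (hV.pi_sum.norm.pow 2))).integrable _) fun ω => ?_
          simp only
          rw [mul_pow, ← pow_mul, ← mul_pow]
          refine mul_le_mul_of_nonneg_left ?_ (by positivity)
          rw [← sq_abs]
          exact pow_le_pow_left₀ (abs_nonneg _) (abs_real_inner_le_norm _ _) 2
      _ ≤ (1 / n : ℝ) ^ 4 * (n * (4 * r * (4 * r)) + 3 * n ^ 2 * (4 * r * (4 * r))) := by
          rw [integral_const_mul]
          refine mul_le_mul_of_nonneg_left ((integral_norm_sum_sq_mul_le n hU hV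
            hae.integral_sub_integral hye.integral_sub_integral).trans ?_) (by positivity)
          have nnV : 0 ≤ ∫ o, ‖y o • e o - v‖ ^ 2 ∂P := integral_nonneg fun _ => by positivity
          gcongr
      -- Using `n ≤ n ^ 2`, the single-index part is merged into the pairs: `16 + 3 * 16 = 64`.
      _ ≤ (1 / n : ℝ) ^ 4 * (n ^ 2 * (4 * r * (4 * r)) + 3 * n ^ 2 * (4 * r * (4 * r))) := by
          gcongr
          nlinarith
      _ = _ := by
          field_simp
          ring
  have lin : ∀ (w : Ω → ℝ) (x : H) (_ : BddMeasurable w) (_ : ∀ o, |w o| ≤ C)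
      (_ : ∀ o, |inner ℝ x (e o)| ≤ C * D),
      ∫ ω, ((1 / n : ℝ) * ∑ i, w (ω i) * inner ℝ x (e (ω i)) -
        ∫ o, w o * inner ℝ x (e o) ∂P) ^ 2 ∂(Measure.pi fun _ : Fin n => P) ≤
        C ^ 4 * D ^ 2 / n := fun w x hw hwC hx => by
    have hg : BddMeasurable fun o => w o * inner ℝ x (e o) :=
      hw.mul ((BddMeasurable.const x).inner h.meas_e)
    refine (integral_average_sub_mean_sq_le hn hg).trans ?_
    gcongr
    refine iconst _ (hg.pow 2) _ fun o => ?_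
    rw [← sq_abs, abs_mul]
    calc _ ≤ (C * (C * D)) ^ 2 := pow_le_pow_left₀ (by positivity)
          (mul_le_mul (hwC o) (hx o) (abs_nonneg _) (by positivity)) 2
      _ = _ := by ring
  have l1 := lin y u h.meas_y h.abs_y h.abs_inner_mean_le
  have l2 := lin a v h.meas_a h.abs_a h.swap.abs_inner_mean_le
  rw [h.integral_mul_inner_mean, ← hu, ← hv] at l1
  rw [h.swap.integral_mul_inner_mean, ← hu, ← hv, real_inner_comm] at l2
  set A : (Fin n → Ω) → ℝ := fun ω =>
    (1 / n : ℝ) * ∑ i, y (ω i) * inner ℝ u (e (ω i)) - inner ℝ u v with hA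
  set B : (Fin n → Ω) → ℝ := fun ω =>
    (1 / n : ℝ) * ∑ i, a (ω i) * inner ℝ v (e (ω i)) - inner ℝ u v with hB
  have hAm : BddMeasurable A := g1.average.sub (BddMeasurable.const _)
  have hBm : BddMeasurable B := g2.average.sub (BddMeasurable.const _)
  calc _ ≤ ∫ ω, (3 * A ω ^ 2 + 3 * B ω ^ 2 + 3 * ((1 / n : ℝ) ^ 2 * inner ℝ
        (∑ i, (a (ω i) • e (ω i) - u)) (∑ i, (y (ω i) • e (ω i) - v))) ^ 2)
        ∂(Measure.pi fun _ : Fin n => P) := by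
        refine integral_mono (((h.measurable_plugIn.sub (BddMeasurable.const _)).pow 2).integrable
          _) (((((BddMeasurable.const 3).mul (hAm.pow 2)).add ((BddMeasurable.const 3).mul
          (hBm.pow 2))).add ((BddMeasurable.const 3).mul (g3.pow 2))).integrable _) fun ω => ?_
        simp only [plugIn_eq hn a y e u v ω, hA, hB]
        generalize (1 / n : ℝ) * ∑ i, y (ω i) * inner ℝ u (e (ω i)) = x1
        generalize (1 / n : ℝ) * ∑ i, a (ω i) * inner ℝ v (e (ω i)) = x2
        generalize (1 / n : ℝ) ^ 2 * inner ℝ (∑ i, (a (ω i) • e (ω i) - u))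
          (∑ i, (y (ω i) • e (ω i) - v)) = x3
        generalize (inner ℝ u v : ℝ) = q
        nlinarith [sq_nonneg (x1 - x2), sq_nonneg (x1 - q - x3), sq_nonneg (x2 - q - x3)]
    _ ≤ 3 * (C ^ 4 * D ^ 2 / n) + 3 * (C ^ 4 * D ^ 2 / n) + 3 * (64 * r ^ 2 / n ^ 2) := by
        rw [integral_add ((((BddMeasurable.const 3).mul (hAm.pow 2)).add
          ((BddMeasurable.const 3).mul (hBm.pow 2))).integrable _)
          (((BddMeasurable.const 3).mul (g3.pow 2)).integrable _),
          integral_add (((BddMeasurable.const 3).mul (hAm.pow 2)).integrable _)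
          (((BddMeasurable.const 3).mul (hBm.pow 2)).integrable _),
          integral_const_mul, integral_const_mul, integral_const_mul]
        gcongr
    _ = C ^ 4 * D ^ 2 * (6 / n + 192 * (k ^ 2 / n ^ 2)) := by
        rw [hr]
        ring
    _ ≤ C ^ 4 * D ^ 4 * (192 / n + 192 * (k ^ 2 / n ^ 2)) := by
        gcongr <;> norm_num
    _ = _ := by ring

end KernelPair

end Fitted

/-! ### Second moments of fitted values and of the summands built from them. -/

namespace KernelPair

variable {Ω H : Type*} [MeasurableSpace Ω] [NormedAddCommGroup H] [InnerProductSpace ℝ H]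
  {P : Measure Ω} {a y : Ω → ℝ} {K₁ K₂ : Ω → Ω → ℝ} {e : Ω → H}
  {C D k₁ k₂ : ℝ} (h : KernelPair P a y K₁ K₂ e C D k₁ k₂) {n : ℕ}

include h

theorem measurable_fitted_left : BddMeasurable fun z : (Fin n → Ω) × Ω => fitted a K₁ z.1 z.2 :=
  h.meas_a.fitted h.meas_K₁

theorem measurable_fitted_right : BddMeasurable fun z : (Fin n → Ω) × Ω => fitted y K₂ z.1 z.2 :=
  h.meas_y.fitted h.meas_K₂

theorem measurable_K₁_left (o : Ω) : BddMeasurable fun o' => K₁ o' o :=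
  h.meas_K₁.comp (φ := fun o' => (o', o)) (by fun_prop)

theorem measurable_K₂_left (o : Ω) : BddMeasurable fun o' => K₂ o' o :=
  h.meas_K₂.comp (φ := fun o' => (o', o)) (by fun_prop)

theorem integral_sq_K₁_left (o : Ω) : ∫ o', K₁ o' o ^ 2 ∂P ≤ D * k₁ := by
  simpa only [h.symm_K₁ _ o] using h.integral_sq_K₁ o

variable [IsProbabilityMeasure P]

theorem abs_mean_left_le (o : Ω) : |∫ o', a o' * K₁ o' o ∂P| ≤ C * D := by
  simp only [h.symm_K₁ _ o]
  exact abs_integral_mul_le (by linarith [h.one_le_C]) h.abs_a h.meas_a (h.meas_K₁.right o)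
    (h.integral_abs_K₁ o)

/-- Use the sup bound for the kernel of smaller resolution and the `L²` bound for the other one; the
opposite choice would give `k_min * k_max²`. -/
theorem integral_sq_mul_sq_le (o : Ω) :
    ∫ o', K₁ o' o ^ 2 * K₂ o' o ^ 2 ∂P ≤ D ^ 3 * (min k₁ k₂ ^ 2 * max k₁ k₂) := by
  have hD := h.one_le_D
  have main : ∀ (K K' : Ω → ℝ) (k k' : ℝ) (_ : BddMeasurable K) (_ : BddMeasurable K')
      (_ : ∀ o', |K o'| ≤ D * k) (_ : ∫ o', K' o' ^ 2 ∂P ≤ D * k'),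
      ∫ o', K o' ^ 2 * K' o' ^ 2 ∂P ≤ D ^ 3 * (k ^ 2 * k') := fun K K' k k' hK hK' hb hi => by
    calc _ ≤ ∫ o', (D * k) ^ 2 * K' o' ^ 2 ∂P := by
          refine integral_mono (((hK.pow 2).mul (hK'.pow 2)).integrable _)
            (((BddMeasurable.const _).mul (hK'.pow 2)).integrable _) fun o' => ?_
          simp only
          rw [← sq_abs (K o')]
          exact mul_le_mul_of_nonneg_right (pow_le_pow_left₀ (abs_nonneg _) (hb o') 2)
            (sq_nonneg _)
      _ ≤ (D * k) ^ 2 * (D * k') := by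
          rw [integral_const_mul]
          exact mul_le_mul_of_nonneg_left hi (sq_nonneg _)
      _ = _ := by ring
  rcases le_total k₁ k₂ with hk | hk
  · rw [min_eq_left hk, max_eq_right hk]
    exact main (fun o' => K₁ o' o) (fun o' => K₂ o' o) k₁ k₂ (h.measurable_K₁_left o)
      (h.measurable_K₂_left o) (fun o' => h.abs_K₁ o' o) (h.swap.integral_sq_K₁_left o)
  · rw [min_eq_right hk, max_eq_left hk]
    simp only [mul_comm (K₁ _ o ^ 2)]
    exact main (fun o' => K₂ o' o) (fun o' => K₁ o' o) k₂ k₁ (h.measurable_K₂_left o)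
      (h.measurable_K₁_left o) (fun o' => h.abs_K₂ o' o) (h.integral_sq_K₁_left o)

theorem integral_mul_sq_le (o : Ω) :
    ∫ o', (a o' * K₁ o' o) ^ 2 * (y o' * K₂ o' o) ^ 2 ∂P ≤
      C ^ 4 * (D ^ 3 * (min k₁ k₂ ^ 2 * max k₁ k₂)) := by
  have m1 := h.meas_a.mul (h.measurable_K₁_left o)
  have m2 := h.meas_y.mul (h.measurable_K₂_left o)
  have sq_le : ∀ x : ℝ, |x| ≤ C → x ^ 2 ≤ C ^ 2 := fun x hx => by
    rw [← sq_abs]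
    exact pow_le_pow_left₀ (abs_nonneg _) hx 2
  calc _ ≤ ∫ o', C ^ 4 * (K₁ o' o ^ 2 * K₂ o' o ^ 2) ∂P := by
        refine integral_mono (((m1.pow 2).mul (m2.pow 2)).integrable _)
          (((BddMeasurable.const _).mul (((h.measurable_K₁_left o).pow 2).mul
          ((h.measurable_K₂_left o).pow 2))).integrable _) fun o' => ?_
        have hp : a o' ^ 2 * y o' ^ 2 ≤ C ^ 2 * C ^ 2 :=
          mul_le_mul (sq_le _ (h.abs_a o')) (sq_le _ (h.abs_y o')) (sq_nonneg _) (sq_nonneg _)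
        calc (a o' * K₁ o' o) ^ 2 * (y o' * K₂ o' o) ^ 2 =
            a o' ^ 2 * y o' ^ 2 * (K₁ o' o ^ 2 * K₂ o' o ^ 2) := by ring
          _ ≤ C ^ 2 * C ^ 2 * (K₁ o' o ^ 2 * K₂ o' o ^ 2) :=
            mul_le_mul_of_nonneg_right hp (by positivity)
          _ = _ := by ring
    _ ≤ _ := by
        rw [integral_const_mul]
        exact mul_le_mul_of_nonneg_left (h.integral_sq_mul_sq_le o) (by positivity)

/-- The second moment of the product of the two fitted values at a point. -/
theorem integral_fitted_sq_mul_le (hn : 1 ≤ n) (o : Ω) :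
    ∫ ω, fitted a K₁ ω o ^ 2 * fitted y K₂ ω o ^ 2 ∂(Measure.pi fun _ : Fin n => P) ≤
      40 * (C ^ 4 * D ^ 4) * (1 + max k₁ k₂ / n + min k₁ k₂ * max k₁ k₂ / n ^ 2 +
        min k₁ k₂ ^ 2 * max k₁ k₂ / n ^ 3) := by
  have hn1 : (1 : ℝ) ≤ n := by exact_mod_cast hn
  have hn0 : (0 : ℝ) < n := by linarith
  have hC := h.one_le_C
  have hD := h.one_le_D
  have h1 := h.one_le_k₁
  have h2 := h.one_le_k₂
  refine (integral_average_sq_mul_le hn (h.meas_a.mul (h.measurable_K₁_left o))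
    (h.meas_y.mul (h.measurable_K₂_left o)) (h.abs_mean_left_le o) (h.swap.abs_mean_left_le o)
    (integral_weighted_sq_le h.abs_a h.meas_a (h.measurable_K₁_left o) (h.integral_sq_K₁_left o))
    (integral_weighted_sq_le h.abs_y h.meas_y (h.measurable_K₂_left o)
      (h.swap.integral_sq_K₁_left o)) (h.integral_mul_sq_le o)).trans ?_
  rw [min_mul_max]
  set K := max k₁ k₂ with hK
  set k := min k₁ k₂ with hk
  have hK1 : k₁ ≤ K := le_max_left _ _
  have hK2 : k₂ ≤ K := le_max_right _ _
  have hK0 : 0 < K := by linarith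
  have hk0 : 0 < k := lt_min (by linarith) (by linarith)
  have p32 : D ^ 3 ≤ D ^ 4 := pow_le_pow_right₀ hD (by norm_num)
  have p24 : D ^ 2 ≤ D ^ 4 := pow_le_pow_right₀ hD (by norm_num)
  have hn13 : (n : ℝ) ≤ (n : ℝ) ^ 3 := le_self_pow₀ hn1 (by norm_num)
  have hn03 : (1 : ℝ) ≤ (n : ℝ) ^ 3 := one_le_pow₀ hn1
  set G := C ^ 4 * D ^ 4 with hG
  have hG0 : 0 < G := by positivity
  have t1 : (C * D) ^ 2 * (C ^ 2 * (D * k₁)) ≤ G * K := by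
    calc _ = C ^ 4 * D ^ 3 * k₁ := by ring
      _ ≤ C ^ 4 * D ^ 4 * K := by gcongr
  have t2 : (C * D) ^ 2 * (C ^ 2 * (D * k₂)) ≤ G * K := by
    calc _ = C ^ 4 * D ^ 3 * k₂ := by ring
      _ ≤ C ^ 4 * D ^ 4 * K := by gcongr
  have t3 : C ^ 4 * (D ^ 3 * (k ^ 2 * K)) ≤ G * (k ^ 2 * K) := by
    rw [← mul_assoc]
    gcongr
    exact mul_le_mul_of_nonneg_left p32 (by positivity)
  have t4 : (C * D) ^ 4 = G := by rw [mul_pow]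
  have t5 : C ^ 2 * (D * k₁) * (C ^ 2 * (D * k₂)) ≤ G * (k₁ * k₂) := by
    calc _ = C ^ 4 * D ^ 2 * (k₁ * k₂) := by ring
      _ ≤ C ^ 4 * D ^ 4 * (k₁ * k₂) := by gcongr
  have u1 : (C * D) ^ 2 * (C ^ 2 * (D * k₁) / n) ≤ G * (K / n) := by
    rw [← mul_div_assoc, ← mul_div_assoc]
    gcongr
  have u2 : (C * D) ^ 2 * (C ^ 2 * (D * k₂) / n) ≤ G * (K / n) := by
    rw [← mul_div_assoc, ← mul_div_assoc]
    gcongr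
  have u3 : 4 * (C ^ 4 * (D ^ 3 * (k ^ 2 * K)) + (C * D) ^ 2 * (C ^ 2 * (D * k₁)) +
      (C * D) ^ 2 * (C ^ 2 * (D * k₂)) + (C * D) ^ 4) / (n : ℝ) ^ 3 ≤
      4 * G * (k ^ 2 * K / n ^ 3) + 8 * G * (K / n) + 4 * G := by
    calc _ ≤ 4 * (G * (k ^ 2 * K) + G * K + G * K + G) / (n : ℝ) ^ 3 := by
          gcongr
          exact t4.le
      _ = 4 * G * (k ^ 2 * K / n ^ 3) + 8 * G * (K / n ^ 3) + 4 * G * (1 / n ^ 3) := by ring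
      _ ≤ _ := by
          have : 1 / (n : ℝ) ^ 3 ≤ 1 := by
            rw [div_le_one (by positivity)]
            exact hn03
          have : K / (n : ℝ) ^ 3 ≤ K / n := by gcongr
          nlinarith
  have u5 : 3 * (C ^ 2 * (D * k₁) * (C ^ 2 * (D * k₂))) / (n : ℝ) ^ 2 ≤
      3 * G * (k₁ * k₂ / n ^ 2) := by
    rw [← mul_div_assoc, mul_assoc 3 G]
    gcongr
  have w1 : 0 ≤ G * (K / n) := by positivity
  have w2 : 0 ≤ G * (k ^ 2 * K / (n : ℝ) ^ 3) := by positivity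
  have w3 : 0 ≤ G * (k₁ * k₂ / (n : ℝ) ^ 2) := by positivity
  -- The largest coefficient is that of `K / n`, namely `4 * (1 + 1 + 8) = 40`.
  rw [t4] at *
  linarith

/-- The bound uses the larger resolution so that it has the same form for both fits. -/
theorem integral_fitted_sq_le (hn : 1 ≤ n) (o : Ω) :
    ∫ ω, fitted a K₁ ω o ^ 2 ∂(Measure.pi fun _ : Fin n => P) ≤
      2 * (C ^ 2 * D ^ 4) * (1 + max k₁ k₂ / n) := by
  have hn0 : (0 : ℝ) < n := by exact_mod_cast hn
  have hC := h.one_le_C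
  have hD := h.one_le_D
  have h1 := h.one_le_k₁
  refine (integral_average_sq_le hn (h.meas_a.mul (h.measurable_K₁_left o)) (h.abs_mean_left_le o)
    (integral_weighted_sq_le h.abs_a h.meas_a (h.measurable_K₁_left o)
      (h.integral_sq_K₁_left o))).trans ?_
  have hK1 : k₁ ≤ max k₁ k₂ := le_max_left _ _
  have p24 : D ^ 2 ≤ D ^ 4 := pow_le_pow_right₀ hD (by norm_num)
  have p14 : D ≤ D ^ 4 := le_self_pow₀ hD (by norm_num)
  calc _ = 2 * (C ^ 2 * D ^ 2) + 2 * (C ^ 2 * D * (k₁ / n)) := by ring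
    _ ≤ 2 * (C ^ 2 * D ^ 4) + 2 * (C ^ 2 * D ^ 4 * (max k₁ k₂ / n)) := by gcongr
    _ = _ := by ring

/-- Exchanging the integrals puts the average over the training sample inside, where the bound holds
at each fixed point. -/
theorem integral_integral_plugIn_summand_sq_le (hn : 1 ≤ n) :
    ∫ ω, ∫ o, (fitted a K₁ ω o * fitted y K₂ ω o) ^ 2 ∂P ∂(Measure.pi fun _ : Fin n => P) ≤
      40 * (C ^ 4 * D ^ 4) * (1 + max k₁ k₂ / n + min k₁ k₂ * max k₁ k₂ / n ^ 2 +
        min k₁ k₂ ^ 2 * max k₁ k₂ / n ^ 3) := by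
  have hm : BddMeasurable fun z : (Fin n → Ω) × Ω =>
      (fitted a K₁ z.1 z.2 * fitted y K₂ z.1 z.2) ^ 2 :=
    (h.measurable_fitted_left.mul h.measurable_fitted_right).pow 2
  rw [integral_integral_swap (hm.integrable _)]
  have hm' := (hm.comp measurable_swap).integral_right (Measure.pi fun _ : Fin n => P)
  have := integral_mono (hm'.integrable P) (integrable_const _) fun o =>
    (by simpa only [Prod.swap, mul_pow] using h.integral_fitted_sq_mul_le hn o)
  simpa using this

theorem integral_integral_influence_summand_sq_le (hn : 1 ≤ n) :
    ∫ ω, ∫ o, ((a o - fitted a K₁ ω o) * (y o - fitted y K₂ ω o)) ^ 2 ∂P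
        ∂(Measure.pi fun _ : Fin n => P) ≤
      200 * (C ^ 4 * D ^ 4) * (1 + max k₁ k₂ / n + min k₁ k₂ * max k₁ k₂ / n ^ 2 +
        min k₁ k₂ ^ 2 * max k₁ k₂ / n ^ 3) := by
  have hC := h.one_le_C
  have hD := h.one_le_D
  have h1 := h.one_le_k₁
  have h2 := h.one_le_k₂
  have hm : BddMeasurable fun z : (Fin n → Ω) × Ω =>
      ((a z.2 - fitted a K₁ z.1 z.2) * (y z.2 - fitted y K₂ z.1 z.2)) ^ 2 :=
    (((h.meas_a.comp measurable_snd).sub h.measurable_fitted_left).mul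
      ((h.meas_y.comp measurable_snd).sub h.measurable_fitted_right)).pow 2
  rw [integral_integral_swap (hm.integrable _)]
  have hm' := (hm.comp measurable_swap).integral_right (Measure.pi fun _ : Fin n => P)
  set β := 1 + max k₁ k₂ / n + min k₁ k₂ * max k₁ k₂ / n ^ 2 +
        min k₁ k₂ ^ 2 * max k₁ k₂ / n ^ 3 with hβ
  have hK0 : 0 < max k₁ k₂ := lt_max_of_lt_left (by linarith)
  have hk0 : 0 < min k₁ k₂ := lt_min (by linarith) (by linarith)
  have hb0 : 1 + max k₁ k₂ / n ≤ β := by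
    have : 0 ≤ min k₁ k₂ * max k₁ k₂ / (n : ℝ) ^ 2 := by positivity
    have : 0 ≤ min k₁ k₂ ^ 2 * max k₁ k₂ / (n : ℝ) ^ 3 := by positivity
    linarith
  have hb1 : 1 ≤ β := by
    have : 0 ≤ max k₁ k₂ / (n : ℝ) := by positivity
    linarith
  have sq_le : ∀ x : ℝ, |x| ≤ C → x ^ 2 ≤ C ^ 2 := fun x hx => by
    rw [← sq_abs]
    exact pow_le_pow_left₀ (abs_nonneg _) hx 2
  have key : ∀ o, ∫ ω, ((a o - fitted a K₁ ω o) * (y o - fitted y K₂ ω o)) ^ 2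
      ∂(Measure.pi fun _ : Fin n => P) ≤ 200 * (C ^ 4 * D ^ 4) * β := fun o => by
    have f1 : BddMeasurable fun ω : Fin n → Ω => fitted a K₁ ω o :=
      h.measurable_fitted_left.comp (φ := fun ω : Fin n → Ω => (ω, o)) (by fun_prop)
    have f2 : BddMeasurable fun ω : Fin n → Ω => fitted y K₂ ω o :=
      h.measurable_fitted_right.comp (φ := fun ω : Fin n → Ω => (ω, o)) (by fun_prop)
    have c1 : BddMeasurable fun ω : Fin n → Ω => C ^ 2 * fitted y K₂ ω o ^ 2 :=
      (BddMeasurable.const _).mul (f2.pow 2)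
    have c2 : BddMeasurable fun ω : Fin n → Ω => C ^ 2 * fitted a K₁ ω o ^ 2 :=
      (BddMeasurable.const _).mul (f1.pow 2)
    have c3 : BddMeasurable fun ω : Fin n → Ω => fitted a K₁ ω o ^ 2 * fitted y K₂ ω o ^ 2 :=
      (f1.pow 2).mul (f2.pow 2)
    have b1 := h.integral_fitted_sq_le hn o
    have b2 := h.swap.integral_fitted_sq_le hn o
    have b3 := h.integral_fitted_sq_mul_le hn o
    rw [max_comm] at b2
    calc _ ≤ ∫ ω, 4 * (C ^ 4 + C ^ 2 * fitted y K₂ ω o ^ 2 + C ^ 2 * fitted a K₁ ω o ^ 2 +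
          fitted a K₁ ω o ^ 2 * fitted y K₂ ω o ^ 2) ∂(Measure.pi fun _ : Fin n => P) := by
          refine integral_mono (((((BddMeasurable.const _).sub f1).mul
            ((BddMeasurable.const _).sub f2)).pow 2).integrable _)
            (((BddMeasurable.const 4).mul ((((BddMeasurable.const (C ^ 4)).add c1).add c2).add
            c3)).integrable _) fun ω => ?_
          simp only [mul_pow]
          have g1 : (a o - fitted a K₁ ω o) ^ 2 ≤ 2 * (C ^ 2 + fitted a K₁ ω o ^ 2) := by
            nlinarith [sq_nonneg (a o + fitted a K₁ ω o), sq_le _ (h.abs_a o)]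
          have g2 : (y o - fitted y K₂ ω o) ^ 2 ≤ 2 * (C ^ 2 + fitted y K₂ ω o ^ 2) := by
            nlinarith [sq_nonneg (y o + fitted y K₂ ω o), sq_le _ (h.abs_y o)]
          calc _ ≤ 2 * (C ^ 2 + fitted a K₁ ω o ^ 2) * (2 * (C ^ 2 + fitted y K₂ ω o ^ 2)) :=
                mul_le_mul g1 g2 (sq_nonneg _) (by positivity)
            _ = _ := by ring
      _ = 4 * (C ^ 4 + C ^ 2 * (∫ ω, fitted y K₂ ω o ^ 2 ∂(Measure.pi fun _ : Fin n => P)) +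
          C ^ 2 * (∫ ω, fitted a K₁ ω o ^ 2 ∂(Measure.pi fun _ : Fin n => P)) +
          ∫ ω, fitted a K₁ ω o ^ 2 * fitted y K₂ ω o ^ 2 ∂(Measure.pi fun _ : Fin n => P)) := by
          rw [integral_const_mul, integral_add ((((BddMeasurable.const (C ^ 4)).add c1).add
            c2).integrable _) (c3.integrable _), integral_add
            (((BddMeasurable.const (C ^ 4)).add c1).integrable _) (c2.integrable _),
            integral_add (integrable_const _) (c1.integrable _)]
          simp only [integral_const, probReal_univ, one_smul, integral_const_mul]
      -- The four terms have weights `1`, `2`, `2` and `40`, and `4 * 45 = 180` is below the stated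
      -- `200`.
      _ ≤ 4 * (C ^ 4 * D ^ 4 * β + C ^ 2 * (2 * (C ^ 2 * D ^ 4) * β) +
          C ^ 2 * (2 * (C ^ 2 * D ^ 4) * β) + 40 * (C ^ 4 * D ^ 4) * β) := by
          have : C ^ 4 ≤ C ^ 4 * D ^ 4 * β := by
            have : 1 ≤ D ^ 4 * β := one_le_mul_of_one_le_of_one_le (one_le_pow₀ hD) hb1
            rw [mul_assoc]
            exact le_mul_of_one_le_right (by positivity) this
          have b1' := b1.trans (mul_le_mul_of_nonneg_left hb0 (by positivity))
          have b2' := b2.trans (mul_le_mul_of_nonneg_left hb0 (by positivity))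
          gcongr
      _ ≤ _ := by
          have : 0 ≤ C ^ 4 * D ^ 4 * β := by positivity
          linarith
  have := integral_mono (hm'.integrable P) (integrable_const _) key
  simpa using this

/-! ### The conditional mean of the influence function summands -/

theorem integral_fitted_mul (ω : Fin n → Ω) :
    ∫ o, fitted a K₁ ω o * y o ∂P =
      (1 / n : ℝ) * ∑ i, a (ω i) * ∫ o, y o * K₁ (ω i) o ∂P := by
  simp only [fitted, Finset.mul_sum, Finset.sum_mul]
  have hm : ∀ i, BddMeasurable fun o => (1 / n : ℝ) * (a (ω i) * K₁ (ω i) o) * y o := fun i =>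
    ((BddMeasurable.const _).mul ((BddMeasurable.const _).mul (h.meas_K₁.right (ω i)))).mul h.meas_y
  rw [integral_finsetSum _ fun i _ => (hm i).integrable _]
  refine Finset.sum_congr rfl fun i _ => ?_
  rw [← integral_const_mul, ← integral_const_mul]
  congr 1
  ext o
  ring

/-- Multiply out the product of residuals: the two mixed terms are linear in the training sample,
and the product of the two fits integrates to the plug-in statistic. -/
theorem integral_influence_summand (ω : Fin n → Ω) :
    ∫ o, (a o - fitted a K₁ ω o) * (y o - fitted y K₂ ω o) ∂P =
      (∫ o, a o * y o ∂P) - (1 / n : ℝ) * ∑ i, a (ω i) * ∫ o, y o * K₁ (ω i) o ∂P -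
        (1 / n : ℝ) * ∑ i, y (ω i) * ∫ o, a o * K₂ (ω i) o ∂P + plugIn a y e ω := by
  have f1 := h.measurable_fitted_left.right ω
  have f2 := h.measurable_fitted_right.right ω
  rw [← h.integral_fitted_mul, ← h.swap.integral_fitted_mul, ← h.integral_fitted_mul_fitted,
    ← integral_sub ((h.meas_a.mul h.meas_y).integrable _) ((f1.mul h.meas_y).integrable _),
    ← integral_sub (((h.meas_a.mul h.meas_y).sub (f1.mul h.meas_y)).integrable _)
      ((f2.mul h.meas_a).integrable _),
    ← integral_add ((((h.meas_a.mul h.meas_y).sub (f1.mul h.meas_y)).sub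
      (f2.mul h.meas_a)).integrable _) ((f1.mul f2).integrable _)]
  congr 1
  ext o
  ring

theorem measurable_mean_right : BddMeasurable fun o => ∫ o', y o' * K₁ o o' ∂P :=
  ((h.meas_y.comp measurable_snd).mul h.meas_K₁).integral_right P

theorem abs_mean_right_le (o : Ω) : |∫ o', y o' * K₁ o o' ∂P| ≤ C * D :=
  abs_integral_mul_le (by linarith [h.one_le_C]) h.abs_y h.meas_y (h.meas_K₁.right o)
    (h.integral_abs_K₁ o)

/-- The summands are bounded by `C * (C * D)`, without a factor of the resolution, because the inner
integral is controlled by the `L¹` norm of the kernel. -/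
theorem integral_average_mean_right_sub_sq_le (hn : 1 ≤ n) :
    ∫ ω, ((1 / n : ℝ) * ∑ i, a (ω i) * (∫ o, y o * K₁ (ω i) o ∂P) -
        ∫ o, a o * (∫ o', y o' * K₁ o o' ∂P) ∂P) ^ 2 ∂(Measure.pi fun _ : Fin n => P) ≤
      C ^ 4 * D ^ 4 / n := by
  have hC := h.one_le_C
  have hD := h.one_le_D
  have hm := h.meas_a.mul h.measurable_mean_right
  refine (integral_average_sub_mean_sq_le hn hm).trans ?_
  gcongr
  have hpt : ∀ o, (a o * ∫ o', y o' * K₁ o o' ∂P) ^ 2 ≤ C ^ 4 * D ^ 4 := fun o => by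
    rw [← sq_abs, abs_mul]
    calc _ ≤ (C * (C * D)) ^ 2 := pow_le_pow_left₀ (by positivity)
          (mul_le_mul (h.abs_a o) (h.abs_mean_right_le o) (abs_nonneg _) (by positivity)) 2
      _ = C ^ 4 * D ^ 2 := by ring
      _ ≤ _ := by
        gcongr
        norm_num
  have := integral_mono ((hm.pow 2).integrable P) (integrable_const _) hpt
  simpa using this

variable [CompleteSpace H]

theorem integral_integral_influence_summand (hn : 1 ≤ n) :
    ∫ ω, ∫ o, (a o - fitted a K₁ ω o) * (y o - fitted y K₂ ω o) ∂P
        ∂(Measure.pi fun _ : Fin n => P) =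
      (∫ o, a o * y o ∂P) - (∫ o, a o * (∫ o', y o' * K₁ o o' ∂P) ∂P) -
        (∫ o, y o * (∫ o', a o' * K₂ o o' ∂P) ∂P) +
        (inner ℝ (∫ o, a o • e o ∂P) (∫ o, y o • e o ∂P) + (1 / n : ℝ) *
        ((∫ o, a o * y o * ‖e o‖ ^ 2 ∂P) -
          inner ℝ (∫ o, a o • e o ∂P) (∫ o, y o • e o ∂P))) := by
  simp only [h.integral_influence_summand]
  have m1 := (h.meas_a.mul h.measurable_mean_right).average (n := n)
  have m2 := (h.meas_y.mul h.swap.measurable_mean_right).average (n := n)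
  rw [integral_add ((((BddMeasurable.const _).sub m1).sub m2).integrable _)
    (h.measurable_plugIn.integrable _), integral_sub (((BddMeasurable.const _).sub m1).integrable _)
    (m2.integrable _), integral_sub (integrable_const _) (m1.integrable _),
    integral_average hn (h.meas_a.mul h.measurable_mean_right),
    integral_average hn (h.meas_y.mul h.swap.measurable_mean_right), h.integral_plugIn hn]
  simp

/-- The error is a sum of two linear fluctuations and the plug-in fluctuation; squaring a sum of
three costs a factor `3`, whence `3 + 3 + 3 * 192 = 582`. -/
theorem integral_influence_summand_sub_sq_le (hn : 1 ≤ n) :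
    ∫ ω, ((∫ o, (a o - fitted a K₁ ω o) * (y o - fitted y K₂ ω o) ∂P) -
      ((∫ o, a o * y o ∂P) - (∫ o, a o * (∫ o', y o' * K₁ o o' ∂P) ∂P) -
        (∫ o, y o * (∫ o', a o' * K₂ o o' ∂P) ∂P) +
        inner ℝ (∫ o, a o • e o ∂P) (∫ o, y o • e o ∂P))) ^ 2
        ∂(Measure.pi fun _ : Fin n => P) ≤
      600 * (C ^ 4 * D ^ 4) * (1 / n + min k₁ k₂ ^ 2 / n ^ 2) := by
  have hn0 : (0 : ℝ) < n := by exact_mod_cast hn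
  have hC := h.one_le_C
  have hD := h.one_le_D
  simp only [h.integral_influence_summand]
  have m1 := (h.meas_a.mul h.measurable_mean_right).average (n := n)
  have m2 := (h.meas_y.mul h.swap.measurable_mean_right).average (n := n)
  have b1 := h.integral_average_mean_right_sub_sq_le hn
  have b2 := h.swap.integral_average_mean_right_sub_sq_le hn
  have b3 := h.integral_plugIn_sub_sq_le hn
  set q1 := ∫ o, a o * (∫ o', y o' * K₁ o o' ∂P) ∂P
  set q2 := ∫ o, y o * (∫ o', a o' * K₂ o o' ∂P) ∂P
  set q0 : ℝ := inner ℝ (∫ o, a o • e o ∂P) (∫ o, y o • e o ∂P)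
  have c1 := (m1.sub (BddMeasurable.const q1)).pow 2
  have c2 := (m2.sub (BddMeasurable.const q2)).pow 2
  have c3 := ((h.measurable_plugIn (n := n)).sub (BddMeasurable.const q0)).pow 2
  calc _ ≤ ∫ ω, (3 * ((1 / n : ℝ) * ∑ i, a (ω i) * (∫ o, y o * K₁ (ω i) o ∂P) - q1) ^ 2 +
        3 * ((1 / n : ℝ) * ∑ i, y (ω i) * (∫ o, a o * K₂ (ω i) o ∂P) - q2) ^ 2 +
        3 * (plugIn a y e ω - q0) ^ 2) ∂(Measure.pi fun _ : Fin n => P) := by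
        refine integral_mono ((((((BddMeasurable.const _).sub m1).sub m2).add
          h.measurable_plugIn).sub (BddMeasurable.const _)).pow 2 |>.integrable _)
          (((((BddMeasurable.const 3).mul c1).add ((BddMeasurable.const 3).mul c2)).add
          ((BddMeasurable.const 3).mul c3)).integrable _) fun ω => ?_
        simp only
        generalize (1 / n : ℝ) * ∑ i, a (ω i) * (∫ o, y o * K₁ (ω i) o ∂P) = x1
        generalize (1 / n : ℝ) * ∑ i, y (ω i) * (∫ o, a o * K₂ (ω i) o ∂P) = x2
        generalize plugIn a y e ω = x3
        nlinarith [sq_nonneg ((x1 - q1) - (x2 - q2)), sq_nonneg ((x1 - q1) + (x3 - q0)),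
          sq_nonneg ((x2 - q2) + (x3 - q0))]
    _ ≤ 3 * (C ^ 4 * D ^ 4 / n) + 3 * (C ^ 4 * D ^ 4 / n) +
        3 * (192 * (C ^ 4 * D ^ 4) * (1 / n + min k₁ k₂ ^ 2 / n ^ 2)) := by
        rw [integral_add ((((BddMeasurable.const 3).mul c1).add
          ((BddMeasurable.const 3).mul c2)).integrable _)
          (((BddMeasurable.const 3).mul c3).integrable _),
          integral_add (((BddMeasurable.const 3).mul c1).integrable _)
          (((BddMeasurable.const 3).mul c2).integrable _),
          integral_const_mul, integral_const_mul, integral_const_mul]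
        gcongr
    _ = C ^ 4 * D ^ 4 * (582 / n + 576 * (min k₁ k₂ ^ 2 / n ^ 2)) := by ring
    _ ≤ C ^ 4 * D ^ 4 * (600 / n + 600 * (min k₁ k₂ ^ 2 / n ^ 2)) := by gcongr <;> norm_num
    _ = _ := by ring

end KernelPair

/-! ### Laws of observations with given regression functions -/

section Laws

variable {d : ℕ}

/-- The coordinatewise projection onto the unit cube. -/
def clampCube (x : Fin d → ℝ) : Fin d → ℝ := fun i => max 0 (min 1 (x i))

theorem clampCube_mem (x : Fin d → ℝ) : clampCube x ∈ Icc (0 : Fin d → ℝ) 1 :=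
  ⟨fun _ => le_max_left _ _, fun _ => max_le zero_le_one (min_le_left _ _)⟩

theorem clampCube_of_mem {x : Fin d → ℝ} (hx : x ∈ Icc (0 : Fin d → ℝ) 1) : clampCube x = x := by
  ext i
  have := mem_cube_apply hx i
  simp [clampCube, this.1, this.2]

theorem continuous_clampCube : Continuous (clampCube : (Fin d → ℝ) → Fin d → ℝ) := by
  unfold clampCube
  fun_prop

theorem ContinuousOn.comp_clampCube {E : Type*} [TopologicalSpace E] {g : (Fin d → ℝ) → E}
    (hg : ContinuousOn g (Icc 0 1)) : Continuous fun x => g (clampCube x) :=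
  hg.comp_continuous continuous_clampCube clampCube_mem

namespace Obs

theorem measurable_X : Measurable (X : Obs d → Fin d → ℝ) := measurable_fst

theorem measurable_A : Measurable (A : Obs d → ℝ) := measurable_fst.comp measurable_snd

theorem measurable_Y : Measurable (Y : Obs d → ℝ) := measurable_snd.comp measurable_snd

end Obs

theorem ContinuousOn.bddMeasurable_clampCube {E : Type*} [NormedAddCommGroup E]
    {g : (Fin d → ℝ) → E} (hg : ContinuousOn g (Icc 0 1)) :
    BddMeasurable fun o : Obs d => g (clampCube o.X) := by
  obtain ⟨C, hC⟩ := isCompact_Icc.exists_bound_of_continuousOn hg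
  exact ⟨hg.comp_clampCube.stronglyMeasurable.comp_measurable Obs.measurable_X, C,
    fun o => hC _ (clampCube_mem _)⟩

/-- Truncation to the interval `[C₁, C₂]`. -/
def clip (C₁ C₂ t : ℝ) : ℝ := max C₁ (min C₂ t)

theorem clip_of_mem {C₁ C₂ t : ℝ} (ht : t ∈ Icc C₁ C₂) : clip C₁ C₂ t = t := by
  simp [clip, ht.1, ht.2]

theorem abs_clip_le (C₁ C₂ t : ℝ) : |clip C₁ C₂ t| ≤ 1 + |C₁| + |C₂| := by
  have a1 := abs_nonneg C₁
  have a2 := abs_nonneg C₂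
  rw [abs_le, clip]
  constructor
  · exact le_max_of_le_left (by linarith [neg_abs_le C₁])
  · exact max_le (by linarith [le_abs_self C₁])
      ((min_le_left _ _).trans (by linarith [le_abs_self C₂]))

theorem bddMeasurable_clip (C₁ C₂ : ℝ) {f : Obs d → ℝ} (hf : Measurable f) :
    BddMeasurable fun o => clip C₁ C₂ (f o) :=
  ⟨(measurable_const.max (measurable_const.min hf)).stronglyMeasurable, 1 + |C₁| + |C₂|,
    fun _ => abs_clip_le _ _ _⟩

/-- `P` is a law of `(X, A, Y)` with uniform `X`, responses in `[C₁, C₂]`, and regression functions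
`p` and `b`. -/
structure HasRegressions (P : Measure (Obs d)) (C₁ C₂ : ℝ) (p b : (Fin d → ℝ) → ℝ) : Prop where
  isProbabilityMeasure : IsProbabilityMeasure P
  map_X : P.map Obs.X = volume.restrict (Icc (0 : Fin d → ℝ) 1)
  mem_Icc : ∀ᵐ o ∂P, o.A ∈ Icc C₁ C₂ ∧ o.Y ∈ Icc C₁ C₂
  continuousOn_left : ContinuousOn p (Icc 0 1)
  continuousOn_right : ContinuousOn b (Icc 0 1)
  condExp_A : P[Obs.A | Obs.sigmaX d] =ᵐ[P] fun o => p o.X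
  condExp_Y : P[Obs.Y | Obs.sigmaX d] =ᵐ[P] fun o => b o.X

theorem sigmaX_le : Obs.sigmaX d ≤ (inferInstance : MeasurableSpace (Obs d)) :=
  Obs.measurable_X.comap_le

theorem integral_X_of_map_eq {P : Measure (Obs d)}
    (hX : P.map Obs.X = volume.restrict (Icc (0 : Fin d → ℝ) 1)) {g : (Fin d → ℝ) → ℝ}
    (hg : ContinuousOn g (Icc 0 1)) :
    ∫ o, g (clampCube o.X) ∂P = ∫ x in Icc (0 : Fin d → ℝ) 1, g x := by
  rw [← integral_map (f := fun x => g (clampCube x)) Obs.measurable_X.aemeasurable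
    hg.comp_clampCube.stronglyMeasurable.aestronglyMeasurable, hX]
  exact setIntegral_congr_fun measurableSet_Icc fun x hx => by simp only [clampCube_of_mem hx]

theorem ae_X_mem_of_map_eq {P : Measure (Obs d)}
    (hX : P.map Obs.X = volume.restrict (Icc (0 : Fin d → ℝ) 1)) :
    ∀ᵐ o ∂P, o.X ∈ Icc (0 : Fin d → ℝ) 1 := by
  refine ae_of_ae_map Obs.measurable_X.aemeasurable (p := fun x => x ∈ Icc (0 : Fin d → ℝ) 1) ?_
  rw [hX]
  exact ae_restrict_mem measurableSet_Icc

namespace HasRegressions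

variable {P : Measure (Obs d)} {C₁ C₂ : ℝ} {p b : (Fin d → ℝ) → ℝ}
  (h : HasRegressions P C₁ C₂ p b)
include h

theorem ae_good : ∀ᵐ o ∂P, o.X ∈ Icc (0 : Fin d → ℝ) 1 ∧ o.A ∈ Icc C₁ C₂ ∧ o.Y ∈ Icc C₁ C₂ :=
  (ae_X_mem_of_map_eq h.map_X).and h.mem_Icc

/-- Tower property, with the function of the covariates pulled out of the conditional expectation.
Clamping gives a globally measurable, bounded version of `g`. -/
theorem integral_mul_of_condExp {f : Obs d → ℝ} (hf : Measurable f)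
    (hfC : ∀ᵐ o ∂P, f o ∈ Icc C₁ C₂) {q : (Fin d → ℝ) → ℝ} (hq : ContinuousOn q (Icc 0 1))
    (hc : P[f | Obs.sigmaX d] =ᵐ[P] fun o => q o.X) {g : (Fin d → ℝ) → ℝ}
    (hg : ContinuousOn g (Icc 0 1)) :
    ∫ o, clip C₁ C₂ (f o) * g (clampCube o.X) ∂P = ∫ x in Icc (0 : Fin d → ℝ) 1, q x * g x := by
  have := h.isProbabilityMeasure
  have hcl := bddMeasurable_clip (d := d) C₁ C₂ hf
  have hgm := hg.bddMeasurable_clampCube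
  have hclip : (fun o => clip C₁ C₂ (f o)) =ᵐ[P] f := by
    filter_upwards [hfC] with o ho using clip_of_mem ho
  have hsm : StronglyMeasurable[Obs.sigmaX d] fun o : Obs d => g (clampCube o.X) :=
    hg.comp_clampCube.stronglyMeasurable.comp_measurable (comap_measurable _)
  have e1 := condExp_mul_of_stronglyMeasurable_right (μ := P) (m := Obs.sigmaX d)
    (f := fun o => clip C₁ C₂ (f o)) hsm ((hcl.mul hgm).integrable P) (hcl.integrable P)
  calc _ = ∫ o, (P[(fun o => clip C₁ C₂ (f o)) * (fun o => g (clampCube o.X)) | Obs.sigmaX d]) o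
        ∂P := (integral_condExp sigmaX_le).symm
    _ = ∫ o, (fun x => q x * g x) (clampCube o.X) ∂P := by
        refine integral_congr_ae ?_
        filter_upwards [e1, condExp_congr_ae (m := Obs.sigmaX d) hclip, hc, h.ae_good]
          with o h1 h2 h3 h4
        rw [h1, Pi.mul_apply, h2, h3, clampCube_of_mem h4.1]
    _ = _ := integral_X_of_map_eq h.map_X (hq.mul hg)

theorem integral_A_mul {g : (Fin d → ℝ) → ℝ} (hg : ContinuousOn g (Icc 0 1)) :
    ∫ o, clip C₁ C₂ o.A * g (clampCube o.X) ∂P = ∫ x in Icc (0 : Fin d → ℝ) 1, p x * g x :=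
  h.integral_mul_of_condExp Obs.measurable_A (h.mem_Icc.mono fun _ ho => ho.1)
    h.continuousOn_left h.condExp_A hg

theorem integral_Y_mul {g : (Fin d → ℝ) → ℝ} (hg : ContinuousOn g (Icc 0 1)) :
    ∫ o, clip C₁ C₂ o.Y * g (clampCube o.X) ∂P = ∫ x in Icc (0 : Fin d → ℝ) 1, b x * g x :=
  h.integral_mul_of_condExp Obs.measurable_Y (h.mem_Icc.mono fun _ ho => ho.2)
    h.continuousOn_right h.condExp_Y hg

/-- Integrating removes the outer conditional expectation; in the product of the two residuals, each
mixed term has mean `∫ p b`. -/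
theorem expCondCov_eq : expCondCov P =
    (∫ o, clip C₁ C₂ o.A * clip C₁ C₂ o.Y ∂P) - ∫ x in Icc (0 : Fin d → ℝ) 1, p x * b x := by
  have := h.isProbabilityMeasure
  have hA := bddMeasurable_clip (d := d) C₁ C₂ Obs.measurable_A
  have hY := bddMeasurable_clip (d := d) C₁ C₂ Obs.measurable_Y
  have hp := h.continuousOn_left.bddMeasurable_clampCube
  have hb := h.continuousOn_right.bddMeasurable_clampCube
  rw [expCondCov, integral_condExp sigmaX_le]
  calc _ = ∫ o, (clip C₁ C₂ o.A * clip C₁ C₂ o.Y - clip C₁ C₂ o.A * b (clampCube o.X) -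
        clip C₁ C₂ o.Y * p (clampCube o.X) + p (clampCube o.X) * b (clampCube o.X)) ∂P := by
        refine integral_congr_ae ?_
        filter_upwards [h.condExp_A, h.condExp_Y, h.ae_good] with o h1 h2 h3
        simp only [h1, h2, clip_of_mem h3.2.1, clip_of_mem h3.2.2, clampCube_of_mem h3.1]
        ring
    _ = _ := by
        rw [integral_add ((((hA.mul hY).sub (hA.mul hb)).sub (hY.mul hp)).integrable _)
          ((hp.mul hb).integrable _), integral_sub (((hA.mul hY).sub (hA.mul hb)).integrable _)
          ((hY.mul hp).integrable _), integral_sub ((hA.mul hY).integrable _)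
          ((hA.mul hb).integrable _), h.integral_A_mul h.continuousOn_right,
          h.integral_Y_mul h.continuousOn_left,
          integral_X_of_map_eq (g := fun x => p x * b x) h.map_X
            (h.continuousOn_left.mul h.continuousOn_right)]
        simp only [mul_comm (b _)]
        ring

end HasRegressions

end Laws

/-! ### Subsamples -/

theorem BddMeasurable.integral_comp_measurePreserving {α β : Type*} [MeasurableSpace α]
    [MeasurableSpace β] {μ : Measure α} {ν : Measure β} {φ : α → β} (h : MeasurePreserving φ μ ν)
    {f : β → ℝ} (hf : BddMeasurable f) : ∫ x, f (φ x) ∂μ = ∫ z, f z ∂ν := by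
  rw [← h.map_eq, integral_map h.measurable.aemeasurable hf.1.aestronglyMeasurable]

section Subsamples

variable {d n : ℕ} {P : Measure (Obs d)} [IsProbabilityMeasure P]

instance isProbabilityMeasure_sampleLaw : IsProbabilityMeasure (sampleLaw n P) := by
  unfold sampleLaw
  infer_instance

/-- Assembling a sample from its three subsamples. -/
def joinSample (z : (Fin n → Obs d) × (Fin n → Obs d) × (Fin n → Obs d)) : Sample d n :=
  fun a => (![z.1, z.2.1, z.2.2] : Fin 3 → Fin n → Obs d) a.1 a.2

/-- A product measure is determined by its values on boxes, and the preimage of a box is a product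
of three boxes. -/
theorem measurePreserving_joinSample :
    MeasurePreserving (joinSample (d := d) (n := n))
      ((Measure.pi fun _ : Fin n => P).prod
        ((Measure.pi fun _ : Fin n => P).prod (Measure.pi fun _ : Fin n => P)))
      (sampleLaw n P) := by
  have hm : Measurable (joinSample (d := d) (n := n)) := by
    refine measurable_pi_lambda _ fun a => ?_
    obtain ⟨s, i⟩ := a
    fin_cases s <;> simp [joinSample] <;> fun_prop
  refine ⟨hm, (Measure.pi_eq fun s hs => ?_).symm⟩
  have hpre : joinSample ⁻¹' (Set.univ.pi s) =
      (Set.univ.pi fun i => s (0, i)) ×ˢ ((Set.univ.pi fun i => s (1, i)) ×ˢ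
        (Set.univ.pi fun i => s (2, i))) := by
    ext z
    simp only [joinSample, Set.mem_preimage, Set.mem_univ_pi, Prod.forall, Fin.forall_fin_succ,
      Set.mem_prod]
    simp
  rw [Measure.map_apply hm (MeasurableSet.univ_pi hs), hpre, Measure.prod_prod, Measure.prod_prod,
    Measure.pi_pi, Measure.pi_pi, Measure.pi_pi, Fintype.prod_prod_type, Fin.prod_univ_three,
    mul_assoc]

theorem integral_sampleLaw {f : Sample d n → ℝ} (hf : BddMeasurable f) :
    ∫ ω, f ω ∂(sampleLaw n P) = ∫ z, f (joinSample z) ∂((Measure.pi fun _ : Fin n => P).prod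
        ((Measure.pi fun _ : Fin n => P).prod (Measure.pi fun _ : Fin n => P))) :=
  (hf.integral_comp_measurePreserving measurePreserving_joinSample).symm

/-- The `s`-th subsample. -/
def subsample (s : Fin 3) (ω : Sample d n) : Fin n → Obs d := fun i => ω (s, i)

theorem measurable_subsample (s : Fin 3) : Measurable (subsample (d := d) (n := n) s) := by
  unfold subsample
  fun_prop

theorem integral_subsample_zero {f : (Fin n → Obs d) → ℝ} (hf : BddMeasurable f) :
    ∫ ω, f (subsample 0 ω) ∂(sampleLaw n P) = ∫ ω, f ω ∂(Measure.pi fun _ : Fin n => P) := by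
  rw [integral_sampleLaw (hf.comp (measurable_subsample 0))]
  exact integral_prod_fst f

theorem integral_subsample_one {f : (Fin n → Obs d) → ℝ} (hf : BddMeasurable f) :
    ∫ ω, f (subsample 1 ω) ∂(sampleLaw n P) = ∫ ω, f ω ∂(Measure.pi fun _ : Fin n => P) := by
  rw [integral_sampleLaw (hf.comp (measurable_subsample 1))]
  have h1 := integral_prod_snd (P := Measure.pi fun _ : Fin n => P)
    (ν := (Measure.pi fun _ : Fin n => P).prod (Measure.pi fun _ : Fin n => P))
    fun z : (Fin n → Obs d) × (Fin n → Obs d) => f z.1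
  exact h1.trans (integral_prod_fst f)

theorem integral_subsample_zero_one {f : (Fin n → Obs d) × (Fin n → Obs d) → ℝ}
    (hf : BddMeasurable f) :
    ∫ ω, f (subsample 0 ω, subsample 1 ω) ∂(sampleLaw n P) =
      ∫ z, f z ∂((Measure.pi fun _ : Fin n => P).prod (Measure.pi fun _ : Fin n => P)) := by
  rw [integral_sampleLaw (hf.comp ((measurable_subsample 0).prodMk (measurable_subsample 1)))]
  have h := (MeasurePreserving.id (Measure.pi fun _ : Fin n => P)).prod
    (measurePreserving_fst (μ := Measure.pi fun _ : Fin n => P)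
      (ν := Measure.pi fun _ : Fin n => P))
  exact hf.integral_comp_measurePreserving h

theorem integral_subsample_zero_two {f : (Fin n → Obs d) × (Fin n → Obs d) → ℝ}
    (hf : BddMeasurable f) :
    ∫ ω, f (subsample 0 ω, subsample 2 ω) ∂(sampleLaw n P) =
      ∫ z, f z ∂((Measure.pi fun _ : Fin n => P).prod (Measure.pi fun _ : Fin n => P)) := by
  rw [integral_sampleLaw (hf.comp ((measurable_subsample 0).prodMk (measurable_subsample 2)))]
  have h := (MeasurePreserving.id (Measure.pi fun _ : Fin n => P)).prod
    (measurePreserving_snd (μ := Measure.pi fun _ : Fin n => P)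
      (ν := Measure.pi fun _ : Fin n => P))
  exact hf.integral_comp_measurePreserving h

theorem ae_sampleLaw {q : Obs d → Prop} (hq : ∀ᵐ o ∂P, q o) :
    ∀ᵐ ω ∂(sampleLaw n P), ∀ a, q (ω a) :=
  ae_all_iff.2 fun a =>
    (measurePreserving_eval (fun _ : Fin 3 × Fin n => P) a).quasiMeasurePreserving.ae hq

end Subsamples

/-- The variance is at most the mean square deviation from any constant, so a convenient centre may
be used instead of the mean. -/
theorem evariance_le_of_integral_sub_sq_le {Ω : Type*} [MeasurableSpace Ω] {μ : Measure Ω}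
    [IsProbabilityMeasure μ] {T T' : Ω → ℝ} (hT : T =ᵐ[μ] T') (hT' : BddMeasurable T') (c : ℝ)
    {V : ℝ} (hV : ∫ ω, (T' ω - c) ^ 2 ∂μ ≤ V) : evariance T μ ≤ ENNReal.ofReal V := by
  have hm := hT'.memLp μ 2
  rw [evariance_congr hT, ← hm.ofReal_variance_eq]
  refine ENNReal.ofReal_le_ofReal (le_trans ?_ hV)
  rw [← variance_sub_const hm.aestronglyMeasurable c]
  exact variance_le_expectation_sq (hm.aestronglyMeasurable.sub aestronglyMeasurable_const)

/-! ### Wavelet kernels and scaling functions as functions of observations. -/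

namespace CDVBasis

variable {S : ℕ} (B : CDVBasis S) {d n : ℕ}

/-- The kernel of level `j` evaluated at the covariates of two observations. -/
def obsKernel (j : ℕ) (o o' : Obs d) : ℝ := B.kernel j (clampCube o.X) (clampCube o'.X)

/-- The vector of scaling functions of level `j` evaluated at the covariates. -/
def feature (j : ℕ) (o : Obs d) : EuclideanSpace ℝ (Fin d → Fin (2 ^ j)) :=
  WithLp.toLp 2 fun m => B.Phi j m (clampCube o.X)

theorem inner_feature (j : ℕ) (o o' : Obs d) :
    inner ℝ (B.feature j o) (B.feature j o') = B.obsKernel j o o' := by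
  simp [feature, obsKernel, kernel, PiLp.inner_apply, mul_comm]

theorem norm_feature_sq (j : ℕ) (o : Obs d) :
    ‖B.feature j o‖ ^ 2 = B.obsKernel j o o := by
  rw [← inner_feature, real_inner_self_eq_norm_sq]

theorem bddMeasurable_obsKernel (j : ℕ) :
    BddMeasurable fun z : Obs d × Obs d => B.obsKernel j z.1 z.2 :=
  BddMeasurable.sum _ fun m =>
    ((B.Phi_continuousOn j m).bddMeasurable_clampCube.comp measurable_fst).mul
      ((B.Phi_continuousOn j m).bddMeasurable_clampCube.comp measurable_snd)

theorem bddMeasurable_feature (j : ℕ) : BddMeasurable (B.feature j : Obs d → _) := by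
  refine ContinuousOn.bddMeasurable_clampCube
    (g := fun x => (WithLp.toLp 2 fun m => B.Phi j m x : EuclideanSpace ℝ (Fin d → Fin (2 ^ j)))) ?_
  exact (PiLp.continuous_toLp 2 _).comp_continuousOn
    (continuousOn_pi.2 fun m => B.Phi_continuousOn j m)

theorem min_two_pow_mul (j₁ j₂ d : ℕ) :
    min ((2 : ℝ) ^ (j₁ * d)) (2 ^ (j₂ * d)) = 2 ^ (min j₁ j₂ * d) := by
  have hm : Monotone fun j : ℕ => (2 : ℝ) ^ (j * d) := fun a b hab =>
    pow_le_pow_right₀ (by norm_num) (Nat.mul_le_mul_right d hab)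
  exact (hm.map_min (a := j₁) (b := j₂)).symm

-- Uniformity of the covariates turns integrals against `P` into integrals over the cube, so the
-- kernel estimates there carry over.
variable {B} in
theorem KernelBound.kernelPair {P : Measure (Obs d)} {C₁ C₂ : ℝ} {p b : (Fin d → ℝ) → ℝ}
    {D : ℝ} (hK : B.KernelBound d D) (h : HasRegressions P C₁ C₂ p b) {j₁ j₂ : ℕ}
    (h₁ : B.J₀ ≤ j₁) (h₂ : B.J₀ ≤ j₂) :
    KernelPair P (fun o => clip C₁ C₂ o.A) (fun o => clip C₁ C₂ o.Y) (B.obsKernel j₁)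
      (B.obsKernel j₂) (B.feature (min j₁ j₂)) (1 + |C₁| + |C₂|) D (2 ^ (j₁ * d))
      (2 ^ (j₂ * d)) := by
  have habs : ∀ j (o : Obs d), ∫ o', |B.obsKernel j o o'| ∂P ≤ D := fun j o => by
    refine le_trans (le_of_eq ?_) (hK.integral_abs_le j (clampCube o.X) (clampCube_mem _))
    exact integral_X_of_map_eq h.map_X (B.kernel_continuousOn j (clampCube o.X)).abs
  have hmul : ∀ j j' (_ : B.J₀ ≤ j) (_ : B.J₀ ≤ j') (o o' : Obs d),
      ∫ z, B.obsKernel j o z * B.obsKernel j' o' z ∂P = B.obsKernel (min j j') o o' :=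
    fun j j' hj hj' o o' => by
    rw [obsKernel, ← B.integral_kernel_mul_kernel hj hj' (clampCube_mem _) (clampCube_mem _)]
    exact integral_X_of_map_eq h.map_X ((B.kernel_continuousOn j (clampCube o.X)).mul
      (B.kernel_continuousOn j' (clampCube o'.X)))
  have hbd : ∀ j (o o' : Obs d), |B.obsKernel j o o'| ≤ D * 2 ^ (j * d) := fun j o o' =>
    hK.abs_le j _ (clampCube_mem _) _ (clampCube_mem _)
  -- By reproduction, the squared `L²` norm of `K(x, ·)` is `K(x, x)`.
  have hsq : ∀ j (_ : B.J₀ ≤ j) (o : Obs d), ∫ o', B.obsKernel j o o' ^ 2 ∂P ≤ D * 2 ^ (j * d) :=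
    fun j hj o => by
    simp only [pow_two, hmul j j hj hj, min_self]
    exact (le_abs_self _).trans (hbd j o o)
  have ha0 := abs_nonneg C₁
  have hb0 := abs_nonneg C₂
  exact
  { one_le_C := by linarith
    one_le_D := hK.one_le
    one_le_k₁ := one_le_pow₀ (by norm_num)
    one_le_k₂ := one_le_pow₀ (by norm_num)
    meas_a := bddMeasurable_clip _ _ Obs.measurable_A
    meas_y := bddMeasurable_clip _ _ Obs.measurable_Y
    meas_K₁ := B.bddMeasurable_obsKernel j₁
    meas_K₂ := B.bddMeasurable_obsKernel j₂
    meas_e := B.bddMeasurable_feature _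
    abs_a := fun o => abs_clip_le _ _ _
    abs_y := fun o => abs_clip_le _ _ _
    symm_K₁ := fun o o' => B.kernel_comm _ _ _
    symm_K₂ := fun o o' => B.kernel_comm _ _ _
    abs_K₁ := hbd j₁
    abs_K₂ := hbd j₂
    norm_e := fun o => by
      rw [norm_feature_sq, min_two_pow_mul]
      exact (le_abs_self _).trans (hbd _ o o)
    integral_abs_K₁ := habs j₁
    integral_abs_K₂ := habs j₂
    integral_abs_e := fun o => by
      simp only [inner_feature]
      exact habs _ o
    integral_sq_K₁ := hsq j₁ h₁
    integral_sq_K₂ := hsq j₂ h₂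
    integral_mul := fun o o' => by rw [hmul j₁ j₂ h₁ h₂, inner_feature] }

end CDVBasis

/-! ### Identification of means, and bounded versions of the estimators. -/

namespace HasRegressions

variable {S : ℕ} {B : CDVBasis S} {d n : ℕ} {P : Measure (Obs d)} {C₁ C₂ : ℝ}
  {p b : (Fin d → ℝ) → ℝ} (h : HasRegressions P C₁ C₂ p b)
include h

/-- Coordinatewise, the mean of a response times a scaling function is the corresponding coefficient
of its regression function. -/
theorem inner_mean_feature (j : ℕ) :
    inner ℝ (∫ o, clip C₁ C₂ o.A • B.feature j o ∂P) (∫ o, clip C₁ C₂ o.Y • B.feature j o ∂P) =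
      B.projForm j p b := by
  have := h.isProbabilityMeasure
  have key : ∀ (f : Obs d → ℝ) (_ : Measurable f) (m : Fin d → Fin (2 ^ j)),
      (∫ o, clip C₁ C₂ (f o) • B.feature j o ∂P) m =
        ∫ o, clip C₁ C₂ (f o) * B.Phi j m (clampCube o.X) ∂P := fun f hf m => by
    have hi := ((bddMeasurable_clip C₁ C₂ hf).smul (B.bddMeasurable_feature j)).integrable P
    have := (EuclideanSpace.proj (𝕜 := ℝ) m).integral_comp_comm hi
    exact this.symm
  simp only [PiLp.inner_apply, key _ Obs.measurable_A, key _ Obs.measurable_Y,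
    h.integral_A_mul (B.Phi_continuousOn j _), h.integral_Y_mul (B.Phi_continuousOn j _)]
  simp [CDVBasis.projForm, mul_comm]

theorem integral_mul_integral_obsKernel (j : ℕ) :
    ∫ o, clip C₁ C₂ o.A * (∫ o', clip C₁ C₂ o'.Y * B.obsKernel j o o' ∂P) ∂P =
      B.projForm j p b := by
  have e : ∀ o : Obs d, ∫ o', clip C₁ C₂ o'.Y * B.obsKernel j o o' ∂P =
      ∫ z in Icc (0 : Fin d → ℝ) 1, b z * B.kernel j (clampCube o.X) z := fun o =>
    h.integral_Y_mul (B.kernel_continuousOn j _)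
  simp only [e]
  rw [h.integral_A_mul (B.proj_continuousOn j h.continuousOn_right),
    B.projForm_eq_integral j h.continuousOn_left h.continuousOn_right]

theorem integral_mul_integral_obsKernel' (j : ℕ) :
    ∫ o, clip C₁ C₂ o.Y * (∫ o', clip C₁ C₂ o'.A * B.obsKernel j o o' ∂P) ∂P =
      B.projForm j p b := by
  have e : ∀ o : Obs d, ∫ o', clip C₁ C₂ o'.A * B.obsKernel j o o' ∂P =
      ∫ z in Icc (0 : Fin d → ℝ) 1, p z * B.kernel j (clampCube o.X) z := fun o =>
    h.integral_A_mul (B.kernel_continuousOn j _)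
  simp only [e]
  rw [h.integral_Y_mul (B.proj_continuousOn j h.continuousOn_left),
    ← B.projForm_eq_integral j h.continuousOn_right h.continuousOn_left]
  simp only [CDVBasis.projForm, mul_comm]

theorem ae_sample_good : ∀ᵐ ω ∂(sampleLaw n P), ∀ a, (ω a).X ∈ Icc (0 : Fin d → ℝ) 1 ∧
    (ω a).A ∈ Icc C₁ C₂ ∧ (ω a).Y ∈ Icc C₁ C₂ := by
  have := h.isProbabilityMeasure
  exact ae_sampleLaw h.ae_good

omit h in
theorem pHat_eq_fitted {ω : Sample d n} (hω : ∀ a, (ω a).X ∈ Icc (0 : Fin d → ℝ) 1 ∧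
    (ω a).A ∈ Icc C₁ C₂ ∧ (ω a).Y ∈ Icc C₁ C₂) (j : ℕ) (s : Fin 3) {o : Obs d}
    (ho : o.X ∈ Icc (0 : Fin d → ℝ) 1) :
    B.pHat j s ω o.X = fitted (fun o => clip C₁ C₂ o.A) (B.obsKernel j) (subsample s ω) o := by
  simp only [CDVBasis.pHat, fitted, subsample, CDVBasis.obsKernel, clampCube_of_mem ho,
    clip_of_mem (hω _).2.1, clampCube_of_mem (hω _).1]

omit h in
theorem bHat_eq_fitted {ω : Sample d n} (hω : ∀ a, (ω a).X ∈ Icc (0 : Fin d → ℝ) 1 ∧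
    (ω a).A ∈ Icc C₁ C₂ ∧ (ω a).Y ∈ Icc C₁ C₂) (j : ℕ) (s : Fin 3) {o : Obs d}
    (ho : o.X ∈ Icc (0 : Fin d → ℝ) 1) :
    B.bHat j s ω o.X = fitted (fun o => clip C₁ C₂ o.Y) (B.obsKernel j) (subsample s ω) o := by
  simp only [CDVBasis.bHat, fitted, subsample, CDVBasis.obsKernel, clampCube_of_mem ho,
    clip_of_mem (hω _).2.2, clampCube_of_mem (hω _).1]

theorem psiMC_ae_eq (j₁ j₂ : ℕ) : B.psiMC (n := n) j₁ j₂ =ᵐ[sampleLaw n P] fun ω =>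
    (1 / n : ℝ) * ∑ i, clip C₁ C₂ (subsample 1 ω i).A * clip C₁ C₂ (subsample 1 ω i).Y -
    (1 / n : ℝ) * ∑ i, fitted (fun o => clip C₁ C₂ o.A) (B.obsKernel j₁) (subsample 0 ω)
      (subsample 2 ω i) * fitted (fun o => clip C₁ C₂ o.Y) (B.obsKernel j₂) (subsample 0 ω)
      (subsample 2 ω i) := by
  filter_upwards [h.ae_sample_good] with ω hω
  simp only [CDVBasis.psiMC, pHat_eq_fitted hω _ _ (hω _).1, bHat_eq_fitted hω _ _ (hω _).1,
    subsample, clip_of_mem (hω _).2.1, clip_of_mem (hω _).2.2]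

theorem psiIF_ae_eq (j₁ j₂ : ℕ) : B.psiIF (n := n) j₁ j₂ =ᵐ[sampleLaw n P] fun ω =>
    (1 / n : ℝ) * ∑ i, (clip C₁ C₂ (subsample 1 ω i).A -
        fitted (fun o => clip C₁ C₂ o.A) (B.obsKernel j₁) (subsample 0 ω) (subsample 1 ω i)) *
      (clip C₁ C₂ (subsample 1 ω i).Y -
        fitted (fun o => clip C₁ C₂ o.Y) (B.obsKernel j₂) (subsample 0 ω) (subsample 1 ω i)) := by
  filter_upwards [h.ae_sample_good] with ω hω
  simp only [CDVBasis.psiIF, pHat_eq_fitted hω _ _ (hω _).1, bHat_eq_fitted hω _ _ (hω _).1,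
    subsample, clip_of_mem (hω _).2.1, clip_of_mem (hω _).2.2]

/-- The exact integral composes the two kernels, so the finer level disappears; this is why `k_max`
is absent from the variance bound of this estimator. -/
theorem psiINT_ae_eq {j₁ j₂ : ℕ} (h₁ : B.J₀ ≤ j₁) (h₂ : B.J₀ ≤ j₂) :
    B.psiINT (n := n) j₁ j₂ =ᵐ[sampleLaw n P] fun ω =>
    (1 / n : ℝ) * ∑ i, clip C₁ C₂ (subsample 1 ω i).A * clip C₁ C₂ (subsample 1 ω i).Y -
    plugIn (fun o => clip C₁ C₂ o.A) (fun o => clip C₁ C₂ o.Y) (B.feature (min j₁ j₂))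
      (subsample 0 ω) := by
  have := h.isProbabilityMeasure
  obtain ⟨D, hK⟩ := B.exists_kernelBound d
  filter_upwards [h.ae_sample_good] with ω hω
  have hker : ∀ (j : ℕ), ContinuousOn (fun x => B.pHat j 0 ω x * B.bHat j₂ 0 ω x) (Icc 0 1) :=
    fun j => (continuousOn_const.mul (continuousOn_finsetSum _ fun i _ =>
      continuousOn_const.mul (B.kernel_continuousOn j _))).mul (continuousOn_const.mul
      (continuousOn_finsetSum _ fun i _ => continuousOn_const.mul (B.kernel_continuousOn j₂ _)))
  simp only [CDVBasis.psiINT]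
  congr 1
  · simp only [subsample, clip_of_mem (hω _).2.1, clip_of_mem (hω _).2.2]
  · rw [← (hK.kernelPair h h₁ h₂).integral_fitted_mul_fitted, ← integral_X_of_map_eq h.map_X
      (hker j₁)]
    refine integral_congr_ae ?_
    filter_upwards [h.ae_good] with o ho
    rw [clampCube_of_mem ho.1, pHat_eq_fitted hω _ _ ho.1, bHat_eq_fitted hω _ _ ho.1]

end HasRegressions

/-! ### Moment bounds for the three estimators. -/

theorem evariance_le_of_ae_eq_sub {Ω : Type*} [MeasurableSpace Ω] {μ : Measure Ω}
    [IsProbabilityMeasure μ] {T U V : Ω → ℝ} (hT : T =ᵐ[μ] fun ω => U ω - V ω)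
    (hU : BddMeasurable U) (hV : BddMeasurable V) {m q r s : ℝ}
    (hr : ∫ ω, (U ω - m) ^ 2 ∂μ ≤ r) (hs : ∫ ω, (V ω - q) ^ 2 ∂μ ≤ s) :
    evariance T μ ≤ ENNReal.ofReal (2 * r + 2 * s) := by
  refine evariance_le_of_integral_sub_sq_le hT (hU.sub hV) (m - q) ?_
  have m1 := ((BddMeasurable.const 2).mul ((hU.sub (BddMeasurable.const m)).pow 2)).integrable μ
  have m2 := ((BddMeasurable.const 2).mul ((hV.sub (BddMeasurable.const q)).pow 2)).integrable μ
  refine (integral_mono (((((hU.sub hV).sub (BddMeasurable.const _)).pow 2)).integrable μ)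
    (m1.add m2) fun ω => ?_).trans (?_ : _ ≤ 2 * r + 2 * s)
  · simp only [Pi.add_apply]
    nlinarith [sq_nonneg ((U ω - m) + (V ω - q))]
  · rw [integral_add' m1 m2, integral_const_mul, integral_const_mul]
    gcongr

/-- Multiplying the mean square of a summand by `1 / n` produces the last three rates; the
coefficient of `1 / n` is `2 + 160 + 768 = 930`. -/
theorem two_mul_add_le_rate {G n k K : ℝ} (hG : 0 ≤ G) (hn : 0 < n) (hk : 0 ≤ k) (hK : 0 ≤ K) :
    2 * (G / n) + 2 * (2 / n * (40 * G * (1 + K / n + k * K / n ^ 2 + k ^ 2 * K / n ^ 3)) +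
        2 * (192 * G * (1 / n + k ^ 2 / n ^ 2))) ≤
      2000 * G * (1 / n + k ^ 2 / n ^ 2 + K / n ^ 2 + k * K / n ^ 3 + k ^ 2 * K / n ^ 4) := by
  calc _ = G * (930 * (1 / n) + 768 * (k ^ 2 / n ^ 2) + 160 * (K / n ^ 2) +
        160 * (k * K / n ^ 3) + 160 * (k ^ 2 * K / n ^ 4)) := by
        field_simp
        ring
    _ ≤ G * (2000 * (1 / n) + 2000 * (k ^ 2 / n ^ 2) + 2000 * (K / n ^ 2) +
        2000 * (k * K / n ^ 3) + 2000 * (k ^ 2 * K / n ^ 4)) := by gcongr <;> norm_num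
    _ = _ := by ring

theorem evariance_le_of_subsamples {d n : ℕ} {P : Measure (Obs d)} [IsProbabilityMeasure P]
    {f : (Fin n → Obs d) × (Fin n → Obs d) → ℝ} {T U : Sample d n → ℝ} {m q r s : ℝ}
    (hf : BddMeasurable f) (hU : BddMeasurable U)
    (hT : T =ᵐ[sampleLaw n P] fun ω => U ω - f (subsample 0 ω, subsample 2 ω))
    (hr : ∫ ω, (U ω - m) ^ 2 ∂(sampleLaw n P) ≤ r)
    (hs : ∫ z, (f z - q) ^ 2
      ∂((Measure.pi fun _ : Fin n => P).prod (Measure.pi fun _ : Fin n => P)) ≤ s) :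
    evariance T (sampleLaw n P) ≤ ENNReal.ofReal (2 * r + 2 * s) :=
  evariance_le_of_ae_eq_sub hT hU
    (hf.comp ((measurable_subsample 0).prodMk (measurable_subsample 2))) hr
    ((integral_subsample_zero_two ((hf.sub (BddMeasurable.const q)).pow 2)).le.trans hs)

namespace HasRegressions

variable {S : ℕ} {B : CDVBasis S} {d n : ℕ} {P : Measure (Obs d)} {C₁ C₂ : ℝ}
  {p b : (Fin d → ℝ) → ℝ} (h : HasRegressions P C₁ C₂ p b)
include h

omit h in
theorem bddMeasurable_clip_mul_clip : BddMeasurable fun o : Obs d =>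
    clip C₁ C₂ o.A * clip C₁ C₂ o.Y :=
  (bddMeasurable_clip _ _ Obs.measurable_A).mul (bddMeasurable_clip _ _ Obs.measurable_Y)

theorem integral_average_product (hn : 1 ≤ n) : ∫ ω : Sample d n,
    (1 / n : ℝ) * ∑ i, clip C₁ C₂ (subsample 1 ω i).A * clip C₁ C₂ (subsample 1 ω i).Y
      ∂(sampleLaw n P) = ∫ o, clip C₁ C₂ o.A * clip C₁ C₂ o.Y ∂P := by
  have := h.isProbabilityMeasure
  have hm := bddMeasurable_clip_mul_clip (d := d) (C₁ := C₁) (C₂ := C₂)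
  rw [← integral_average hn hm]
  exact integral_subsample_one hm.average

theorem integral_average_product_sub_sq_le (hn : 1 ≤ n) {D : ℝ} (hD : 1 ≤ D) : ∫ ω : Sample d n,
    ((1 / n : ℝ) * ∑ i, clip C₁ C₂ (subsample 1 ω i).A * clip C₁ C₂ (subsample 1 ω i).Y -
      ∫ o, clip C₁ C₂ o.A * clip C₁ C₂ o.Y ∂P) ^ 2 ∂(sampleLaw n P) ≤
      (1 + |C₁| + |C₂|) ^ 4 * D ^ 4 / n := by
  have := h.isProbabilityMeasure
  have hm := bddMeasurable_clip_mul_clip (d := d) (C₁ := C₁) (C₂ := C₂)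
  refine (integral_subsample_one
    ((hm.average (n := n)).sub (BddMeasurable.const _) |>.pow 2)).le.trans ?_
  refine (integral_average_sub_mean_sq_le hn hm).trans ?_
  gcongr
  have hpt : ∀ o : Obs d, (clip C₁ C₂ o.A * clip C₁ C₂ o.Y) ^ 2 ≤
      (1 + |C₁| + |C₂|) ^ 4 * D ^ 4 := fun o => by
    rw [← sq_abs, abs_mul]
    calc _ ≤ ((1 + |C₁| + |C₂|) * (1 + |C₁| + |C₂|)) ^ 2 := pow_le_pow_left₀ (by positivity)
          (mul_le_mul (abs_clip_le _ _ _) (abs_clip_le _ _ _) (abs_nonneg _) (by positivity)) 2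
      _ = (1 + |C₁| + |C₂|) ^ 4 * 1 := by ring
      _ ≤ _ := by
        gcongr
        exact one_le_pow₀ hD
  have := integral_mono ((hm.pow 2).integrable P) (integrable_const _) hpt
  simpa using this

/-- The mean of `A Y K(X, X)` for the kernel of level `j`. -/
theorem abs_diagonal_le {D : ℝ} (hK : B.KernelBound d D) (j : ℕ) :
    |∫ o, clip C₁ C₂ o.A * clip C₁ C₂ o.Y * ‖B.feature j o‖ ^ 2 ∂P| ≤
      (1 + |C₁| + |C₂|) ^ 2 * (D * 2 ^ (j * d)) := by
  have := h.isProbabilityMeasure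
  have hb : ∀ o : Obs d, ‖clip C₁ C₂ o.A * clip C₁ C₂ o.Y * ‖B.feature j o‖ ^ 2‖ ≤
      (1 + |C₁| + |C₂|) ^ 2 * (D * 2 ^ (j * d)) := fun o => by
    rw [norm_mul, norm_mul, CDVBasis.norm_feature_sq, pow_two (1 + |C₁| + |C₂|)]
    exact mul_le_mul (mul_le_mul (abs_clip_le _ _ _) (abs_clip_le _ _ _) (abs_nonneg _)
      (by positivity)) (hK.abs_le j _ (clampCube_mem _) _ (clampCube_mem _)) (norm_nonneg _)
      (by positivity)
  have := norm_integral_le_of_norm_le_const (μ := P) (Filter.Eventually.of_forall hb)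
  simpa using this

/-- A crude bound of order `k` suffices, since this term is divided by `n` where the bound is used.
-/
theorem abs_projForm_le {D : ℝ} (hK : B.KernelBound d D) (j : ℕ) :
    |B.projForm j p b| ≤ (1 + |C₁| + |C₂|) ^ 2 * (D * 2 ^ (j * d)) := by
  have := h.isProbabilityMeasure
  rw [← h.integral_mul_integral_obsKernel j]
  have hC0 : 0 ≤ 1 + |C₁| + |C₂| := by positivity
  have hD0 : 0 ≤ D := by linarith [hK.one_le]
  have hcst : ∀ (f : Obs d → ℝ) (c : ℝ), (∀ o, ‖f o‖ ≤ c) → |∫ o, f o ∂P| ≤ c := fun f c hc => by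
    have := norm_integral_le_of_norm_le_const (μ := P) (Filter.Eventually.of_forall hc)
    simpa using this
  have h1 : ∀ o : Obs d, |∫ o', clip C₁ C₂ o'.Y * B.obsKernel j o o' ∂P| ≤
      (1 + |C₁| + |C₂|) * (D * 2 ^ (j * d)) := fun o => hcst _ _ fun o' => by
    rw [norm_mul]
    exact mul_le_mul (abs_clip_le _ _ _) (hK.abs_le j _ (clampCube_mem _) _ (clampCube_mem _))
      (norm_nonneg _) hC0
  refine hcst _ _ fun o => ?_
  rw [norm_mul, pow_two, mul_assoc]
  exact mul_le_mul (abs_clip_le _ _ _) (h1 o) (abs_nonneg _) hC0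

section Representatives

variable {j₁ j₂ : ℕ}

theorem bddMeasurable_INT (h₁ : B.J₀ ≤ j₁) (h₂ : B.J₀ ≤ j₂) : BddMeasurable fun ω : Sample d n =>
    (1 / n : ℝ) * ∑ i, clip C₁ C₂ (subsample 1 ω i).A * clip C₁ C₂ (subsample 1 ω i).Y -
    plugIn (fun o => clip C₁ C₂ o.A) (fun o => clip C₁ C₂ o.Y) (B.feature (min j₁ j₂))
      (subsample 0 ω) := by
  obtain ⟨D, hK⟩ := B.exists_kernelBound d
  exact ((bddMeasurable_clip_mul_clip (C₁ := C₁) (C₂ := C₂)).average.comp (measurable_subsample 1)).sub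
    ((hK.kernelPair h h₁ h₂).measurable_plugIn.comp (measurable_subsample 0))

theorem bddMeasurable_MC_average (h₁ : B.J₀ ≤ j₁) (h₂ : B.J₀ ≤ j₂) :
    BddMeasurable fun z : (Fin n → Obs d) × (Fin n → Obs d) =>
    (1 / n : ℝ) * ∑ i, fitted (fun o => clip C₁ C₂ o.A) (B.obsKernel j₁) z.1 (z.2 i) *
      fitted (fun o => clip C₁ C₂ o.Y) (B.obsKernel j₂) z.1 (z.2 i) := by
  obtain ⟨D, hK⟩ := B.exists_kernelBound d
  have hk := hK.kernelPair h h₁ h₂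
  exact (BddMeasurable.const _).mul (BddMeasurable.sum _ fun i =>
    (hk.measurable_fitted_left.mul hk.measurable_fitted_right).comp
      (φ := fun z : (Fin n → Obs d) × (Fin n → Obs d) => (z.1, z.2 i)) (by fun_prop))

theorem bddMeasurable_IF_average (h₁ : B.J₀ ≤ j₁) (h₂ : B.J₀ ≤ j₂) :
    BddMeasurable fun z : (Fin n → Obs d) × (Fin n → Obs d) =>
    (1 / n : ℝ) * ∑ i, (clip C₁ C₂ (z.2 i).A -
        fitted (fun o => clip C₁ C₂ o.A) (B.obsKernel j₁) z.1 (z.2 i)) *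
      (clip C₁ C₂ (z.2 i).Y -
        fitted (fun o => clip C₁ C₂ o.Y) (B.obsKernel j₂) z.1 (z.2 i)) := by
  obtain ⟨D, hK⟩ := B.exists_kernelBound d
  have hk := hK.kernelPair h h₁ h₂
  exact (BddMeasurable.const _).mul (BddMeasurable.sum _ fun i =>
    ((((hk.meas_a.comp measurable_snd).sub hk.measurable_fitted_left).mul
      ((hk.meas_y.comp measurable_snd).sub hk.measurable_fitted_right))).comp
      (φ := fun z : (Fin n → Obs d) × (Fin n → Obs d) => (z.1, z.2 i)) (by fun_prop))

theorem memLp_psiINT (h₁ : B.J₀ ≤ j₁) (h₂ : B.J₀ ≤ j₂) :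
    MemLp (B.psiINT (n := n) j₁ j₂) 2 (sampleLaw n P) := by
  have := h.isProbabilityMeasure
  exact ((h.bddMeasurable_INT h₁ h₂).memLp _ 2).ae_eq (h.psiINT_ae_eq h₁ h₂).symm

theorem memLp_psiMC (h₁ : B.J₀ ≤ j₁) (h₂ : B.J₀ ≤ j₂) :
    MemLp (B.psiMC (n := n) j₁ j₂) 2 (sampleLaw n P) := by
  have := h.isProbabilityMeasure
  exact ((((bddMeasurable_clip_mul_clip (C₁ := C₁) (C₂ := C₂)).average.comp (measurable_subsample 1)).sub
    ((h.bddMeasurable_MC_average h₁ h₂).comp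
      ((measurable_subsample 0).prodMk (measurable_subsample 2)))).memLp _ 2).ae_eq
    (h.psiMC_ae_eq j₁ j₂).symm

theorem memLp_psiIF (h₁ : B.J₀ ≤ j₁) (h₂ : B.J₀ ≤ j₂) :
    MemLp (B.psiIF (n := n) j₁ j₂) 2 (sampleLaw n P) := by
  have := h.isProbabilityMeasure
  exact (((h.bddMeasurable_IF_average h₁ h₂).comp
      ((measurable_subsample 0).prodMk (measurable_subsample 1))).memLp _ 2).ae_eq
    (h.psiIF_ae_eq j₁ j₂).symm

/-! ### Exact bias -/

/-- The mean of `A Y` cancels between the estimator and the functional, leaving `∫ p b` minus the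
mean of the plug-in statistic. -/
theorem bias_psiINT (hn : 1 ≤ n) (h₁ : B.J₀ ≤ j₁) (h₂ : B.J₀ ≤ j₂) :
    ∫ ω, (B.psiINT (n := n) j₁ j₂ ω - expCondCov P) ∂(sampleLaw n P) =
      (∫ x in Icc (0 : Fin d → ℝ) 1, p x * b x) - B.projForm (min j₁ j₂) p b - (1 / n : ℝ) *
        ((∫ o, clip C₁ C₂ o.A * clip C₁ C₂ o.Y * ‖B.feature (min j₁ j₂) o‖ ^ 2 ∂P) -
          B.projForm (min j₁ j₂) p b) := by
  have := h.isProbabilityMeasure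
  obtain ⟨D, hK⟩ := B.exists_kernelBound d
  have hk := hK.kernelPair h h₁ h₂
  rw [integral_sub ((h.memLp_psiINT h₁ h₂).integrable (by norm_num)) (integrable_const _),
    integral_congr_ae (h.psiINT_ae_eq h₁ h₂), integral_sub
    (((bddMeasurable_clip_mul_clip (C₁ := C₁) (C₂ := C₂)).average.comp (measurable_subsample 1)).integrable _)
    ((hk.measurable_plugIn.comp (measurable_subsample 0)).integrable _),
    h.integral_average_product hn, integral_subsample_zero hk.measurable_plugIn,
    hk.integral_plugIn hn, h.inner_mean_feature, h.expCondCov_eq]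
  simp only [integral_const, probReal_univ, one_smul]
  ring

/-- Given the fitted functions, the Monte Carlo average is unbiased for the integral it replaces. -/
theorem bias_psiMC (hn : 1 ≤ n) (h₁ : B.J₀ ≤ j₁) (h₂ : B.J₀ ≤ j₂) :
    ∫ ω, (B.psiMC (n := n) j₁ j₂ ω - expCondCov P) ∂(sampleLaw n P) =
      (∫ x in Icc (0 : Fin d → ℝ) 1, p x * b x) - B.projForm (min j₁ j₂) p b - (1 / n : ℝ) *
        ((∫ o, clip C₁ C₂ o.A * clip C₁ C₂ o.Y * ‖B.feature (min j₁ j₂) o‖ ^ 2 ∂P) -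
          B.projForm (min j₁ j₂) p b) := by
  have := h.isProbabilityMeasure
  obtain ⟨D, hK⟩ := B.exists_kernelBound d
  have hk := hK.kernelPair h h₁ h₂
  have hF := hk.measurable_fitted_left (n := n) |>.mul hk.measurable_fitted_right
  have hmean : ∫ z, (1 / n : ℝ) * ∑ i, fitted (fun o => clip C₁ C₂ o.A) (B.obsKernel j₁) z.1
      (z.2 i) * fitted (fun o => clip C₁ C₂ o.Y) (B.obsKernel j₂) z.1 (z.2 i)
      ∂((Measure.pi fun _ : Fin n => P).prod (Measure.pi fun _ : Fin n => P)) =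
      ∫ ω, plugIn (fun o => clip C₁ C₂ o.A) (fun o => clip C₁ C₂ o.Y) (B.feature (min j₁ j₂)) ω
        ∂(Measure.pi fun _ : Fin n => P) := by
    rw [integral_prod _ ((h.bddMeasurable_MC_average h₁ h₂).integrable _)]
    refine integral_congr_ae (Filter.Eventually.of_forall fun ω => ?_)
    simp only
    rw [integral_average hn (hF.right ω)]
    exact hk.integral_fitted_mul_fitted ω
  have hsub := integral_subsample_zero_two (P := P) (h.bddMeasurable_MC_average (n := n) h₁ h₂)
  simp only at hsub
  rw [integral_sub ((h.memLp_psiMC h₁ h₂).integrable (by norm_num)) (integrable_const _),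
    integral_congr_ae (h.psiMC_ae_eq j₁ j₂), integral_sub
    (((bddMeasurable_clip_mul_clip (C₁ := C₁) (C₂ := C₂)).average.comp (measurable_subsample 1)).integrable _)
    (((h.bddMeasurable_MC_average h₁ h₂).comp
      ((measurable_subsample 0).prodMk (measurable_subsample 2))).integrable _),
    h.integral_average_product hn, hsub, hmean, hk.integral_plugIn hn, h.inner_mean_feature,
    h.expCondCov_eq]
  simp only [integral_const, probReal_univ, one_smul]
  ring

-- This cancellation moves the approximation error of the bias-corrected estimator from the coarser
-- to the finer level.
omit h in
theorem projForm_add_projForm_min_max (j₁ j₂ : ℕ) : B.projForm j₁ p b + B.projForm j₂ p b =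
    B.projForm (min j₁ j₂) p b + B.projForm (max j₁ j₂) p b := by
  rcases le_total j₁ j₂ with hj | hj
  · rw [min_eq_left hj, max_eq_right hj]
  · rw [min_eq_right hj, max_eq_left hj, add_comm]

/-- The mixed terms contribute minus the forms at both levels and the product of the fits
contributes plus the form at the coarser level, so minus the form at the finer level remains. The
diagonal noise enters with the opposite sign to that of the plug-in estimators. -/
theorem bias_psiIF (hn : 1 ≤ n) (h₁ : B.J₀ ≤ j₁) (h₂ : B.J₀ ≤ j₂) :
    ∫ ω, (B.psiIF (n := n) j₁ j₂ ω - expCondCov P) ∂(sampleLaw n P) =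
      (∫ x in Icc (0 : Fin d → ℝ) 1, p x * b x) - B.projForm (max j₁ j₂) p b + (1 / n : ℝ) *
        ((∫ o, clip C₁ C₂ o.A * clip C₁ C₂ o.Y * ‖B.feature (min j₁ j₂) o‖ ^ 2 ∂P) -
          B.projForm (min j₁ j₂) p b) := by
  have := h.isProbabilityMeasure
  obtain ⟨D, hK⟩ := B.exists_kernelBound d
  have hk := hK.kernelPair h h₁ h₂
  have hF : BddMeasurable fun z : (Fin n → Obs d) × Obs d => (clip C₁ C₂ z.2.A -
        fitted (fun o => clip C₁ C₂ o.A) (B.obsKernel j₁) z.1 z.2) *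
      (clip C₁ C₂ z.2.Y - fitted (fun o => clip C₁ C₂ o.Y) (B.obsKernel j₂) z.1 z.2) :=
    ((hk.meas_a.comp measurable_snd).sub hk.measurable_fitted_left).mul
      ((hk.meas_y.comp measurable_snd).sub hk.measurable_fitted_right)
  have hsub := integral_subsample_zero_one (P := P) (h.bddMeasurable_IF_average (n := n) h₁ h₂)
  simp only at hsub
  have hmean := hk.integral_integral_influence_summand hn
  rw [integral_sub ((h.memLp_psiIF h₁ h₂).integrable (by norm_num)) (integrable_const _),
    integral_congr_ae (h.psiIF_ae_eq j₁ j₂), hsub,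
    integral_prod _ ((h.bddMeasurable_IF_average h₁ h₂).integrable _)]
  have e : ∀ ω : Fin n → Obs d, ∫ ω', (1 / n : ℝ) * ∑ i, (clip C₁ C₂ (ω' i).A -
        fitted (fun o => clip C₁ C₂ o.A) (B.obsKernel j₁) ω (ω' i)) *
      (clip C₁ C₂ (ω' i).Y -
        fitted (fun o => clip C₁ C₂ o.Y) (B.obsKernel j₂) ω (ω' i))
        ∂(Measure.pi fun _ : Fin n => P) = _ := fun ω => integral_average hn (hF.right ω)
  simp only [e]
  rw [hmean, h.inner_mean_feature, h.integral_mul_integral_obsKernel,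
    h.integral_mul_integral_obsKernel', h.expCondCov_eq]
  have := projForm_add_projForm_min_max (B := B) (p := p) (b := b) j₁ j₂
  simp only [integral_const, probReal_univ, one_smul]
  linarith

/-! ### Variance bounds -/

theorem evariance_psiINT_le {D : ℝ} (hK : B.KernelBound d D) (hn : 1 ≤ n) (h₁ : B.J₀ ≤ j₁)
    (h₂ : B.J₀ ≤ j₂) : evariance (B.psiINT (n := n) j₁ j₂) (sampleLaw n P) ≤
      ENNReal.ofReal (2000 * ((1 + |C₁| + |C₂|) ^ 4 * D ^ 4) *
        (1 / n + min ((2 : ℝ) ^ (j₁ * d)) (2 ^ (j₂ * d)) ^ 2 / n ^ 2)) := by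
  have := h.isProbabilityMeasure
  have hn0 : (0 : ℝ) < n := by exact_mod_cast hn
  have hD := hK.one_le
  have hk := hK.kernelPair h h₁ h₂
  have b1 := h.integral_average_product_sub_sq_le hn hD
  have b2 := hk.integral_plugIn_sub_sq_le hn
  set k := min ((2 : ℝ) ^ (j₁ * d)) (2 ^ (j₂ * d)) with hkdef
  set G := (1 + |C₁| + |C₂|) ^ 4 * D ^ 4 with hG
  have hG0 : 0 ≤ G := by positivity
  set m := ∫ o, clip C₁ C₂ o.A * clip C₁ C₂ o.Y ∂P
  set q : ℝ := inner ℝ (∫ o, clip C₁ C₂ o.A • B.feature (min j₁ j₂) o ∂P)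
    (∫ o, clip C₁ C₂ o.Y • B.feature (min j₁ j₂) o ∂P)
  refine (evariance_le_of_ae_eq_sub (h.psiINT_ae_eq h₁ h₂)
    ((bddMeasurable_clip_mul_clip (C₁ := C₁) (C₂ := C₂)).average.comp (measurable_subsample 1))
    (hk.measurable_plugIn.comp (measurable_subsample 0)) b1
    ((integral_subsample_zero (((hk.measurable_plugIn (n := n)).sub
      (BddMeasurable.const q)).pow 2)).le.trans b2)).trans (ENNReal.ofReal_le_ofReal ?_)
  calc 2 * (G / n) + 2 * (192 * G * (1 / n + k ^ 2 / n ^ 2))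
    _ = G * (386 * (1 / n) + 384 * (k ^ 2 / n ^ 2)) := by ring
    _ ≤ G * (2000 * (1 / n) + 2000 * (k ^ 2 / n ^ 2)) := by gcongr <;> norm_num
    _ = _ := by ring

/-- Condition on the fitted functions: the conditional mean is the plug-in statistic, and the
sampling error is governed by the mean square of one summand. -/
theorem integral_MC_average_sub_sq_le {D : ℝ} (hK : B.KernelBound d D) (hn : 1 ≤ n)
    (h₁ : B.J₀ ≤ j₁) (h₂ : B.J₀ ≤ j₂) {k K : ℝ} (hk' : k = min ((2 : ℝ) ^ (j₁ * d)) (2 ^ (j₂ * d)))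
    (hK' : K = max ((2 : ℝ) ^ (j₁ * d)) (2 ^ (j₂ * d))) :
    ∫ z, ((1 / n : ℝ) * ∑ i, fitted (fun o => clip C₁ C₂ o.A) (B.obsKernel j₁) z.1 (z.2 i) *
      fitted (fun o => clip C₁ C₂ o.Y) (B.obsKernel j₂) z.1 (z.2 i) -
      (inner ℝ (∫ o, clip C₁ C₂ o.A • B.feature (min j₁ j₂) o ∂P)
        (∫ o, clip C₁ C₂ o.Y • B.feature (min j₁ j₂) o ∂P) : ℝ)) ^ 2
      ∂((Measure.pi fun _ : Fin n => P).prod (Measure.pi fun _ : Fin n => P)) ≤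
      2 / n * (40 * ((1 + |C₁| + |C₂|) ^ 4 * D ^ 4) *
          (1 + K / n + k * K / n ^ 2 + k ^ 2 * K / n ^ 3)) +
        2 * (192 * ((1 + |C₁| + |C₂|) ^ 4 * D ^ 4) * (1 / n + k ^ 2 / n ^ 2)) := by
  have := h.isProbabilityMeasure
  have hk := hK.kernelPair h h₁ h₂
  have b2 := hk.integral_plugIn_sub_sq_le hn
  have b3 := hk.integral_integral_plugIn_summand_sq_le hn
  have hF := hk.measurable_fitted_left (n := n) |>.mul hk.measurable_fitted_right
  have b4 := integral_average_sub_sq_le (P := P) (μ := Measure.pi fun _ : Fin n => P) hn hF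
    (inner ℝ (∫ o, clip C₁ C₂ o.A • B.feature (min j₁ j₂) o ∂P)
      (∫ o, clip C₁ C₂ o.Y • B.feature (min j₁ j₂) o ∂P))
  simp only [hk.integral_fitted_mul_fitted] at b4
  subst hk' hK'
  refine b4.trans (add_le_add (mul_le_mul_of_nonneg_left b3 (by positivity))
    (mul_le_mul_of_nonneg_left b2 (by norm_num)))

theorem evariance_psiMC_le {D : ℝ} (hK : B.KernelBound d D) (hn : 1 ≤ n) (h₁ : B.J₀ ≤ j₁)
    (h₂ : B.J₀ ≤ j₂) : evariance (B.psiMC (n := n) j₁ j₂) (sampleLaw n P) ≤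
      ENNReal.ofReal (2000 * ((1 + |C₁| + |C₂|) ^ 4 * D ^ 4) *
        (1 / n + min ((2 : ℝ) ^ (j₁ * d)) (2 ^ (j₂ * d)) ^ 2 / n ^ 2 +
          max ((2 : ℝ) ^ (j₁ * d)) (2 ^ (j₂ * d)) / n ^ 2 +
          min ((2 : ℝ) ^ (j₁ * d)) (2 ^ (j₂ * d)) * max ((2 : ℝ) ^ (j₁ * d)) (2 ^ (j₂ * d)) /
            n ^ 3 +
          min ((2 : ℝ) ^ (j₁ * d)) (2 ^ (j₂ * d)) ^ 2 *
            max ((2 : ℝ) ^ (j₁ * d)) (2 ^ (j₂ * d)) / n ^ 4)) := by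
  have := h.isProbabilityMeasure
  exact (evariance_le_of_subsamples (h.bddMeasurable_MC_average h₁ h₂)
    ((bddMeasurable_clip_mul_clip (C₁ := C₁) (C₂ := C₂)).average.comp (measurable_subsample 1))
    (h.psiMC_ae_eq j₁ j₂) (h.integral_average_product_sub_sq_le hn hK.one_le)
    (h.integral_MC_average_sub_sq_le hK hn h₁ h₂ rfl rfl)).trans (ENNReal.ofReal_le_ofReal
      (two_mul_add_le_rate (by positivity) (by exact_mod_cast hn) (by positivity) (by positivity)))

/-- The residual products form one average given the fitted functions, so no separate term for the
mean of `A Y` is needed. -/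
theorem evariance_psiIF_le {D : ℝ} (hK : B.KernelBound d D) (hn : 1 ≤ n) (h₁ : B.J₀ ≤ j₁)
    (h₂ : B.J₀ ≤ j₂) : evariance (B.psiIF (n := n) j₁ j₂) (sampleLaw n P) ≤
      ENNReal.ofReal (2000 * ((1 + |C₁| + |C₂|) ^ 4 * D ^ 4) *
        (1 / n + min ((2 : ℝ) ^ (j₁ * d)) (2 ^ (j₂ * d)) ^ 2 / n ^ 2 +
          max ((2 : ℝ) ^ (j₁ * d)) (2 ^ (j₂ * d)) / n ^ 2 +
          min ((2 : ℝ) ^ (j₁ * d)) (2 ^ (j₂ * d)) * max ((2 : ℝ) ^ (j₁ * d)) (2 ^ (j₂ * d)) /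
            n ^ 3 +
          min ((2 : ℝ) ^ (j₁ * d)) (2 ^ (j₂ * d)) ^ 2 *
            max ((2 : ℝ) ^ (j₁ * d)) (2 ^ (j₂ * d)) / n ^ 4)) := by
  have := h.isProbabilityMeasure
  have hn0 : (0 : ℝ) < n := by exact_mod_cast hn
  have hk := hK.kernelPair h h₁ h₂
  have hF : BddMeasurable fun z : (Fin n → Obs d) × Obs d => (clip C₁ C₂ z.2.A -
        fitted (fun o => clip C₁ C₂ o.A) (B.obsKernel j₁) z.1 z.2) *
      (clip C₁ C₂ z.2.Y - fitted (fun o => clip C₁ C₂ o.Y) (B.obsKernel j₂) z.1 z.2) :=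
    ((hk.meas_a.comp measurable_snd).sub hk.measurable_fitted_left).mul
      ((hk.meas_y.comp measurable_snd).sub hk.measurable_fitted_right)
  have b2 := hk.integral_influence_summand_sub_sq_le hn
  have b3 := hk.integral_integral_influence_summand_sq_le hn
  set k := min ((2 : ℝ) ^ (j₁ * d)) (2 ^ (j₂ * d)) with hkdef
  set K := max ((2 : ℝ) ^ (j₁ * d)) (2 ^ (j₂ * d)) with hKdef
  have hk0 : 0 < k := by positivity
  have hK0 : 0 < K := by positivity
  set G := (1 + |C₁| + |C₂|) ^ 4 * D ^ 4 with hG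
  have hG0 : 0 ≤ G := by positivity
  generalize (∫ o, clip C₁ C₂ o.A * clip C₁ C₂ o.Y ∂P) -
    (∫ o, clip C₁ C₂ o.A * (∫ o', clip C₁ C₂ o'.Y * B.obsKernel j₁ o o' ∂P) ∂P) -
    (∫ o, clip C₁ C₂ o.Y * (∫ o', clip C₁ C₂ o'.A * B.obsKernel j₂ o o' ∂P) ∂P) +
    inner ℝ (∫ o, clip C₁ C₂ o.A • B.feature (min j₁ j₂) o ∂P)
      (∫ o, clip C₁ C₂ o.Y • B.feature (min j₁ j₂) o ∂P) = q at b2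
  have b4 := integral_average_sub_sq_le (P := P) (μ := Measure.pi fun _ : Fin n => P) hn hF q
  have m2 := ((h.bddMeasurable_IF_average (n := n) h₁ h₂).sub (BddMeasurable.const q)).pow 2
  refine evariance_le_of_integral_sub_sq_le (h.psiIF_ae_eq j₁ j₂)
    ((h.bddMeasurable_IF_average h₁ h₂).comp
      ((measurable_subsample 0).prodMk (measurable_subsample 1))) q ?_
  refine (integral_subsample_zero_one (P := P) m2).le.trans (b4.trans ?_)
  calc _ ≤ 2 / n * (200 * G * (1 + K / n + k * K / n ^ 2 + k ^ 2 * K / n ^ 3)) +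
        2 * (600 * G * (1 / n + k ^ 2 / n ^ 2)) := by gcongr
    _ = G * (1600 * (1 / n) + 1200 * (k ^ 2 / n ^ 2) + 400 * (K / n ^ 2) + 400 * (k * K / n ^ 3) +
        400 * (k ^ 2 * K / n ^ 4)) := by
        field_simp
        ring
    _ ≤ G * (2000 * (1 / n) + 2000 * (k ^ 2 / n ^ 2) + 2000 * (K / n ^ 2) +
        2000 * (k * K / n ^ 3) + 2000 * (k ^ 2 * K / n ^ 4)) := by gcongr <;> norm_num
    _ = _ := by ring

end Representatives

end HasRegressions

/-! ### Symmetric two-point laws with prescribed regression functions -/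

section TwoPoint

variable {d : ℕ}

/-- The map `x ↦ (x, p x + η, b x + η)`, with `x` clamped to the cube in `p` and `b`. -/
def shiftedGraph (p b : (Fin d → ℝ) → ℝ) (η : ℝ) (x : Fin d → ℝ) : Obs d :=
  (x, p (clampCube x) + η, b (clampCube x) + η)

/-- The law of `(X, p X + ε η, b X + ε η)` with `X` uniform on the cube and an independent random
sign `ε`. -/
def twoPointLaw (p b : (Fin d → ℝ) → ℝ) (η : ℝ) : Measure (Obs d) :=
  (2⁻¹ : ℝ≥0∞) • (volume.restrict (Icc (0 : Fin d → ℝ) 1)).map (shiftedGraph p b η) +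
    (2⁻¹ : ℝ≥0∞) • (volume.restrict (Icc (0 : Fin d → ℝ) 1)).map (shiftedGraph p b (-η))

variable {p b : (Fin d → ℝ) → ℝ} {η : ℝ}

theorem measurable_shiftedGraph (hp : ContinuousOn p (Icc 0 1)) (hb : ContinuousOn b (Icc 0 1))
    (η : ℝ) : Measurable (shiftedGraph p b η) :=
  measurable_id.prodMk ((hp.comp_clampCube.measurable.add_const η).prodMk
    (hb.comp_clampCube.measurable.add_const η))

theorem integral_twoPointLaw (hp : ContinuousOn p (Icc 0 1)) (hb : ContinuousOn b (Icc 0 1))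
    {F : Obs d → ℝ} (hF : Measurable F)
    (h : ∀ η : ℝ, IntegrableOn (fun x => F (shiftedGraph p b η x)) (Icc 0 1)) :
    Integrable F (twoPointLaw p b η) ∧ ∫ o, F o ∂(twoPointLaw p b η) =
      2⁻¹ * (∫ x in Icc (0 : Fin d → ℝ) 1, F (shiftedGraph p b η x)) +
      2⁻¹ * ∫ x in Icc (0 : Fin d → ℝ) 1, F (shiftedGraph p b (-η) x) := by
  have hm := measurable_shiftedGraph hp hb
  have hi : ∀ η : ℝ, Integrable F ((2⁻¹ : ℝ≥0∞) •
      (volume.restrict (Icc (0 : Fin d → ℝ) 1)).map (shiftedGraph p b η)) := fun η =>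
    ((integrable_map_measure hF.aestronglyMeasurable (hm η).aemeasurable).2 (h η)).smul_measure
      (by simp)
  refine ⟨(hi η).add_measure (hi (-η)), ?_⟩
  rw [twoPointLaw, integral_add_measure (hi η) (hi (-η)), integral_smul_measure,
    integral_smul_measure, integral_map (hm η).aemeasurable hF.aestronglyMeasurable,
    integral_map (hm (-η)).aemeasurable hF.aestronglyMeasurable]
  simp

theorem ae_twoPointLaw (hp : ContinuousOn p (Icc 0 1)) (hb : ContinuousOn b (Icc 0 1))
    {q : Obs d → Prop} (hq : MeasurableSet {o | q o})
    (h1 : ∀ x ∈ Icc (0 : Fin d → ℝ) 1, q (shiftedGraph p b η x))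
    (h2 : ∀ x ∈ Icc (0 : Fin d → ℝ) 1, q (shiftedGraph p b (-η) x)) :
    ∀ᵐ o ∂(twoPointLaw p b η), q o := by
  have hm := measurable_shiftedGraph hp hb
  have key : ∀ η : ℝ, (∀ x ∈ Icc (0 : Fin d → ℝ) 1, q (shiftedGraph p b η x)) →
      ∀ᵐ o ∂((2⁻¹ : ℝ≥0∞) • (volume.restrict (Icc (0 : Fin d → ℝ) 1)).map (shiftedGraph p b η)),
        q o := fun η h => by
    refine Measure.ae_smul_measure ?_ _
    rw [ae_map_iff (hm η).aemeasurable hq]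
    filter_upwards [ae_restrict_mem measurableSet_Icc] with x hx using h x hx
  rw [twoPointLaw, ae_add_measure_iff]
  exact ⟨key _ h1, key _ h2⟩

theorem map_X_twoPointLaw (hp : ContinuousOn p (Icc 0 1)) (hb : ContinuousOn b (Icc 0 1)) :
    (twoPointLaw p b η).map Obs.X = volume.restrict (Icc (0 : Fin d → ℝ) 1) := by
  have hm := measurable_shiftedGraph hp hb
  have hid : ∀ η : ℝ, (Obs.X ∘ shiftedGraph p b η) = id := fun _ => rfl
  rw [twoPointLaw, Measure.map_add _ _ Obs.measurable_X, Measure.map_smul, Measure.map_smul,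
    Measure.map_map Obs.measurable_X (hm η), Measure.map_map Obs.measurable_X (hm (-η)), hid, hid,
    Measure.map_id, ← add_smul, ENNReal.inv_two_add_inv_two, one_smul]

theorem isProbabilityMeasure_twoPointLaw (hp : ContinuousOn p (Icc 0 1))
    (hb : ContinuousOn b (Icc 0 1)) : IsProbabilityMeasure (twoPointLaw p b η) := by
  have h := map_X_twoPointLaw (η := η) hp hb
  have : IsProbabilityMeasure ((twoPointLaw p b η).map Obs.X) := by
    rw [h]
    infer_instance
  exact Measure.isProbabilityMeasure_of_map Obs.X

/-- On each event determined by the covariates the two signs average out. The candidate is the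
clamped function, measurable on the whole space. -/
theorem condExp_twoPointLaw (hp : ContinuousOn p (Icc 0 1)) (hb : ContinuousOn b (Icc 0 1))
    {f : Obs d → ℝ} (hf : Measurable f) {q : (Fin d → ℝ) → ℝ} (hq : ContinuousOn q (Icc 0 1))
    (hfq : ∀ η x, f (shiftedGraph p b η x) = q (clampCube x) + η) :
    (twoPointLaw p b η)[f | Obs.sigmaX d] =ᵐ[twoPointLaw p b η] fun o => q o.X := by
  have := isProbabilityMeasure_twoPointLaw (η := η) hp hb
  have hcl : (fun o : Obs d => q (clampCube o.X)) =ᵐ[twoPointLaw p b η] fun o => q o.X := by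
    filter_upwards [ae_X_mem_of_map_eq (map_X_twoPointLaw (η := η) hp hb)] with o ho
    rw [clampCube_of_mem ho]
  refine Filter.EventuallyEq.trans (Filter.EventuallyEq.symm ?_) hcl
  have hqc : ContinuousOn (fun x => q (clampCube x)) (Icc 0 1) := hq.comp_clampCube.continuousOn
  have hfi : ∀ η : ℝ, IntegrableOn (fun x => f (shiftedGraph p b η x)) (Icc 0 1) := fun η => by
    simp only [hfq]
    exact (hqc.add continuousOn_const).integrableOn_cube
  have hqm : Measurable fun o : Obs d => q (clampCube o.X) :=
    hq.comp_clampCube.measurable.comp Obs.measurable_X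
  have hqi : ∀ η : ℝ, IntegrableOn (fun x => q (clampCube (shiftedGraph p b η x).X)) (Icc 0 1) :=
    fun η => hqc.integrableOn_cube
  refine ae_eq_condExp_of_forall_setIntegral_eq sigmaX_le
    (integral_twoPointLaw hp hb hf hfi).1
    (fun s _ _ => (integral_twoPointLaw hp hb hqm hqi).1.integrableOn) ?_
    (hq.comp_clampCube.stronglyMeasurable.comp_measurable
      (comap_measurable _)).aestronglyMeasurable
  rintro s ⟨t, ht, rfl⟩ -
  have hms : MeasurableSet (Obs.X ⁻¹' t : Set (Obs d)) := Obs.measurable_X ht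
  have hind : ∀ (g : Obs d → ℝ) (η : ℝ) (x : Fin d → ℝ),
      (Obs.X ⁻¹' t).indicator g (shiftedGraph p b η x) =
        t.indicator (fun x => g (shiftedGraph p b η x)) x := fun g η x => rfl
  have hi1 : ∀ η : ℝ, IntegrableOn (fun x => (Obs.X ⁻¹' t).indicator f (shiftedGraph p b η x))
      (Icc 0 1) := fun η => by
    simp only [hind]
    exact (hfi η).indicator ht
  have hi2 : ∀ η : ℝ, IntegrableOn (fun x => (Obs.X ⁻¹' t).indicator
      (fun o => q (clampCube o.X)) (shiftedGraph p b η x)) (Icc 0 1) := fun η => by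
    simp only [hind]
    exact (hqi η).indicator ht
  rw [← integral_indicator hms, ← integral_indicator hms,
    (integral_twoPointLaw hp hb (hqm.indicator hms) hi2).2,
    (integral_twoPointLaw hp hb (hf.indicator hms) hi1).2, ← mul_add, ← mul_add,
    ← integral_add (hi2 η) (hi2 (-η)), ← integral_add (hi1 η) (hi1 (-η))]
  congr 1
  refine integral_congr_ae (Filter.Eventually.of_forall fun x => ?_)
  by_cases hx : x ∈ t
  · simp only [hind, indicator_of_mem hx, hfq]
    simp only [shiftedGraph, Obs.X]
    ring
  · simp only [hind, indicator_of_notMem hx]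

variable {C₁ C₂ : ℝ}

/-- The two-point law has the prescribed regression functions. -/
theorem hasRegressions_twoPointLaw (hp : ContinuousOn p (Icc 0 1)) (hb : ContinuousOn b (Icc 0 1))
    (hpC : ∀ x ∈ Icc (0 : Fin d → ℝ) 1, p x ∈ Icc (C₁ + |η|) (C₂ - |η|))
    (hbC : ∀ x ∈ Icc (0 : Fin d → ℝ) 1, b x ∈ Icc (C₁ + |η|) (C₂ - |η|)) :
    HasRegressions (twoPointLaw p b η) C₁ C₂ p b where
  isProbabilityMeasure := isProbabilityMeasure_twoPointLaw hp hb
  map_X := map_X_twoPointLaw hp hb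
  mem_Icc := by
    have h : ∀ ζ : ℝ, |ζ| = |η| → ∀ x ∈ Icc (0 : Fin d → ℝ) 1,
        (shiftedGraph p b ζ x).A ∈ Icc C₁ C₂ ∧ (shiftedGraph p b ζ x).Y ∈ Icc C₁ C₂ := by
      intro ζ hζ x hx
      have h1 := hpC x hx
      have h2 := hbC x hx
      rw [← hζ] at h1 h2
      have h3 := le_abs_self ζ
      have h4 := neg_abs_le ζ
      simp only [shiftedGraph, Obs.A, Obs.Y, clampCube_of_mem hx, mem_Icc] at *
      refine ⟨⟨?_, ?_⟩, ?_, ?_⟩ <;> linarith [h1.1, h1.2, h2.1, h2.2]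
    exact ae_twoPointLaw hp hb ((Obs.measurable_A measurableSet_Icc).inter
      (Obs.measurable_Y measurableSet_Icc)) (h η rfl) (h (-η) (abs_neg η))
  continuousOn_left := hp
  continuousOn_right := hb
  condExp_A := condExp_twoPointLaw hp hb Obs.measurable_A hp fun _ _ => rfl
  condExp_Y := condExp_twoPointLaw hp hb Obs.measurable_Y hb fun _ _ => rfl

theorem CDVBasis.kernel_diag_continuousOn {S : ℕ} (B : CDVBasis S) (j : ℕ) :
    ContinuousOn (fun x : Fin d → ℝ => B.kernel j x x) (Icc 0 1) :=
  continuousOn_finsetSum _ fun m _ => (B.Phi_continuousOn j m).mul (B.Phi_continuousOn j m)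

/-- Averaging `(p + η) (b + η)` and `(p - η) (b - η)` gives `p b + η²`: both responses carry the
same sign, so it creates covariance without moving the regressions. -/
theorem integral_diagonal_twoPointLaw {S : ℕ} (B : CDVBasis S) (j : ℕ)
    (hp : ContinuousOn p (Icc 0 1)) (hb : ContinuousOn b (Icc 0 1))
    (hpC : ∀ x ∈ Icc (0 : Fin d → ℝ) 1, p x ∈ Icc (C₁ + |η|) (C₂ - |η|))
    (hbC : ∀ x ∈ Icc (0 : Fin d → ℝ) 1, b x ∈ Icc (C₁ + |η|) (C₂ - |η|)) :
    ∫ o, clip C₁ C₂ o.A * clip C₁ C₂ o.Y * ‖B.feature j o‖ ^ 2 ∂(twoPointLaw p b η) =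
      ∫ x in Icc (0 : Fin d → ℝ) 1, (p x * b x + η ^ 2) * B.kernel j x x := by
  have h := hasRegressions_twoPointLaw hp hb hpC hbC
  have hprob := h.isProbabilityMeasure
  have hk := B.kernel_diag_continuousOn (d := d) j
  have hmeas : Measurable fun o : Obs d => o.A * o.Y * B.kernel j (clampCube o.X) (clampCube o.X) :=
    (Obs.measurable_A.mul Obs.measurable_Y).mul
      (hk.comp_clampCube.measurable.comp Obs.measurable_X)
  have hc : ∀ ζ : ℝ, ContinuousOn (fun x => (p x + ζ) * (b x + ζ) * B.kernel j x x) (Icc 0 1) :=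
    fun ζ => ((hp.add continuousOn_const).mul (hb.add continuousOn_const)).mul hk
  have hval : ∀ ζ : ℝ, ∀ x ∈ Icc (0 : Fin d → ℝ) 1, (shiftedGraph p b ζ x).A *
      (shiftedGraph p b ζ x).Y * B.kernel j (clampCube (shiftedGraph p b ζ x).X)
        (clampCube (shiftedGraph p b ζ x).X) = (p x + ζ) * (b x + ζ) * B.kernel j x x := by
    intro ζ x hx
    simp only [shiftedGraph, Obs.A, Obs.Y, Obs.X, clampCube_of_mem hx]
  have hint : ∀ ζ : ℝ, IntegrableOn (fun x => (shiftedGraph p b ζ x).A *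
      (shiftedGraph p b ζ x).Y * B.kernel j (clampCube (shiftedGraph p b ζ x).X)
        (clampCube (shiftedGraph p b ζ x).X)) (Icc 0 1) := fun ζ =>
    (hc ζ).integrableOn_cube.congr_fun (fun x hx => (hval ζ x hx).symm) measurableSet_Icc
  calc _ = ∫ o, o.A * o.Y * B.kernel j (clampCube o.X) (clampCube o.X) ∂(twoPointLaw p b η) := by
        refine integral_congr_ae ?_
        filter_upwards [h.mem_Icc] with o ho
        rw [clip_of_mem ho.1, clip_of_mem ho.2, CDVBasis.norm_feature_sq]
        rfl
    _ = _ := by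
        rw [(integral_twoPointLaw hp hb hmeas hint).2, setIntegral_congr_fun measurableSet_Icc
          (hval η), setIntegral_congr_fun measurableSet_Icc (hval (-η)), ← mul_add,
          ← integral_add (hc η).integrableOn_cube (hc (-η)).integrableOn_cube,
          ← integral_const_mul]
        refine integral_congr_ae (Filter.Eventually.of_forall fun x => ?_)
        simp only
        ring

end TwoPoint

/-! ### Membership in the model -/

section Model

variable {S : ℕ} {B : CDVBasis S} {d : ℕ} {α β M C₁ C₂ : ℝ} {P : Measure (Obs d)}

theorem exists_hasRegressions_of_mem_model (hP : P ∈ model B d α β M C₁ C₂) :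
    ∃ p ∈ B.holderBall d α M, ∃ b ∈ B.holderBall d β M, HasRegressions P C₁ C₂ p b := by
  obtain ⟨h1, h2, h3, ⟨p, hp, hpc⟩, b, hb, hbc⟩ := hP
  exact ⟨p, hp, b, hb, h1, h2, h3, hp.1.continuousOn, hb.1.continuousOn, hpc, hbc⟩

theorem HasRegressions.mem_model {p b : (Fin d → ℝ) → ℝ} (h : HasRegressions P C₁ C₂ p b)
    (hp : p ∈ B.holderBall d α M) (hb : b ∈ B.holderBall d β M) : P ∈ model B d α β M C₁ C₂ :=
  ⟨h.isProbabilityMeasure, h.map_X, h.mem_Icc, ⟨p, hp, h.condExp_A⟩, b, hb, h.condExp_Y⟩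

end Model

/-! ### The worst-case bias -/

section Bias

variable {S : ℕ} {B : CDVBasis S} {d n : ℕ} {α β M C₁ C₂ σ : ℝ} {j l : ℕ}

/-- The estimator `T` has the bias of a plug-in estimator with approximation error at level `l` and
diagonal error of sign `σ` at level `j`. -/
def HasPlugInBias (B : CDVBasis S) (C₁ C₂ : ℝ) (T : Sample d n → ℝ) (j l : ℕ) (σ : ℝ) : Prop :=
  ∀ ⦃P : Measure (Obs d)⦄ ⦃p b : (Fin d → ℝ) → ℝ⦄, HasRegressions P C₁ C₂ p b →
    ∫ ω, (T ω - expCondCov P) ∂(sampleLaw n P) =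
      (∫ x in Icc (0 : Fin d → ℝ) 1, p x * b x) - B.projForm l p b + σ / n *
        ((∫ o, clip C₁ C₂ o.A * clip C₁ C₂ o.Y * ‖B.feature j o‖ ^ 2 ∂P) - B.projForm j p b)

theorem two_pow_mul_rpow_div (hd : 1 ≤ d) (γ : ℝ) (l : ℕ) :
    ((2 : ℝ) ^ (l * d)) ^ (-γ / d) = ((2 : ℝ) ^ (-γ)) ^ l := by
  have hd0 : (d : ℝ) ≠ 0 := by positivity
  rw [← Real.rpow_natCast, ← Real.rpow_natCast, ← Real.rpow_mul (by norm_num),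
    ← Real.rpow_mul (by norm_num)]
  congr 1
  push_cast
  field_simp

/-- The approximation part is bounded by a geometric tail, and the two parts of the noise are each
of order `2 ^ (j d)` before division by `n`. -/
theorem exists_supBias_le (B : CDVBasis S) (hS : 1 ≤ S) (hd : 1 ≤ d) (hα : 0 < α) (hβ : 0 < β)
    (hM : 0 < M) (C₁ C₂ : ℝ) : ∃ C : ℝ, 0 < C ∧ ∀ n : ℕ, 1 ≤ n → ∀ j l : ℕ, B.J₀ ≤ l →
      ∀ σ : ℝ, |σ| = 1 → ∀ T : Sample d n → ℝ, HasPlugInBias B C₁ C₂ T j l σ →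
        supBias (model B d α β M C₁ C₂) T ≤
          ENNReal.ofReal (C * max (((2 : ℝ) ^ (l * d)) ^ (-(α + β) / d)) (2 ^ (j * d) / n)) := by
  obtain ⟨Ca, hCa, happ⟩ := B.exists_approximation_bound (d := d) hS hα hβ hM.le
  obtain ⟨D, hK⟩ := B.exists_kernelBound d
  have hD := hK.one_le
  refine ⟨Ca + 2 * ((1 + |C₁| + |C₂|) ^ 2 * D), by positivity, ?_⟩
  intro n hn j l hl σ hσ T hT
  refine iSup₂_le fun P hP => ENNReal.ofReal_le_ofReal ?_
  obtain ⟨p, hp, b, hb, h⟩ := exists_hasRegressions_of_mem_model hP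
  have hn0 : (0 : ℝ) < n := by exact_mod_cast hn
  rw [hT h]
  have h1 := happ p hp b hb l hl
  have h2 := (abs_sub _ _).trans (add_le_add (h.abs_diagonal_le hK j) (h.abs_projForm_le hK j))
  rw [← two_pow_mul_rpow_div hd] at h1
  refine (abs_add_le _ _).trans ?_
  rw [abs_mul, abs_div, hσ, Nat.abs_cast]
  set u := ((2 : ℝ) ^ (l * d)) ^ (-(α + β) / d)
  calc _ ≤ Ca * u + 1 / n * ((1 + |C₁| + |C₂|) ^ 2 * (D * 2 ^ (j * d)) +
          (1 + |C₁| + |C₂|) ^ 2 * (D * 2 ^ (j * d))) := by gcongr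
    _ = Ca * u + 2 * ((1 + |C₁| + |C₂|) ^ 2 * D) * (2 ^ (j * d) / n) := by ring
    _ ≤ Ca * max u (2 ^ (j * d) / n) +
        2 * ((1 + |C₁| + |C₂|) ^ 2 * D) * max u (2 ^ (j * d) / n) := by
        gcongr
        · exact le_max_left _ _
        · exact le_max_right _ _
    _ = _ := by ring

/-- A Hölder ball that contains a function with values in `(C₁, C₂)` contains all small bump
perturbations of some function, with values that stay away from `C₁` and `C₂`. -/
theorem exists_bump_perturbation (B : CDVBasis S) (hd : 1 ≤ d) (hα : 0 < α) (hM : 0 < M)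
    (hp : ∃ h ∈ B.holderBall d α M, ∀ x ∈ Icc (0 : Fin d → ℝ) 1, h x ∈ Ioo C₁ C₂) :
    ∃ (g : (Fin d → ℝ) → ℝ) (κ μ : ℝ), ContinuousOn g (Icc 0 1) ∧ 0 < κ ∧ 0 < μ ∧
      ∀ l : ℕ, B.J₀ ≤ l → ∀ s : ℝ, |s| ≤ 1 →
        (fun x => g x + s * (κ * 2 ^ (-((l : ℝ) * (α + d / 2)))) * B.bump d l x) ∈
          B.holderBall d α M ∧
        ∀ x ∈ Icc (0 : Fin d → ℝ) 1,
          g x + s * (κ * 2 ^ (-((l : ℝ) * (α + d / 2)))) * B.bump d l x ∈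
            Icc (C₁ + μ) (C₂ - μ) := by
  obtain ⟨h, hh, hC⟩ := hp
  have hc : ContinuousOn h (Icc 0 1) := hh.1.continuousOn
  obtain ⟨Cb, hCb, hbump⟩ := B.exists_abs_bump_le d
  have hne : (Icc (0 : Fin d → ℝ) 1).Nonempty := ⟨0, left_mem_Icc.2 zero_le_one⟩
  obtain ⟨x₀, hx₀, hmin⟩ := isCompact_Icc.exists_isMinOn hne hc
  obtain ⟨x₁, hx₁, hmax⟩ := isCompact_Icc.exists_isMaxOn hne hc
  -- By compactness, values in the open interval keep a positive distance from both end points.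
  set ν := min (h x₀ - C₁) (C₂ - h x₁) with hν
  have hν0 : 0 < ν := lt_min (sub_pos.2 (hC x₀ hx₀).1) (sub_pos.2 (hC x₁ hx₁).2)
  set Q := 1 + |C₁| + |C₂| with hQ
  have hQ0 : 0 < Q := by positivity
  -- Replacing `h` by `(1 - δ) * h` plus a bump moves values by at most `δ * (Q + M * Cb)`; this
  -- choice makes the move use at most half of the margin `ν`.
  set δ := min 1 (ν / (2 * (Q + M * Cb))) with hδ
  have hMC : 0 < Q + M * Cb := by positivity
  have hδ0 : 0 < δ := lt_min one_pos (by positivity)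
  have hδν : δ * (Q + M * Cb) ≤ ν / 2 := by
    calc _ ≤ ν / (2 * (Q + M * Cb)) * (Q + M * Cb) := by
          gcongr
          exact min_le_right _ _
      _ = ν / 2 := by field_simp
  refine ⟨fun x => (1 - δ) * h x, δ * M, ν / 2, continuousOn_const.mul hc, by positivity,
    by positivity, fun l hl s hs => ⟨?_, fun x hx => ?_⟩⟩
  · refine B.add_bump_mem_holderBall hd hM.le hδ0.le (min_le_left _ _) hh hl ?_
    rw [abs_mul, abs_of_nonneg (by positivity : 0 ≤ δ * M * 2 ^ (-((l : ℝ) * (α + d / 2)))),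
      Real.rpow_neg (by norm_num)]
    have h0 : (0 : ℝ) < 2 ^ ((l : ℝ) * (α + d / 2)) := by positivity
    calc _ = |s| * (δ * M) := by field_simp
      _ ≤ 1 * (δ * M) := by gcongr
      _ = _ := one_mul _
  · have hx0 : h x₀ ≤ h x := hmin hx
    have hx1 : h x ≤ h x₁ := hmax hx
    have hm0 : ν ≤ h x₀ - C₁ := min_le_left _ _
    have hm1 : ν ≤ C₂ - h x₁ := min_le_right _ _
    have hhQ : |h x| ≤ Q := abs_le.2 ⟨by linarith [neg_abs_le C₁, abs_nonneg C₂, (hC x hx).1],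
      by linarith [le_abs_self C₂, abs_nonneg C₁, (hC x hx).2]⟩
    -- The height `2 ^ (l d / 2)` of the bump is beaten by its coefficient, leaving `2 ^ (-l α) ≤
    -- 1`.
    have h1 : |s * (δ * M * 2 ^ (-((l : ℝ) * (α + d / 2)))) * B.bump d l x| ≤ δ * (M * Cb) := by
      rw [abs_mul, abs_mul,
        abs_of_nonneg (by positivity : 0 ≤ δ * M * 2 ^ (-((l : ℝ) * (α + d / 2))))]
      calc _ ≤ 1 * (δ * M * 2 ^ (-((l : ℝ) * (α + d / 2)))) * (Cb * 2 ^ ((l : ℝ) * (d / 2))) := by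
            gcongr
            exact hbump l x hx
        _ = δ * (M * Cb) * (2 ^ (-((l : ℝ) * (α + d / 2))) * 2 ^ ((l : ℝ) * (d / 2))) := by ring
        _ = δ * (M * Cb) * 2 ^ (-((l : ℝ) * α)) := by
            rw [← Real.rpow_add (by norm_num)]
            ring_nf
        _ ≤ δ * (M * Cb) * 1 := by
            gcongr
            exact Real.rpow_le_one_of_one_le_of_nonpos (by norm_num)
              (neg_nonpos.2 (by positivity))
        _ = _ := mul_one _
    have h2 : |δ * h x| ≤ δ * Q := by
      rw [abs_mul, abs_of_pos hδ0]
      gcongr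
    rw [abs_le] at h1 h2
    constructor <;> nlinarith

/-- A bump of level `l` is orthogonal to `V_i` for all `i ≤ l`, so the projections do not see it. -/
theorem CDVBasis.projForm_add_bump (hd : 1 ≤ d) {i : ℕ} (hi : B.J₀ ≤ i) (hil : i ≤ l)
    {p b : (Fin d → ℝ) → ℝ} (hp : ContinuousOn p (Icc 0 1)) (hb : ContinuousOn b (Icc 0 1))
    (ε ε' : ℝ) : B.projForm i (fun x => p x + ε * B.bump d l x)
      (fun x => b x + ε' * B.bump d l x) = B.projForm i p b := by
  have key : ∀ {q : (Fin d → ℝ) → ℝ} (_ : ContinuousOn q (Icc 0 1)) (ε : ℝ) (m),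
      ∫ x in Icc (0 : Fin d → ℝ) 1, (q x + ε * B.bump d l x) * B.Phi i m x =
        ∫ x in Icc (0 : Fin d → ℝ) 1, q x * B.Phi i m x := fun {q} hq ε m => by
    have hΦ := B.Phi_continuousOn (d := d) i m
    simp only [add_mul, mul_assoc]
    rw [integral_add (integrableOn_cube_mul hq hΦ)
      ((integrableOn_cube_mul (B.bump_continuousOn d l) hΦ).const_mul ε), integral_const_mul,
      B.integral_bump_mul_Phi hd hi hil, mul_zero, add_zero]
  simp only [CDVBasis.projForm, key hp, key hb]

theorem integral_bilinear_expand {p b u w : (Fin d → ℝ) → ℝ} (hp : ContinuousOn p (Icc 0 1))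
    (hb : ContinuousOn b (Icc 0 1)) (hu : ContinuousOn u (Icc 0 1))
    (hw : ContinuousOn w (Icc 0 1)) (ε ε' : ℝ) :
    ∫ x in Icc (0 : Fin d → ℝ) 1, (p x + ε * u x) * (b x + ε' * u x) * w x =
      (∫ x in Icc (0 : Fin d → ℝ) 1, p x * b x * w x) +
        ε * (∫ x in Icc (0 : Fin d → ℝ) 1, u x * b x * w x) +
        ε' * (∫ x in Icc (0 : Fin d → ℝ) 1, p x * u x * w x) +
        ε * ε' * ∫ x in Icc (0 : Fin d → ℝ) 1, u x * u x * w x := by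
  have i1 : IntegrableOn (fun x => p x * b x * w x) (Icc 0 1) :=
    ((hp.mul hb).mul hw).integrableOn_cube
  have i2 : IntegrableOn (fun x => ε * (u x * b x * w x)) (Icc 0 1) :=
    (continuousOn_const.mul ((hu.mul hb).mul hw)).integrableOn_cube
  have i3 : IntegrableOn (fun x => ε' * (p x * u x * w x)) (Icc 0 1) :=
    (continuousOn_const.mul ((hp.mul hu).mul hw)).integrableOn_cube
  have i4 : IntegrableOn (fun x => ε * ε' * (u x * u x * w x)) (Icc 0 1) :=
    (continuousOn_const.mul ((hu.mul hu).mul hw)).integrableOn_cube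
  have i12 : IntegrableOn (fun x => p x * b x * w x + ε * (u x * b x * w x)) (Icc 0 1) := i1.add i2
  have i123 : IntegrableOn (fun x => p x * b x * w x + ε * (u x * b x * w x) +
    ε' * (p x * u x * w x)) (Icc 0 1) := i12.add i3
  rw [← integral_const_mul, ← integral_const_mul, ← integral_const_mul, ← integral_add i1 i2,
    ← integral_add i12 i3, ← integral_add i123 i4]
  refine integral_congr_ae (Filter.Eventually.of_forall fun x => ?_)
  simp only
  ring

/-- The bias under a symmetric two-point law. -/
theorem HasPlugInBias.bias_twoPointLaw {T : Sample d n → ℝ} (hT : HasPlugInBias B C₁ C₂ T j l σ)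
    (hj : B.J₀ ≤ j) {p b : (Fin d → ℝ) → ℝ} {η : ℝ} (hp : ContinuousOn p (Icc 0 1))
    (hb : ContinuousOn b (Icc 0 1))
    (hpC : ∀ x ∈ Icc (0 : Fin d → ℝ) 1, p x ∈ Icc (C₁ + |η|) (C₂ - |η|))
    (hbC : ∀ x ∈ Icc (0 : Fin d → ℝ) 1, b x ∈ Icc (C₁ + |η|) (C₂ - |η|)) :
    ∫ ω, (T ω - expCondCov (twoPointLaw p b η)) ∂(sampleLaw n (twoPointLaw p b η)) =
      (∫ x in Icc (0 : Fin d → ℝ) 1, p x * b x * (1 + σ / n * B.kernel j x x)) -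
        B.projForm l p b - σ / n * B.projForm j p b + σ / n * (η ^ 2 * 2 ^ (j * d)) := by
  have hk := B.kernel_diag_continuousOn (d := d) j
  have i0 : IntegrableOn (fun x => p x * b x) (Icc 0 1) := integrableOn_cube_mul hp hb
  have i1 : IntegrableOn (fun x => p x * b x * B.kernel j x x) (Icc 0 1) :=
    ((hp.mul hb).mul hk).integrableOn_cube
  have e1 : ∫ x in Icc (0 : Fin d → ℝ) 1, (p x * b x + η ^ 2) * B.kernel j x x =
      (∫ x in Icc (0 : Fin d → ℝ) 1, p x * b x * B.kernel j x x) + η ^ 2 * 2 ^ (j * d) := by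
    simp only [add_mul]
    rw [integral_add i1 (hk.integrableOn_cube.const_mul _), integral_const_mul,
      B.integral_kernel_diag hj]
  have e2 : ∫ x in Icc (0 : Fin d → ℝ) 1, p x * b x * (1 + σ / n * B.kernel j x x) =
      (∫ x in Icc (0 : Fin d → ℝ) 1, p x * b x) +
        σ / n * ∫ x in Icc (0 : Fin d → ℝ) 1, p x * b x * B.kernel j x x := by
    rw [← integral_const_mul, ← integral_add i0 (i1.const_mul _)]
    refine integral_congr_ae (Filter.Eventually.of_forall fun x => ?_)
    simp only
    ring
  rw [hT (hasRegressions_twoPointLaw hp hb hpC hbC), integral_diagonal_twoPointLaw B j hp hb hpC hbC,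
    e1, e2]
  ring

/-- The bias is affine in `η²` and bilinear in the amplitudes of the two bumps. Differences between
finitely many laws isolate the noise and the approximation error, whatever the remaining terms are.
-/
theorem exists_le_supBias (B : CDVBasis S) (hd : 1 ≤ d) (hα : 0 < α) (hβ : 0 < β) (hM : 0 < M)
    (hp : ∃ h ∈ B.holderBall d α M, ∀ x ∈ Icc (0 : Fin d → ℝ) 1, h x ∈ Ioo C₁ C₂)
    (hb : ∃ h ∈ B.holderBall d β M, ∀ x ∈ Icc (0 : Fin d → ℝ) 1, h x ∈ Ioo C₁ C₂) :
    ∃ c : ℝ, 0 < c ∧ ∀ n : ℕ, 1 ≤ n → ∀ j l : ℕ, B.J₀ ≤ j → j ≤ l →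
      ∀ σ : ℝ, |σ| = 1 → ∀ T : Sample d n → ℝ, HasPlugInBias B C₁ C₂ T j l σ →
        ENNReal.ofReal (c * max (((2 : ℝ) ^ (l * d)) ^ (-(α + β) / d)) (2 ^ (j * d) / n)) ≤
          supBias (model B d α β M C₁ C₂) T := by
  obtain ⟨p, κ, μ, hpc, hκ, hμ, hp⟩ := exists_bump_perturbation B hd hα hM hp
  obtain ⟨b, κ', μ', hbc, hκ', hμ', hb⟩ := exists_bump_perturbation B hd hβ hM hb
  obtain ⟨D, hK⟩ := B.exists_kernelBound d
  have hD := hK.one_le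
  set η := min μ μ' with hη
  have hη0 : 0 < η := lt_min hμ hμ'
  -- The first constant loses a factor `2` to the weight `w ≥ 1 / 2`; the second makes `η² / (4 D)`
  -- times `2 D k / n` equal to the noise bound `η² / 2 * (k / n)`.
  refine ⟨min (κ * κ' / 2) (η ^ 2 / (4 * D)), by positivity, ?_⟩
  intro n hn j l hj hjl σ hσ T hT
  have hn0 : (0 : ℝ) < n := by exact_mod_cast hn
  have hl := hj.trans hjl
  set u := B.bump d l with hu
  have huc : ContinuousOn u (Icc 0 1) := B.bump_continuousOn d l
  set ε := κ * (2 : ℝ) ^ (-((l : ℝ) * (α + d / 2))) with hε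
  set ε' := κ' * (2 : ℝ) ^ (-((l : ℝ) * (β + d / 2))) with hε'
  set k : ℝ := 2 ^ (j * d) with hk
  set r := ((2 : ℝ) ^ (l * d)) ^ (-(α + β) / d) with hr
  set w : (Fin d → ℝ) → ℝ := fun x => 1 + σ / n * B.kernel j x x with hw
  have hkc := B.kernel_diag_continuousOn (d := d) j
  have hwc : ContinuousOn w (Icc 0 1) := continuousOn_const.add (continuousOn_const.mul hkc)
  set Z := ∫ x in Icc (0 : Fin d → ℝ) 1, u x * u x * w x with hZ
  -- A family of admissible laws with explicit bias: signs or zeros `s`, `t` for the two bumps, and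
  -- shift `ζ` of the random sign.
  have hmem : ∀ s t ζ : ℝ, |s| ≤ 1 → |t| ≤ 1 → |ζ| ≤ η →
      ENNReal.ofReal |(∫ x in Icc (0 : Fin d → ℝ) 1, p x * b x * w x) +
        s * ε * (∫ x in Icc (0 : Fin d → ℝ) 1, u x * b x * w x) +
        t * ε' * (∫ x in Icc (0 : Fin d → ℝ) 1, p x * u x * w x) +
        s * ε * (t * ε') * Z - B.projForm l p b - σ / n * B.projForm j p b +
        σ / n * (ζ ^ 2 * k)| ≤ supBias (model B d α β M C₁ C₂) T := by
    intro s t ζ hs ht hζ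
    obtain ⟨hp1, hp2⟩ := hp l hl s hs
    obtain ⟨hb1, hb2⟩ := hb l hl t ht
    have hη1 : η ≤ μ := min_le_left _ _
    have hη2 : η ≤ μ' := min_le_right _ _
    have hp3 := fun x hx => Icc_subset_Icc (by linarith) (by linarith) (hp2 x hx) |>
      fun h : _ ∈ Icc (C₁ + |ζ|) (C₂ - |ζ|) => h
    have hb3 := fun x hx => Icc_subset_Icc (by linarith) (by linarith) (hb2 x hx) |>
      fun h : _ ∈ Icc (C₁ + |ζ|) (C₂ - |ζ|) => h
    have hp4 : ContinuousOn (fun x => p x + s * ε * u x) (Icc 0 1) := hp1.1.continuousOn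
    have hb4 : ContinuousOn (fun x => b x + t * ε' * u x) (Icc 0 1) := hb1.1.continuousOn
    have hbias := hT.bias_twoPointLaw hj hp4 hb4 hp3 hb3
    rw [integral_bilinear_expand hpc hbc huc hwc, CDVBasis.projForm_add_bump hd hl le_rfl hpc hbc,
      CDVBasis.projForm_add_bump hd hj hjl hpc hbc] at hbias
    rw [← hbias]
    exact le_iSup₂ (f := fun P (_ : P ∈ model B d α β M C₁ C₂) =>
      ENNReal.ofReal |∫ ω, (T ω - expCondCov P) ∂(sampleLaw n P)|) _
      ((hasRegressions_twoPointLaw hp4 hb4 hp3 hb3).mem_model hp1 hb1)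
  have hkn0 : 0 < k / n := by positivity
  -- Compare the laws with shifts `η` and `0`: their biases differ by `η² k / n` in absolute value,
  -- so one of them is at least half of that.
  have hnoise : ENNReal.ofReal (η ^ 2 / 2 * (k / n)) ≤ supBias (model B d α β M C₁ C₂) T := by
    have h1 := hmem 0 0 η (by simp) (by simp) (abs_of_pos hη0).le
    have h0 := hmem 0 0 0 (by simp) (by simp) (by simpa using hη0.le)
    simp only [zero_mul, mul_zero, add_zero, ne_eq, OfNat.ofNat_ne_zero, not_false_eq_true,
      zero_pow] at h1 h0
    set z := (∫ x in Icc (0 : Fin d → ℝ) 1, p x * b x * w x) - B.projForm l p b -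
      σ / n * B.projForm j p b
    have hdiff : η ^ 2 * (k / n) ≤ |z + σ / n * (η ^ 2 * k)| + |z| := by
      calc _ = |σ / n * (η ^ 2 * k)| := by
            rw [abs_mul, abs_div, hσ, Nat.abs_cast, abs_of_pos (by positivity)]
            ring
        _ = |(z + σ / n * (η ^ 2 * k)) - z| := by ring_nf
        _ ≤ _ := abs_sub _ _
    rcases le_total (|z + σ / n * (η ^ 2 * k)|) |z| with hz | hz
    · exact (ENNReal.ofReal_le_ofReal (by linarith)).trans h0
    · exact (ENNReal.ofReal_le_ofReal (by linarith)).trans h1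
  have hr1 : r ≤ 1 := Real.rpow_le_one_of_one_le_of_nonpos (one_le_pow₀ (by norm_num))
    (div_nonpos_of_nonpos_of_nonneg (by linarith) (by positivity))
  have hc0 : 0 ≤ min (κ * κ' / 2) (η ^ 2 / (4 * D)) := by positivity
  -- The diagonal noise also acts on the bumps, through the weight `w`. If `k / n` is small, `w ≥ 1
  -- / 2` and the bumps remain visible; otherwise the noise alone is enough.
  rcases le_or_gt (D * (k / n)) (1 / 2) with hsmall | hlarge
  · have happrox : ENNReal.ofReal (κ * κ' / 2 * r) ≤ supBias (model B d α β M C₁ C₂) T := by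
      have hZ2 : 2 ^ (l * d) / 2 ≤ Z := by
        rw [← B.integral_bump_sq (d := d) hl, ← integral_div]
        refine setIntegral_mono_on ((integrableOn_cube_mul huc huc).div_const 2)
          (((huc.mul huc).mul hwc).integrableOn_cube) measurableSet_Icc fun x hx => ?_
        have hwx : 1 / 2 ≤ w x := by
          have h1 : |σ / n * B.kernel j x x| ≤ 1 / 2 := by
            rw [abs_mul, abs_div, hσ, Nat.abs_cast]
            calc _ ≤ 1 / n * (D * k) := by
                  gcongr
                  exact hK.abs_le j x hx x hx
              _ = D * (k / n) := by ring
              _ ≤ _ := hsmall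
          have := (abs_le.1 h1).1
          simp only [hw]
          linarith
        have := mul_le_mul_of_nonneg_left hwx (mul_self_nonneg (u x))
        simp only [hu] at this ⊢
        linarith
      have hεε : κ * κ' / 2 * r ≤ ε * ε' * Z := by
        have h2 : ε * ε' * 2 ^ (l * d) = κ * κ' * r := by
          rw [hr, two_pow_mul_rpow_div hd, ← Real.rpow_natCast, ← Real.rpow_natCast,
            ← Real.rpow_mul (by norm_num), hε, hε', mul_mul_mul_comm, mul_assoc (κ * κ'),
            ← Real.rpow_add (by norm_num), ← Real.rpow_add (by norm_num)]
          congr 2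
          push_cast
          ring
        have h3 : 0 ≤ ε * ε' := by positivity
        nlinarith
      -- In the alternating sum over the four sign patterns the constant and linear terms cancel and
      -- `4 ε ε' Z` remains, so the four biases cannot all be below `ε ε' Z`.
      have h11 := hmem 1 1 0 (by simp) (by simp) (by simpa using hη0.le)
      have h12 := hmem 1 (-1) 0 (by simp) (by simp) (by simpa using hη0.le)
      have h21 := hmem (-1) 1 0 (by simp) (by simp) (by simpa using hη0.le)
      have h22 := hmem (-1) (-1) 0 (by simp) (by simp) (by simpa using hη0.le)
      by_contra hlt
      push Not at hlt
      have g11 := lt_of_le_of_lt h11 hlt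
      have g12 := lt_of_le_of_lt h12 hlt
      have g21 := lt_of_le_of_lt h21 hlt
      have g22 := lt_of_le_of_lt h22 hlt
      have hpos : 0 < κ * κ' / 2 * r := by positivity
      rw [ENNReal.ofReal_lt_ofReal_iff hpos, abs_lt] at g11 g12 g21 g22
      linarith [g11.2, g12.1, g21.1, g22.2]
    rcases le_total r (k / n) with h | h
    · rw [max_eq_right h]
      refine (ENNReal.ofReal_le_ofReal (mul_le_mul_of_nonneg_right
        ((min_le_right _ _).trans ?_) hkn0.le)).trans hnoise
      gcongr
      linarith
    · rw [max_eq_left h]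
      exact (ENNReal.ofReal_le_ofReal (mul_le_mul_of_nonneg_right (min_le_left _ _)
        (hkn0.le.trans h))).trans happrox
  · refine (ENNReal.ofReal_le_ofReal ?_).trans hnoise
    -- Here `r ≤ 1 < 2 * D * (k / n)`, so the noise rate dominates up to a constant.
    have hmax : max r (k / n) ≤ 2 * D * (k / n) :=
      max_le (by linarith) (by nlinarith)
    calc _ ≤ η ^ 2 / (4 * D) * (2 * D * (k / n)) := by
          gcongr
          exact min_le_right _ _
      _ = _ := by
          field_simp
          ring

end Bias

end

/-! ### Assembly of the three statements. -/

theorem max_two_pow_mul (j₁ j₂ d : ℕ) :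
    max ((2 : ℝ) ^ (j₁ * d)) (2 ^ (j₂ * d)) = 2 ^ (max j₁ j₂ * d) := by
  rcases le_total j₁ j₂ with h | h
  · rw [max_eq_right h, max_eq_right (pow_le_pow_right₀ one_le_two (Nat.mul_le_mul_right d h))]
  · rw [max_eq_left h, max_eq_left (pow_le_pow_right₀ one_le_two (Nat.mul_le_mul_right d h))]

theorem theorem2 {S : ℕ} (B : CDVBasis S) (hS : 1 ≤ S) (d : ℕ) (hd : 1 ≤ d)
    (α β M C₁ C₂ : ℝ) (hα : 0 < α) (hβ : 0 < β) (hαS : α < S) (hβS : β < S) (hM : 0 < M)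
    (hp : ∃ h ∈ B.holderBall d α M, ∀ x ∈ Icc (0 : Fin d → ℝ) 1, h x ∈ Ioo C₁ C₂)
    (hb : ∃ h ∈ B.holderBall d β M, ∀ x ∈ Icc (0 : Fin d → ℝ) 1, h x ∈ Ioo C₁ C₂) :
    ∃ c : ℝ, 0 < c ∧ ∃ C : ℝ, 0 < C ∧ ∀ n : ℕ, 1 ≤ n → ∀ j₁ j₂ : ℕ, B.J₀ ≤ j₁ → B.J₀ ≤ j₂ →
      ∀ k₁ k₂ kmin kmax : ℝ, k₁ = 2 ^ (j₁ * d) → k₂ = 2 ^ (j₂ * d) →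
        kmin = min k₁ k₂ → kmax = max k₁ k₂ →
      -- the integral-based plug-in estimator
      (SquareIntegrableOver (model B d α β M C₁ C₂) (B.psiINT (n := n) j₁ j₂) ∧
        ENNReal.ofReal (c * max (kmin ^ (-(α + β) / d)) (kmin / n)) ≤
          supBias (model B d α β M C₁ C₂) (B.psiINT (n := n) j₁ j₂) ∧
        supBias (model B d α β M C₁ C₂) (B.psiINT (n := n) j₁ j₂) ≤
          ENNReal.ofReal (C * max (kmin ^ (-(α + β) / d)) (kmin / n)) ∧
        supVar (model B d α β M C₁ C₂) (B.psiINT (n := n) j₁ j₂) ≤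
          ENNReal.ofReal (C * (1 / n + kmin ^ 2 / n ^ 2))) ∧
      -- the Monte Carlo-based plug-in estimator
      (SquareIntegrableOver (model B d α β M C₁ C₂) (B.psiMC (n := n) j₁ j₂) ∧
        ENNReal.ofReal (c * max (kmin ^ (-(α + β) / d)) (kmin / n)) ≤
          supBias (model B d α β M C₁ C₂) (B.psiMC (n := n) j₁ j₂) ∧
        supBias (model B d α β M C₁ C₂) (B.psiMC (n := n) j₁ j₂) ≤
          ENNReal.ofReal (C * max (kmin ^ (-(α + β) / d)) (kmin / n)) ∧
        supVar (model B d α β M C₁ C₂) (B.psiMC (n := n) j₁ j₂) ≤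
          ENNReal.ofReal (C * (1 / n + kmin ^ 2 / n ^ 2 + kmax / n ^ 2 +
            kmin * kmax / n ^ 3 + kmin ^ 2 * kmax / n ^ 4))) ∧
      -- the first-order bias-corrected estimator
      (SquareIntegrableOver (model B d α β M C₁ C₂) (B.psiIF (n := n) j₁ j₂) ∧
        ENNReal.ofReal (c * max (kmax ^ (-(α + β) / d)) (kmin / n)) ≤
          supBias (model B d α β M C₁ C₂) (B.psiIF (n := n) j₁ j₂) ∧
        supBias (model B d α β M C₁ C₂) (B.psiIF (n := n) j₁ j₂) ≤
          ENNReal.ofReal (C * max (kmax ^ (-(α + β) / d)) (kmin / n)) ∧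
        supVar (model B d α β M C₁ C₂) (B.psiIF (n := n) j₁ j₂) ≤
          ENNReal.ofReal (C * (1 / n + kmin ^ 2 / n ^ 2 + kmax / n ^ 2 +
            kmin * kmax / n ^ 3 + kmin ^ 2 * kmax / n ^ 4))) := by 
  obtain ⟨c, hc, hlow⟩ := exists_le_supBias B hd hα hβ hM hp hb
  obtain ⟨C, hC, hup⟩ := exists_supBias_le B hS hd hα hβ hM C₁ C₂
  obtain ⟨D, hK⟩ := B.exists_kernelBound d
  have hD := hK.one_le
  set V := 2000 * ((1 + |C₁| + |C₂|) ^ 4 * D ^ 4) with hV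
  -- One upper constant for biases and variances: `C` from the bias bound, `V` from the variance
  -- bounds.
  refine ⟨c, hc, max C V, lt_max_of_lt_left hC, ?_⟩
  intro n hn j₁ j₂ h₁ h₂ k₁ k₂ kmin kmax hk₁ hk₂ hkmin hkmax
  have hn0 : (0 : ℝ) < n := by exact_mod_cast hn
  have hmin : (2 : ℝ) ^ (min j₁ j₂ * d) = kmin := by rw [hkmin, hk₁, hk₂, CDVBasis.min_two_pow_mul]
  have hmax : (2 : ℝ) ^ (max j₁ j₂ * d) = kmax := by rw [hkmax, hk₁, hk₂, max_two_pow_mul]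
  have hkmin0 : 0 < kmin := hmin ▸ by positivity
  have hkmax0 : 0 < kmax := hmax ▸ by positivity
  subst hk₁ hk₂
  have hj : B.J₀ ≤ min j₁ j₂ := le_min h₁ h₂
  have hj' : B.J₀ ≤ max j₁ j₂ := le_max_of_le_left h₁
  have hjj : min j₁ j₂ ≤ max j₁ j₂ := min_le_max
  have hCle : ∀ r : ℝ, 0 ≤ r → ENNReal.ofReal (C * r) ≤ ENNReal.ofReal (max C V * r) :=
    fun r hr => ENNReal.ofReal_le_ofReal (mul_le_mul_of_nonneg_right (le_max_left _ _) hr)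
  have hVle : ∀ r : ℝ, 0 ≤ r → ENNReal.ofReal (V * r) ≤ ENNReal.ofReal (max C V * r) :=
    fun r hr => ENNReal.ofReal_le_ofReal (mul_le_mul_of_nonneg_right (le_max_right _ _) hr)
  have hrate : ∀ x : ℝ, 0 ≤ max x (kmin / n) := fun x => le_max_of_le_right (by positivity)
  -- The diagonal noise sits at the coarser level for all three estimators; what differs is its sign
  -- and the level of the approximation error.
  have hINT : HasPlugInBias B C₁ C₂ (B.psiINT (d := d) (n := n) j₁ j₂) (min j₁ j₂) (min j₁ j₂)
      (-1) := fun P p b h => by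
    rw [h.bias_psiINT hn h₁ h₂]
    ring
  have hMC : HasPlugInBias B C₁ C₂ (B.psiMC (d := d) (n := n) j₁ j₂) (min j₁ j₂) (min j₁ j₂)
      (-1) := fun P p b h => by
    rw [h.bias_psiMC hn h₁ h₂]
    ring
  have hIF : HasPlugInBias B C₁ C₂ (B.psiIF (d := d) (n := n) j₁ j₂) (min j₁ j₂) (max j₁ j₂)
      1 := fun P p b h => h.bias_psiIF hn h₁ h₂
  have hs : |(-1 : ℝ)| = 1 := by simp
  have lINT := hlow n hn _ _ hj le_rfl _ hs _ hINT
  have uINT := hup n hn _ _ hj _ hs _ hINT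
  have lMC := hlow n hn _ _ hj le_rfl _ hs _ hMC
  have uMC := hup n hn _ _ hj _ hs _ hMC
  have lIF := hlow n hn _ _ hj hjj _ abs_one _ hIF
  have uIF := hup n hn _ _ hj' _ abs_one _ hIF
  rw [hmin] at lINT uINT lMC uMC
  rw [hmin, hmax] at lIF uIF
  refine ⟨⟨fun P hP => ?_, lINT, uINT.trans (hCle _ (hrate _)), iSup₂_le fun P hP => ?_⟩,
    ⟨fun P hP => ?_, lMC, uMC.trans (hCle _ (hrate _)), iSup₂_le fun P hP => ?_⟩,
    ⟨fun P hP => ?_, lIF, uIF.trans (hCle _ (hrate _)), iSup₂_le fun P hP => ?_⟩⟩ <;>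
    obtain ⟨p, -, b, -, h⟩ := exists_hasRegressions_of_mem_model hP
  · exact h.memLp_psiINT h₁ h₂
  · have := h.evariance_psiINT_le hK hn h₁ h₂
    rw [← hkmin] at this
    exact this.trans (hVle _ (by positivity))
  · exact h.memLp_psiMC h₁ h₂
  · have := h.evariance_psiMC_le hK hn h₁ h₂
    rw [← hkmin, ← hkmax] at this
    exact this.trans (hVle _ (by positivity))
  · exact h.memLp_psiIF h₁ h₂
  · have := h.evariance_psiIF_le hK hn h₁ h₂
    rw [← hkmin, ← hkmax] at this
    exact this.trans (hVle _ (by positivity))
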